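/- **Setting.** Let $\mathcal A$ be a category with a site $\mathcal T$: a collection of families $(U_i\to X)_i$, called covers, which contains the isomorphisms, whose members have pullbacks along arbitrary arrows, and which is stable under base change and under composition of covers. Assume that $\mathcal T$ is subcanonical (representable presheaves are sheaves) and satisfies effective descent: for every cover of $X$ the descent functor from $\mathcal A/X$ to the category of descent data of the cover is an equivalence. Let $\mathcal E$ be the class of admissible epimorphisms, i.e. the largest class of epimorphisms $S\to X$ which have local lifts $U_i\to S$ over some cover $(U_i\to X)_i$, which have pullbacks along arbitrary arrows, and which is stable under these pullbacks. An *internal groupoid* $\mathcal G$ is a groupoid in $\mathcal A$, with object of objects $\mathcal G_0$, object of arrows $\mathcal G_1$, source $s$ and range $r$, such that $r\in\mathcal E$. A *strict arrow* $f:\mathcal H\to\mathcal G$ is a pair $f_0:\mathcal H_0\to\mathcal G_0$, $f_1:\mathcal H_1\to\mathcal G_1$ compatible with $s$, $r$, multiplication and inversion. Let $\mathcal G^I$ be the internal groupoid of functors $I\to\mathcal G$, where $I$ is the interval groupoid (two objects, uniquely isomorphic): its objects are the arrows of $\mathcal G$ and its arrows are the commutative squares in $\mathcal G$. It has the two evaluations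 $e_0,e_1:\mathcal G^I\to\mathcal G$ and the degeneracy $t:\mathcal G\to\mathcal G^I$. A *right homotopy* from $\varphi$ to $\psi:\mathcal K\to\mathcal G$ is a strict arrow $H:\mathcal K\to\mathcal G^I$ with $e_0H=\varphi$ and $e_1H=\psi$. A *strong homotopy* is a finite composable sequence of $n\ge 0$ right homotopies. *Homotopy* of strong homotopies (with fixed ends) is the congruence with respect to concatenation generated by: the constant right homotopy $t\varphi$ is trivial, and the two ways around the boundary of any $\Theta:\mathcal K\to(\mathcal G^I)^I$ agree. $\mathcal{AHG}_2$ is the bicategory whose objects are the internal groupoids, whose 1-cells are the strict arrows, and whose 2-cells are the homotopy classes of strong homotopies. A strict arrow $h$ is a *strong homotopy equivalence* if it has an inverse up to strong homotopy. A strict arrow $\epsilon:\mathcal H\to\mathcal G$ is an *essential equivalence* if $r\circ\mathrm{pr}_1:\mathcal G_1\times_{s,\mathcal G_0,\epsilon_0}\mathcal H_0\to\mathcal G_0$ is in $\mathcal E$ and $\epsilon$ is fully faithful: given $x,y:T\to\mathcal H_0$ and $\gamma:T\to\mathcal G_1$ with $s\gamma=\epsilon_0x$ and $r\gamma=\epsilon_0y$,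 there is exactly one $\eta:T\to\mathcal H_1$ with $s\eta=x$, $r\eta=y$, $\epsilon_1\eta=\gamma$ (if $\mathcal A$ has binary products, this says that $\mathcal H_1$ is the pullback of $(s,r):\mathcal G_1\to\mathcal G_0\times\mathcal G_0$ along $\epsilon_0\times\epsilon_0$). A strict arrow $\eta:\mathcal K\to\mathcal G$ is an *essential homotopy equivalence* if there are a strong homotopy equivalence $h:\mathcal K\to\mathcal L$ and an essential equivalence $\epsilon:\mathcal L\to\mathcal G$ such that $\epsilon h$ is strongly homotopic to $\eta$. Let $W$ be the class of essential homotopy equivalences. **Proposition.** (1) $W$ admits a bicalculus of fractions in $\mathcal{AHG}_2$: * every equivalence of $\mathcal{AHG}_2$ is in $W$; * $W$ is closed under composition; * for $w:a\to b$ in $W$ and $f:c\to b$ there are $w':p\to c$ in $W$ and $f':p\to a$ with an invertible 2-cell $f w'\cong w f'$; * for $w:b\to c$ in $W$, $f,g:a\to b$ and a 2-cell $\alpha:wf\Rightarrow wg$ there are $v:p\to a$ in $W$ and a 2-cell $\beta:fv\Rightarrow gv$ with $\alpha v=w\beta$ (up to associativity), and such that $\beta$ is invertible if $\alpha$ is.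 If $(v,\beta)$ and $(v',\beta')$ are any two pairs with $v,v'\in W$, $\alpha v=w\beta$ and $\alpha v'=w\beta'$, then there are $u,u'$ with $vu,v'u'\in W$ and an invertible 2-cell $\varepsilon:vu\cong v'u'$ with $(g\varepsilon)\circ(\beta u)=(\beta'u')\circ(f\varepsilon)$; * $W$ is closed under invertible 2-cells. (2) The localization $U:\mathcal{AHG}_2\to\mathcal{AHG}_2[W^{-1}]$ exists: there are a bicategory $\mathcal{AHG}_2[W^{-1}]$ and a pseudofunctor $U$ to it which sends the 1-cells in $W$ to equivalences and is universal with this property. That is, for every bicategory $\mathcal D$, each pseudofunctor $F:\mathcal{AHG}_2\to\mathcal D$ sending the 1-cells in $W$ to equivalences is equivalent, in the bicategory of pseudofunctors, to $G\circ U$ for some pseudofunctor $G:\mathcal{AHG}_2[W^{-1}]\to\mathcal D$; and for all pseudofunctors $G,G':\mathcal{AHG}_2[W^{-1}]\to\mathcal D$ composition with $U$ is an equivalence between the categories of pseudonatural transformations (and modifications) $G\to G'$ and $G\circ U\to G'\circ U$. -/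

import Mathlib

open CategoryTheory Limits

universe w₁ w₂ w₃ v₁ v₂ v₃ u₁ u₂ u₃ v u w

namespace IntGpd

/-! ### Cocylinders, strong homotopies, and the bicategory of homotopy classes -/

/-- A cocylinder on a category: a path functor `Y ↦ Y^I` with two faces and a degeneracy. -/
structure Cocylinder (A : Type u) [Category.{v} A] where
  path : A ⥤ A
  e₀ : path ⟶ 𝟭 A
  e₁ : path ⟶ 𝟭 A
  t : 𝟭 A ⟶ path
  t_e₀ : t ≫ e₀ = 𝟙 (𝟭 A)
  t_e₁ : t ≫ e₁ = 𝟙 (𝟭 A)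

namespace Cocylinder

variable {A : Type u} [Category.{v} A] (P : Cocylinder A)

/-- A right homotopy from `f` to `g`: an arrow `H : X ⟶ Y^I` with `e₀ ∘ H = f` and
`e₁ ∘ H = g`. -/
@[ext]
structure Homotopy {X Y : A} (f g : X ⟶ Y) where
  map : X ⟶ P.path.obj Y
  map_e₀ : map ≫ P.e₀.app Y = f
  map_e₁ : map ≫ P.e₁.app Y = g

/-- A strong homotopy from `f` to `g`: a finite sequence of composable right homotopies. -/
inductive StrongHomotopy {X Y : A} : (X ⟶ Y) → (X ⟶ Y) → Type v
  | nil (f : X ⟶ Y) : StrongHomotopy f f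
  | cons {f g h : X ⟶ Y} (H : P.Homotopy f g) (p : StrongHomotopy g h) : StrongHomotopy f h

variable {P}

namespace StrongHomotopy

variable {X Y : A} {f g h k : X ⟶ Y}

/-- The number of right homotopies in a strong homotopy. -/
def length {f g : X ⟶ Y} : P.StrongHomotopy f g → ℕ
  | nil _ => 0
  | cons _ p => p.length + 1

/-- Concatenation of strong homotopies. -/
def comp {f g h : X ⟶ Y} : P.StrongHomotopy f g → P.StrongHomotopy g h → P.StrongHomotopy f h
  | nil _, q => q
  | cons H p, q => cons H (p.comp q)

/-- One right homotopy, as a strong homotopy. -/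
def single (H : P.Homotopy f g) : P.StrongHomotopy f g := cons H (nil g)

lemma comp_nil (p : P.StrongHomotopy f g) : p.comp (nil g) = p := by
  induction p with
  | nil => rfl
  | cons H p ih => exact congrArg (cons H) ih

lemma comp_assoc (p : P.StrongHomotopy f g) (q : P.StrongHomotopy g h)
    (r : P.StrongHomotopy h k) : (p.comp q).comp r = p.comp (q.comp r) := by
  induction p with
  | nil => rfl
  | cons H p ih => exact congrArg (cons H) (ih q)

/-- The relation generating homotopy (relative to the end points) of strong homotopies: a constant
right homotopy may be left out, and the two ways around the boundary of a two-dimensional homotopy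
`Θ : X ⟶ (Y^I)^I` agree. -/
inductive Rel : ∀ {f g : X ⟶ Y}, P.StrongHomotopy f g → P.StrongHomotopy f g → Prop
  | const {f : X ⟶ Y} (H : P.Homotopy f f) (hH : H.map = f ≫ P.t.app Y) :
      Rel (single H) (nil f)
  | square (Θ : X ⟶ P.path.obj (P.path.obj Y)) {a b c d : X ⟶ Y}
      (H₀ : P.Homotopy a b) (H₁ : P.Homotopy c d) (K₀ : P.Homotopy a c) (K₁ : P.Homotopy b d)
      (h₀ : H₀.map = Θ ≫ P.e₀.app (P.path.obj Y)) (h₁ : H₁.map = Θ ≫ P.e₁.app (P.path.obj Y))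
      (k₀ : K₀.map = Θ ≫ P.path.map (P.e₀.app Y)) (k₁ : K₁.map = Θ ≫ P.path.map (P.e₁.app Y)) :
      Rel ((single H₀).comp (single K₁)) ((single K₀).comp (single H₁))
  | comp_left {f g h : X ⟶ Y} (p : P.StrongHomotopy f g) {q q' : P.StrongHomotopy g h} :
      Rel q q' → Rel (p.comp q) (p.comp q')
  | comp_right {f g h : X ⟶ Y} {p p' : P.StrongHomotopy f g} (q : P.StrongHomotopy g h) :
      Rel p p' → Rel (p.comp q) (p'.comp q)

end StrongHomotopy

open StrongHomotopy

variable (P)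

/-- `f` and `g` are right homotopic. -/
def RightHomotopic {X Y : A} (f g : X ⟶ Y) : Prop := Nonempty (P.Homotopy f g)

/-- The relation `f ∼ₙ g`: there is a strong homotopy consisting of `n` right homotopies. -/
def HomotopicIn (n : ℕ) {X Y : A} (f g : X ⟶ Y) : Prop :=
  ∃ H : P.StrongHomotopy f g, H.length = n

/-- `f` and `g` are strongly homotopic: `f ∼ₙ g` for some `n`. -/
def StronglyHomotopic {X Y : A} (f g : X ⟶ Y) : Prop := ∃ n : ℕ, P.HomotopicIn n f g

/-- Strong homotopy equivalences: arrows with an inverse up to strong homotopy. -/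
def IsStrongHomotopyEquivalence {X Y : A} (f : X ⟶ Y) : Prop :=
  ∃ g : Y ⟶ X, P.StronglyHomotopic (f ≫ g) (𝟙 X) ∧ P.StronglyHomotopic (g ≫ f) (𝟙 Y)

/-- Homotopy classes (relative to the end points) of strong homotopies. -/
def HomotopyClass {X Y : A} (f g : X ⟶ Y) : Type v :=
  Quot (StrongHomotopy.Rel (P := P) (f := f) (g := g))

variable {P}

namespace HomotopyClass

variable {X Y : A} {f g h k : X ⟶ Y}

/-- The class of a strong homotopy. -/
def mk (p : P.StrongHomotopy f g) : P.HomotopyClass f g := Quot.mk _ p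

/-- Concatenation of homotopy classes. -/
def comp (η : P.HomotopyClass f g) (θ : P.HomotopyClass g h) : P.HomotopyClass f h :=
  Quot.map₂ StrongHomotopy.comp (fun p _ _ h => .comp_left p h) (fun _ _ q h => .comp_right q h) η θ

lemma comp_assoc (η : P.HomotopyClass f g) (θ : P.HomotopyClass g h) (ι : P.HomotopyClass h k) :
    (η.comp θ).comp ι = η.comp (θ.comp ι) := by
  obtain ⟨p⟩ := η; obtain ⟨q⟩ := θ; obtain ⟨r⟩ := ι
  exact congrArg mk (StrongHomotopy.comp_assoc p q r)

end HomotopyClass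

/-- The arrows `X ⟶ Y`, as the objects of a category. -/
structure Arrows (P : Cocylinder A) (X Y : A) : Type v where
  arrow : X ⟶ Y

/-- The category of arrows `X ⟶ Y` and homotopy classes of strong homotopies. -/
instance (X Y : A) : Category.{v} (P.Arrows X Y) where
  Hom f g := P.HomotopyClass f.arrow g.arrow
  id f := .mk (.nil f.arrow)
  comp η θ := η.comp θ
  id_comp := by rintro _ _ ⟨p⟩; rfl
  comp_id := by rintro _ _ ⟨p⟩; exact congrArg HomotopyClass.mk p.comp_nil
  assoc := HomotopyClass.comp_assoc

variable (P)

/-- An operation taking homotopies between arrows `X ⟶ Y` to homotopies between arrows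
`X' ⟶ Y'`; used for the two whiskering operations. -/
@[ext]
structure Whisker (X Y X' Y' : A) where
  fn : (X ⟶ Y) → (X' ⟶ Y')
  fnPath : (X ⟶ P.path.obj Y) → (X' ⟶ P.path.obj Y')
  fnPath_e₀ : ∀ m, fnPath m ≫ P.e₀.app Y' = fn (m ≫ P.e₀.app Y)
  fnPath_e₁ : ∀ m, fnPath m ≫ P.e₁.app Y' = fn (m ≫ P.e₁.app Y)
  fnPath_t : ∀ f, fnPath (f ≫ P.t.app Y) = fn f ≫ P.t.app Y'
  fnSquare : ∀ Θ : X ⟶ P.path.obj (P.path.obj Y), ∃ Θ' : X' ⟶ P.path.obj (P.path.obj Y'),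
    fnPath (Θ ≫ P.e₀.app (P.path.obj Y)) = Θ' ≫ P.e₀.app (P.path.obj Y') ∧
    fnPath (Θ ≫ P.e₁.app (P.path.obj Y)) = Θ' ≫ P.e₁.app (P.path.obj Y') ∧
    fnPath (Θ ≫ P.path.map (P.e₀.app Y)) = Θ' ≫ P.path.map (P.e₀.app Y') ∧
    fnPath (Θ ≫ P.path.map (P.e₁.app Y)) = Θ' ≫ P.path.map (P.e₁.app Y')

variable {P}

namespace Whisker

variable {X Y X' Y' X'' Y'' : A}

/-- The action on right homotopies. -/
def mapHomotopy (W : P.Whisker X Y X' Y') {f g : X ⟶ Y} (H : P.Homotopy f g) :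
    P.Homotopy (W.fn f) (W.fn g) where
  map := W.fnPath H.map
  map_e₀ := by rw [W.fnPath_e₀, H.map_e₀]
  map_e₁ := by rw [W.fnPath_e₁, H.map_e₁]

/-- The action on strong homotopies. -/
def mapStrong (W : P.Whisker X Y X' Y') {f g : X ⟶ Y} :
    P.StrongHomotopy f g → P.StrongHomotopy (W.fn f) (W.fn g)
  | .nil f => .nil (W.fn f)
  | .cons H p => .cons (W.mapHomotopy H) (W.mapStrong p)

lemma mapStrong_comp (W : P.Whisker X Y X' Y') {f g h : X ⟶ Y} (p : P.StrongHomotopy f g)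
    (q : P.StrongHomotopy g h) :
    W.mapStrong (p.comp q) = (W.mapStrong p).comp (W.mapStrong q) := by
  induction p with
  | nil => rfl
  | cons H p ih => exact congrArg (StrongHomotopy.cons _) (ih q)

lemma mapStrong_rel (W : P.Whisker X Y X' Y') {f g : X ⟶ Y} {p q : P.StrongHomotopy f g}
    (h : p.Rel q) : (W.mapStrong p).Rel (W.mapStrong q) := by
  induction h with
  | const H hH => exact .const _ ((congrArg W.fnPath hH).trans (W.fnPath_t _))
  | square Θ H₀ H₁ K₀ K₁ h₀ h₁ k₀ k₁ =>
    obtain ⟨Θ', h₀', h₁', k₀', k₁'⟩ := W.fnSquare Θ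
    exact .square Θ' (W.mapHomotopy H₀) (W.mapHomotopy H₁) (W.mapHomotopy K₀) (W.mapHomotopy K₁)
      ((congrArg W.fnPath h₀).trans h₀') ((congrArg W.fnPath h₁).trans h₁')
      ((congrArg W.fnPath k₀).trans k₀') ((congrArg W.fnPath k₁).trans k₁')
  | comp_left p _ ih => rw [mapStrong_comp, mapStrong_comp]; exact .comp_left _ ih
  | comp_right q _ ih => rw [mapStrong_comp, mapStrong_comp]; exact .comp_right _ ih

/-- The action on homotopy classes. -/
def mapClass (W : P.Whisker X Y X' Y') {f g : X ⟶ Y} (η : P.HomotopyClass f g) :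
    P.HomotopyClass (W.fn f) (W.fn g) :=
  Quot.map W.mapStrong (fun _ _ h => W.mapStrong_rel h) η

lemma mapClass_comp (W : P.Whisker X Y X' Y') {f g h : X ⟶ Y} (η : P.HomotopyClass f g)
    (θ : P.HomotopyClass g h) : W.mapClass (η.comp θ) = (W.mapClass η).comp (W.mapClass θ) := by
  obtain ⟨p⟩ := η; obtain ⟨q⟩ := θ
  exact congrArg HomotopyClass.mk (W.mapStrong_comp p q)

/-- The identity operation. -/
def id (X Y : A) : P.Whisker X Y X Y where
  fn f := f
  fnPath m := m
  fnPath_e₀ _ := rfl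
  fnPath_e₁ _ := rfl
  fnPath_t _ := rfl
  fnSquare Θ := ⟨Θ, rfl, rfl, rfl, rfl⟩

/-- Composition of operations. -/
def comp (W : P.Whisker X Y X' Y') (V : P.Whisker X' Y' X'' Y'') : P.Whisker X Y X'' Y'' where
  fn f := V.fn (W.fn f)
  fnPath m := V.fnPath (W.fnPath m)
  fnPath_e₀ m := by rw [V.fnPath_e₀, W.fnPath_e₀]
  fnPath_e₁ m := by rw [V.fnPath_e₁, W.fnPath_e₁]
  fnPath_t f := by rw [W.fnPath_t, V.fnPath_t]
  fnSquare Θ := by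
    obtain ⟨Θ', h₀, h₁, k₀, k₁⟩ := W.fnSquare Θ
    obtain ⟨Θ'', h₀', h₁', k₀', k₁'⟩ := V.fnSquare Θ'
    exact ⟨Θ'', by rw [h₀, h₀'], by rw [h₁, h₁'], by rw [k₀, k₀'], by rw [k₁, k₁']⟩

/-- Precomposition with an arrow. -/
def pre {X' X : A} (a : X' ⟶ X) (Y : A) : P.Whisker X Y X' Y where
  fn f := a ≫ f
  fnPath m := a ≫ m
  fnPath_e₀ _ := Category.assoc _ _ _
  fnPath_e₁ _ := Category.assoc _ _ _
  fnPath_t _ := (Category.assoc _ _ _).symm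
  fnSquare Θ := ⟨a ≫ Θ, by simp only [Category.assoc], by simp only [Category.assoc],
    by simp only [Category.assoc], by simp only [Category.assoc]⟩

/-- Postcomposition with an arrow. -/
def post (X : A) {Y Y' : A} (b : Y ⟶ Y') : P.Whisker X Y X Y' where
  fn f := f ≫ b
  fnPath m := m ≫ P.path.map b
  fnPath_e₀ m := by simp
  fnPath_e₁ m := by simp
  fnPath_t f := by simp [← P.t.naturality b]
  fnSquare Θ := ⟨Θ ≫ P.path.map (P.path.map b), by simp, by simp,
    by simp [← Functor.map_comp], by simp [← Functor.map_comp]⟩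

lemma mapClass_id {f g : X ⟶ Y} (η : P.HomotopyClass f g) :
    (Whisker.id X Y).mapClass η = η := by
  obtain ⟨p⟩ := η
  refine congrArg HomotopyClass.mk ?_
  induction p with
  | nil => rfl
  | cons H p ih => exact congrArg (StrongHomotopy.cons _) (ih (.mk p))

lemma mapClass_whisker_comp (W : P.Whisker X Y X' Y') (V : P.Whisker X' Y' X'' Y'')
    {f g : X ⟶ Y} (η : P.HomotopyClass f g) :
    (W.comp V).mapClass η = V.mapClass (W.mapClass η) := by
  obtain ⟨p⟩ := η
  refine congrArg HomotopyClass.mk ?_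
  induction p with
  | nil => rfl
  | cons H p ih => exact congrArg (StrongHomotopy.cons _) (ih (.mk p))

lemma mapClass_congr {W V : P.Whisker X Y X' Y'} (h : W = V) {f g : X ⟶ Y}
    (η : P.HomotopyClass f g) : W.mapClass η ≍ V.mapClass η := by
  subst h; rfl

lemma mapClass_eqToHom (W : P.Whisker X Y X' Y') {f g : P.Arrows X Y} (h : f = g) :
    (W.mapClass (eqToHom h : f ⟶ g) : P.HomotopyClass (W.fn f.arrow) (W.fn g.arrow)) =
      (eqToHom (congrArg (fun f => Arrows.mk (W.fn f.arrow)) h) :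
        (⟨W.fn f.arrow⟩ : P.Arrows X' Y') ⟶ ⟨W.fn g.arrow⟩) := by
  subst h; rfl

end Whisker

/-- Whiskering on the left with an arrow. -/
def HomotopyClass.whiskerLeft {X Y Z : A} (a : X ⟶ Y) {f g : Y ⟶ Z} (η : P.HomotopyClass f g) :
    P.HomotopyClass (a ≫ f) (a ≫ g) := (Whisker.pre a Z).mapClass η

/-- Whiskering on the right with an arrow. -/
def HomotopyClass.whiskerRight {X Y Z : A} {f g : X ⟶ Y} (η : P.HomotopyClass f g) (b : Y ⟶ Z) :
    P.HomotopyClass (f ≫ b) (g ≫ b) := (Whisker.post X b).mapClass η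

lemma HomotopyClass.exchange {X Y Z : A} {f g : X ⟶ Y} {h k : Y ⟶ Z} (η : P.HomotopyClass f g)
    (θ : P.HomotopyClass h k) :
    (θ.whiskerLeft f).comp (η.whiskerRight k) = (η.whiskerRight h).comp (θ.whiskerLeft g) := by
  obtain ⟨p⟩ := η
  obtain ⟨q⟩ := θ
  have key : ∀ {f g : X ⟶ Y} (H : P.Homotopy f g) {h k : Y ⟶ Z} (K : P.Homotopy h k),
      (HomotopyClass.whiskerLeft f (.mk (.single K))).comp
          (HomotopyClass.whiskerRight (.mk (.single H)) k) =
        (HomotopyClass.whiskerRight (.mk (.single H)) h).comp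
          (HomotopyClass.whiskerLeft g (.mk (.single K))) := by
    intro f g H h k K
    refine Quot.sound (.square (H.map ≫ P.path.map K.map) ((Whisker.pre f Z).mapHomotopy K)
      ((Whisker.pre g Z).mapHomotopy K) ((Whisker.post X h).mapHomotopy H)
      ((Whisker.post X k).mapHomotopy H) ?_ ?_ ?_ ?_)
    · simp [Whisker.pre, Whisker.mapHomotopy, reassoc_of% H.map_e₀]
    · simp [Whisker.pre, Whisker.mapHomotopy, reassoc_of% H.map_e₁]
    · simp [Whisker.post, Whisker.mapHomotopy, ← Functor.map_comp, K.map_e₀]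
    · simp [Whisker.post, Whisker.mapHomotopy, ← Functor.map_comp, K.map_e₁]
  have hl : ∀ {W : A} (a : W ⟶ Y) {l m n : Y ⟶ Z} (θ : P.HomotopyClass l m)
      (ι : P.HomotopyClass m n), (θ.comp ι).whiskerLeft a =
        (θ.whiskerLeft a).comp (ι.whiskerLeft a) := fun a _ _ _ θ ι => Whisker.mapClass_comp _ θ ι
  have hr : ∀ {l m n : X ⟶ Y} (θ : P.HomotopyClass l m) (ι : P.HomotopyClass m n) (b : Y ⟶ Z),
      (θ.comp ι).whiskerRight b = (θ.whiskerRight b).comp (ι.whiskerRight b) :=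
    fun θ ι b => Whisker.mapClass_comp _ θ ι
  have key₂ : ∀ {f g : X ⟶ Y} (H : P.Homotopy f g) {h k : Y ⟶ Z} (q : P.StrongHomotopy h k),
      (HomotopyClass.whiskerLeft f (.mk q)).comp
          (HomotopyClass.whiskerRight (.mk (.single H)) k) =
        (HomotopyClass.whiskerRight (.mk (.single H)) h).comp
          (HomotopyClass.whiskerLeft g (.mk q)) := by
    intro f g H h k q
    induction q with
    | nil => rfl
    | cons K q ih =>
      have e : HomotopyClass.mk (.cons K q) = (HomotopyClass.mk (.single K)).comp (.mk q) := rfl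
      rw [e, hl, hl, HomotopyClass.comp_assoc, ih, ← HomotopyClass.comp_assoc, key,
        HomotopyClass.comp_assoc]
  change (HomotopyClass.whiskerLeft f (.mk q)).comp (HomotopyClass.whiskerRight (.mk p) k) =
        (HomotopyClass.whiskerRight (.mk p) h).comp (HomotopyClass.whiskerLeft g (.mk q))
  induction p with
  | nil => exact congrArg HomotopyClass.mk (StrongHomotopy.comp_nil _)
  | cons H p ih =>
    have e : HomotopyClass.mk (.cons H p) = (HomotopyClass.mk (.single H)).comp (.mk p) := rfl
    rw [e, hr, hr, ← HomotopyClass.comp_assoc, key₂, HomotopyClass.comp_assoc, ih (.mk p),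
      HomotopyClass.comp_assoc]

end Cocylinder

open Cocylinder

/-- The objects of `A`, as the objects of the bicategory of arrows and homotopy classes of strong
homotopies. -/
structure HoBicat {A : Type u} [Category.{v} A] (P : Cocylinder A) where
  as : A

namespace HoBicat

variable {A : Type u} [Category.{v} A] {P : Cocylinder A}

instance : CategoryStruct.{v} (HoBicat P) where
  Hom X Y := P.Arrows X.as Y.as
  id X := ⟨𝟙 X.as⟩
  comp f g := ⟨f.arrow ≫ g.arrow⟩

instance (X Y : HoBicat P) : Category.{v} (X ⟶ Y) :=
  inferInstanceAs (Category (P.Arrows X.as Y.as))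

/-- Left whiskering. -/
def whiskerL {X Y Z : HoBicat P} (f : X ⟶ Y) {g h : Y ⟶ Z} (η : g ⟶ h) : f ≫ g ⟶ f ≫ h :=
  HomotopyClass.whiskerLeft f.arrow η

/-- Right whiskering. -/
def whiskerR {X Y Z : HoBicat P} {f g : X ⟶ Y} (η : f ⟶ g) (h : Y ⟶ Z) : f ≫ h ⟶ g ≫ h :=
  HomotopyClass.whiskerRight η h.arrow

lemma comp_id_eq {X Y : HoBicat P} (f : X ⟶ Y) : f ≫ 𝟙 Y = f :=
  congrArg Arrows.mk (Category.comp_id _)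

lemma id_comp_eq {X Y : HoBicat P} (f : X ⟶ Y) : 𝟙 X ≫ f = f :=
  congrArg Arrows.mk (Category.id_comp _)

lemma assoc_eq {X Y Z T : HoBicat P} (f : X ⟶ Y) (g : Y ⟶ Z) (h : Z ⟶ T) :
    (f ≫ g) ≫ h = f ≫ g ≫ h :=
  congrArg Arrows.mk (Category.assoc _ _ _)

lemma whiskerL_eqToHom {X Y Z : HoBicat P} (f : X ⟶ Y) {g h : Y ⟶ Z} (e : g = h) :
    whiskerL f (eqToHom e) = eqToHom (by rw [e]) := by
  subst e; rfl

lemma whiskerR_eqToHom {X Y Z : HoBicat P} {f g : X ⟶ Y} (e : f = g) (h : Y ⟶ Z) :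
    whiskerR (eqToHom e) h = eqToHom (by rw [e]) := by
  subst e; rfl

/-- The bicategory of objects of `A`, arrows, and homotopy classes of strong homotopies. -/
instance : Bicategory.{v, v} (HoBicat P) where
  homCategory X Y := inferInstance
  whiskerLeft f _ _ η := whiskerL f η
  whiskerRight η h := whiskerR η h
  associator f g h := eqToIso (assoc_eq f g h)
  leftUnitor f := eqToIso (id_comp_eq f)
  rightUnitor f := eqToIso (comp_id_eq f)
  whiskerLeft_id f g := rfl
  whiskerLeft_comp f _ _ _ η θ := Whisker.mapClass_comp _ _ _
  id_whiskerLeft {X Y f g} η := by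
    refine (conj_eqToHom_iff_heq (whiskerL (𝟙 X) η) η (id_comp_eq f) (id_comp_eq g)).2 ?_
    exact (Whisker.mapClass_congr (V := .id _ _) (Whisker.ext (funext fun _ => Category.id_comp _)
      (funext fun _ => Category.id_comp _)) η).trans (heq_of_eq (Whisker.mapClass_id η))
  comp_whiskerLeft {_ _ _ T} f g h k η := by
    refine (conj_eqToHom_iff_heq (whiskerL (f ≫ g) η) (whiskerL f (whiskerL g η))
      (assoc_eq f g h) (assoc_eq f g k)).2 ?_
    exact (Whisker.mapClass_congr (V := .comp (.pre g.arrow _) (.pre f.arrow _))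
      (Whisker.ext (funext fun _ => Category.assoc _ _ _)
        (funext fun _ => Category.assoc _ _ _)) η).trans
      (heq_of_eq (Whisker.mapClass_whisker_comp _ _ η))
  id_whiskerRight f g := rfl
  comp_whiskerRight η θ i := Whisker.mapClass_comp _ _ _
  whiskerRight_id {X Y f g} η := by
    refine (conj_eqToHom_iff_heq (whiskerR η (𝟙 Y)) η (comp_id_eq f) (comp_id_eq g)).2 ?_
    exact (Whisker.mapClass_congr (W := .post X.as (𝟙 Y.as)) (V := .id _ _)
      (Whisker.ext (funext fun _ => Category.comp_id _)
      (funext fun _ => by simp [Whisker.post, Whisker.id])) η).trans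
      (heq_of_eq (Whisker.mapClass_id η))
  whiskerRight_comp {T _ _ _ a b} η g h := by
    refine (conj_eqToHom_iff_heq (whiskerR η (g ≫ h)) (whiskerR (whiskerR η g) h)
      (assoc_eq a g h).symm (assoc_eq b g h).symm).2 ?_
    exact (Whisker.mapClass_congr (W := .post T.as (g.arrow ≫ h.arrow))
      (V := .comp (.post _ g.arrow) (.post _ h.arrow))
      (Whisker.ext (funext fun _ => (Category.assoc _ _ _).symm)
        (funext fun _ => by simp [Whisker.post, Whisker.comp])) η).trans
      (heq_of_eq (Whisker.mapClass_whisker_comp _ _ η))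
  whisker_assoc f a b η h := by
    refine (conj_eqToHom_iff_heq (whiskerR (whiskerL f η) h) (whiskerL f (whiskerR η h))
      (assoc_eq f a h) (assoc_eq f b h)).2 ?_
    exact (heq_of_eq
      (Whisker.mapClass_whisker_comp (.pre f.arrow _) (.post _ h.arrow) η).symm).trans <|
      (Whisker.mapClass_congr (V := .comp (.post _ h.arrow) (.pre f.arrow _))
        (Whisker.ext (funext fun _ => Category.assoc _ _ _)
          (funext fun _ => Category.assoc _ _ _)) η).trans
        (heq_of_eq (Whisker.mapClass_whisker_comp _ _ η))
  whisker_exchange η θ := HomotopyClass.exchange η θ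
  pentagon f g h i := by
    simp only [eqToIso.hom, whiskerL_eqToHom, whiskerR_eqToHom, eqToHom_trans]
  triangle f g := by
    simp only [eqToIso.hom, whiskerL_eqToHom, whiskerR_eqToHom, eqToHom_trans]

end HoBicat

/-! ### Sites and admissible epimorphisms -/

section Site

variable {C : Type u} [Category.{v} C]

/-- `f : S ⟶ X` is locally split: some covering family of `X` lifts along `f`. -/
def LocallySplit (J : Precoverage C) {S X : C} (f : S ⟶ X) : Prop :=
  ∃ R ∈ J X, ∀ ⦃U : C⦄ ⦃g : U ⟶ X⦄, R g → ∃ l : U ⟶ S, l ≫ f = g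

/-- The admissible epimorphisms: the largest class of locally split epimorphisms which have
pullbacks along arbitrary arrows and which is stable under these pullbacks. -/
structure Admissible (J : Precoverage C) {S X : C} (f : S ⟶ X) : Prop where
  hasPullback : ∀ {Y : C} (g : Y ⟶ X), HasPullback f g
  universal : ∀ {Q Y : C} {p : Q ⟶ S} {q : Q ⟶ Y} {g : Y ⟶ X}, IsPullback p q f g →
    Epi q ∧ LocallySplit J q

lemma Admissible.of_section {J : Precoverage C} [J.HasIsos] {S X : C} (f : S ⟶ X) (s : X ⟶ S)
    (hs : s ≫ f = 𝟙 X) (hf : ∀ {Y : C} (g : Y ⟶ X), HasPullback f g) : Admissible J f where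
  hasPullback g := hf g
  universal {Q Y p q g} h := by
    have e : h.lift (g ≫ s) (𝟙 Y) (by rw [Category.assoc, hs]; simp) ≫ q = 𝟙 Y := h.lift_snd _ _ _
    refine ⟨⟨fun a b hab => ?_⟩, Presieve.singleton (𝟙 Y),
      Precoverage.mem_coverings_of_isIso (𝟙 Y), ?_⟩
    · rw [← Category.id_comp a, ← e, Category.assoc, hab, ← Category.assoc, e, Category.id_comp]
    · rintro _ _ ⟨⟩
      exact ⟨_, e⟩

/-- The site is subcanonical: all representable presheaves are sheaves. -/
def Subcanonical (J : Precoverage C) : Prop :=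
  ∀ ⦃X : C⦄ ⦃R : Presieve X⦄, R ∈ J X → ∀ Y : C, Presieve.IsSheafFor (yoneda.obj Y) R

section Descent

variable {ι : Type w} {X : C} {U : ι → C}

/-- A descent datum relative to a family of arrows `φ i : U i ⟶ X`: objects `Aᵢ` over `U i` and
isomorphisms over `U i ×_X U j` between the pullbacks of `Aᵢ` and `Aⱼ`, subject to the identity
and cocycle conditions. An arrow over `U i ×_X U j` between these pullbacks is given, by the Yoneda
lemma, as a natural operation that takes a generalized element `y` of `Aᵢ` and a generalized element
`x` of `U j` with the same image in `X` to an element of `Aⱼ` over `x`. -/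
structure DescentDatum (φ : ∀ i, U i ⟶ X) where
  obj : ι → C
  proj : ∀ i, obj i ⟶ U i
  glue : ∀ {T : C} (i j : ι) (y : T ⟶ obj i) (x : T ⟶ U j), y ≫ proj i ≫ φ i = x ≫ φ j →
    (T ⟶ obj j)
  glue_natural : ∀ {S T : C} (s : S ⟶ T) (i j : ι) (y : T ⟶ obj i) (x : T ⟶ U j) (h) (h'),
    glue i j (s ≫ y) (s ≫ x) h' = s ≫ glue i j y x h
  glue_proj : ∀ {T : C} (i j : ι) (y : T ⟶ obj i) (x : T ⟶ U j) (h), glue i j y x h ≫ proj j = x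
  glue_self : ∀ {T : C} (i : ι) (y : T ⟶ obj i) (h), glue i i y (y ≫ proj i) h = y
  glue_glue : ∀ {T : C} (i j k : ι) (y : T ⟶ obj i) (x : T ⟶ U j) (x' : T ⟶ U k) (h) (h') (h''),
    glue j k (glue i j y x h) x' h' = glue i k y x' h''

namespace DescentDatum

variable {φ : ∀ i, U i ⟶ X}

/-- Morphisms of descent data. -/
@[ext]
structure Hom (D E : DescentDatum φ) where
  hom : ∀ i, D.obj i ⟶ E.obj i
  hom_proj : ∀ i, hom i ≫ E.proj i = D.proj i
  hom_glue : ∀ {T : C} (i j : ι) (y : T ⟶ D.obj i) (x : T ⟶ U j) (h) (h'),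
    E.glue i j (y ≫ hom i) x h' = D.glue i j y x h ≫ hom j

instance : Category (DescentDatum φ) where
  Hom := Hom
  id D :=
    { hom := fun i => 𝟙 _
      hom_proj := fun i => Category.id_comp _
      hom_glue := fun i j y x h h' => by simp }
  comp {D E F} f g :=
    { hom := fun i => f.hom i ≫ g.hom i
      hom_proj := fun i => by rw [Category.assoc, g.hom_proj, f.hom_proj]
      hom_glue := fun i j y x h h' => by
        have h'' : (y ≫ f.hom i) ≫ E.proj i ≫ φ i = x ≫ φ j := by
          rw [Category.assoc, reassoc_of% (f.hom_proj i)]; exact h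
        have h₃ := g.hom_glue i j _ x h'' (by simpa only [Category.assoc] using h')
        rw [f.hom_glue i j y x h h''] at h₃
        simpa only [Category.assoc] using h₃ }
  id_comp f := Hom.ext (funext fun i => Category.id_comp _)
  comp_id f := Hom.ext (funext fun i => Category.comp_id _)
  assoc f g h := Hom.ext (funext fun i => Category.assoc _ _ _)

end DescentDatum

/-- The pullbacks of an object over `X` along the arrows `φ i`, with their canonical gluing. -/
noncomputable def descentObj (φ : ∀ i, U i ⟶ X)
    [∀ (i : ι) {Y : C} (f : Y ⟶ X), HasPullback f (φ i)] (A : Over X) : DescentDatum φ where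
  obj i := pullback A.hom (φ i)
  proj i := pullback.snd A.hom (φ i)
  glue i j y x h := pullback.lift (y ≫ pullback.fst A.hom (φ i)) x (by
    rw [Category.assoc, pullback.condition, h])
  glue_natural s i j y x h h' := by
    apply pullback.hom_ext <;> simp [pullback.lift_fst, pullback.lift_snd]
  glue_proj i j y x h := pullback.lift_snd _ _ _
  glue_self i y h := by
    apply pullback.hom_ext <;> simp [pullback.lift_fst, pullback.lift_snd]
  glue_glue i j k y x x' h h' h'' := by
    apply pullback.hom_ext <;> simp [pullback.lift_fst, pullback.lift_snd]

/-- The arrow between pullbacks along `φ i` induced by an arrow over `X`. -/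
noncomputable def descentMap (φ : ∀ i, U i ⟶ X)
    [∀ (i : ι) {Y : C} (f : Y ⟶ X), HasPullback f (φ i)] {A B : Over X} (f : A ⟶ B) (i : ι) :
    pullback A.hom (φ i) ⟶ pullback B.hom (φ i) :=
  pullback.lift (pullback.fst A.hom (φ i) ≫ f.left) (pullback.snd A.hom (φ i))
    (by simp [pullback.condition])

lemma descentMap_fst (φ : ∀ i, U i ⟶ X) [∀ (i : ι) {Y : C} (f : Y ⟶ X), HasPullback f (φ i)]
    {A B : Over X} (f : A ⟶ B) (i : ι) : descentMap φ f i ≫ pullback.fst B.hom (φ i) =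
      pullback.fst A.hom (φ i) ≫ f.left := pullback.lift_fst _ _ _

lemma descentMap_snd (φ : ∀ i, U i ⟶ X) [∀ (i : ι) {Y : C} (f : Y ⟶ X), HasPullback f (φ i)]
    {A B : Over X} (f : A ⟶ B) (i : ι) : descentMap φ f i ≫ pullback.snd B.hom (φ i) =
      pullback.snd A.hom (φ i) := pullback.lift_snd _ _ _

lemma descentMap_lift (φ : ∀ i, U i ⟶ X)
    [∀ (i : ι) {Y : C} (f : Y ⟶ X), HasPullback f (φ i)] {A B : Over X} (f : A ⟶ B) {T : C}
    (i j : ι) (y : T ⟶ pullback A.hom (φ i)) (x : T ⟶ U j) (h) (h') :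
    pullback.lift ((y ≫ descentMap φ f i) ≫ pullback.fst B.hom (φ i)) x h' =
      pullback.lift (y ≫ pullback.fst A.hom (φ i)) x h ≫ descentMap φ f j := by
  apply pullback.hom_ext
  · rw [pullback.lift_fst, Category.assoc, Category.assoc, descentMap_fst, descentMap_fst,
      pullback.lift_fst_assoc, Category.assoc]
  · rw [pullback.lift_snd, Category.assoc, descentMap_snd, pullback.lift_snd]

lemma descentMap_id (φ : ∀ i, U i ⟶ X) [∀ (i : ι) {Y : C} (f : Y ⟶ X), HasPullback f (φ i)]
    (A : Over X) (i : ι) : descentMap φ (𝟙 A) i = 𝟙 (pullback A.hom (φ i)) := by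
  apply pullback.hom_ext <;> simp [descentMap_fst, descentMap_snd]

lemma descentMap_comp (φ : ∀ i, U i ⟶ X) [∀ (i : ι) {Y : C} (f : Y ⟶ X), HasPullback f (φ i)]
    {A B D : Over X} (f : A ⟶ B) (g : B ⟶ D) (i : ι) :
    descentMap φ (f ≫ g) i = descentMap φ f i ≫ descentMap φ g i := by
  apply pullback.hom_ext
  · rw [Category.assoc, descentMap_fst, descentMap_fst, ← Category.assoc, descentMap_fst,
      Category.assoc, Over.comp_left]
  · rw [Category.assoc, descentMap_snd, descentMap_snd, descentMap_snd]

/-- The descent functor: an object over `X` is sent to its pullbacks along the arrows `φ i` with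
their canonical gluing isomorphisms. -/
noncomputable def descentFunctor (φ : ∀ i, U i ⟶ X)
    [∀ (i : ι) {Y : C} (f : Y ⟶ X), HasPullback f (φ i)] : Over X ⥤ DescentDatum φ where
  obj A := descentObj φ A
  map f :=
    { hom := descentMap φ f
      hom_proj := descentMap_snd φ f
      hom_glue := fun i j y x _ _ => descentMap_lift φ f i j y x _ _ }
  map_id A := DescentDatum.Hom.ext (funext fun i => descentMap_id φ A i)
  map_comp f g := DescentDatum.Hom.ext (funext fun i => descentMap_comp φ f g i)

end Descent

lemma hasPullback_of_covering (J : Precoverage C) [J.HasPullbacks] {ι : Type w} {X : C}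
    {U : ι → C} (φ : ∀ i, U i ⟶ X) (h : Presieve.ofArrows U φ ∈ J X) (i : ι) {Y : C}
    (f : Y ⟶ X) : HasPullback f (φ i) :=
  haveI := Precoverage.hasPullbacks_of_mem f h
  haveI := Presieve.hasPullback f (Presieve.ofArrows.mk (Y := U) (f := φ) i)
  hasPullback_symmetry _ _

/-- Effective descent: for each covering family of `X`, the descent functor is an equivalence
between the category of objects over `X` and the category of descent data. -/
def EffectiveDescent (J : Precoverage C) [J.HasPullbacks] : Prop :=
  ∀ (ι : Type (max u v)) (X : C) (U : ι → C) (φ : ∀ i, U i ⟶ X)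
    (h : Presieve.ofArrows U φ ∈ J X),
    haveI := fun (i : ι) {Y : C} (f : Y ⟶ X) => hasPullback_of_covering J φ h i f
    (descentFunctor φ).IsEquivalence

end Site

/-! ### Internal groupoids -/

section Groupoid

variable {C : Type u} [Category.{v} C]

/-- The structure arrows of an internal groupoid. The range map is an admissible epimorphism. -/
structure PreGroupoid (J : Precoverage C) where
  Ob : C
  Ar : C
  src : Ar ⟶ Ob
  tgt : Ar ⟶ Ob
  tgt_adm : Admissible J tgt
  unit : Ob ⟶ Ar
  inv : Ar ⟶ Ar
  /-- The multiplication on the object of composable pairs `(a, b)`, `tgt a = src b`. -/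
  mul : @pullback _ _ _ _ _ tgt src (tgt_adm.hasPullback src) ⟶ Ar

/-- The composite "first `a`, then `b`" of two generalized elements of the object of arrows. -/
noncomputable def PreGroupoid.comp {J : Precoverage C} (G : PreGroupoid J) {T : C}
    (a b : T ⟶ G.Ar) (h : a ≫ G.tgt = b ≫ G.src) : T ⟶ G.Ar :=
  haveI := G.tgt_adm.hasPullback G.src
  pullback.lift a b h ≫ G.mul

lemma PreGroupoid.comp_natural {J : Precoverage C} (G : PreGroupoid J) {S T : C} (s : S ⟶ T)
    (a b : T ⟶ G.Ar) (h : a ≫ G.tgt = b ≫ G.src)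
    (h' : (s ≫ a) ≫ G.tgt = (s ≫ b) ≫ G.src) :
    s ≫ G.comp a b h = G.comp (s ≫ a) (s ≫ b) h' := by
  have := G.tgt_adm.hasPullback G.src
  unfold PreGroupoid.comp
  rw [← Category.assoc]
  congr 1
  apply pullback.hom_ext <;> simp [pullback.lift_fst, pullback.lift_snd]

/-- Groupoids internal to the site; the axioms are written with generalized elements. -/
structure IntGroupoid (J : Precoverage C) extends PreGroupoid J where
  unit_src : unit ≫ src = 𝟙 Ob
  unit_tgt : unit ≫ tgt = 𝟙 Ob
  comp_src : ∀ {T : C} (a b : T ⟶ Ar) (h), toPreGroupoid.comp a b h ≫ src = a ≫ src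
  comp_tgt : ∀ {T : C} (a b : T ⟶ Ar) (h), toPreGroupoid.comp a b h ≫ tgt = b ≫ tgt
  unit_comp : ∀ {T : C} (a : T ⟶ Ar) (h), toPreGroupoid.comp (a ≫ src ≫ unit) a h = a
  comp_unit : ∀ {T : C} (a : T ⟶ Ar) (h), toPreGroupoid.comp a (a ≫ tgt ≫ unit) h = a
  comp_assoc : ∀ {T : C} (a b c : T ⟶ Ar) (h₁) (h₂) (h₃) (h₄),
    toPreGroupoid.comp (toPreGroupoid.comp a b h₁) c h₂ =
      toPreGroupoid.comp a (toPreGroupoid.comp b c h₃) h₄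
  inv_src : inv ≫ src = tgt
  inv_tgt : inv ≫ tgt = src
  comp_inv : ∀ {T : C} (a : T ⟶ Ar) (h), toPreGroupoid.comp a (a ≫ inv) h = a ≫ src ≫ unit
  inv_comp : ∀ {T : C} (a : T ⟶ Ar) (h), toPreGroupoid.comp (a ≫ inv) a h = a ≫ tgt ≫ unit

variable {J : Precoverage C}

/-- Strict arrows of internal groupoids. -/
@[ext]
structure StrictArrow (G H : IntGroupoid J) where
  ob : G.Ob ⟶ H.Ob
  ar : G.Ar ⟶ H.Ar
  ar_src : ar ≫ H.src = G.src ≫ ob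
  ar_tgt : ar ≫ H.tgt = G.tgt ≫ ob
  map_comp : ∀ {T : C} (a b : T ⟶ G.Ar) (h) (h'), G.comp a b h ≫ ar = H.comp (a ≫ ar) (b ≫ ar) h'
  map_inv : G.inv ≫ ar = ar ≫ H.inv

/-- The category of internal groupoids and strict arrows. -/
instance : Category.{v} (IntGroupoid J) where
  Hom := StrictArrow
  id G :=
    { ob := 𝟙 _
      ar := 𝟙 _
      ar_src := by simp
      ar_tgt := by simp
      map_comp := fun a b h h' => by simp
      map_inv := by simp }
  comp {G H K} f g :=
    { ob := f.ob ≫ g.ob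
      ar := f.ar ≫ g.ar
      ar_src := by rw [Category.assoc, g.ar_src, reassoc_of% f.ar_src]
      ar_tgt := by rw [Category.assoc, g.ar_tgt, reassoc_of% f.ar_tgt]
      map_comp := fun a b h h' => by
        have h'' : (a ≫ f.ar) ≫ H.tgt = (b ≫ f.ar) ≫ H.src := by
          simp only [Category.assoc, f.ar_tgt, f.ar_src, reassoc_of% h]
        rw [← Category.assoc, f.map_comp a b h h'', g.map_comp _ _ h'' (by simpa using h')]
        simp only [Category.assoc]
      map_inv := by rw [← Category.assoc, f.map_inv, Category.assoc, g.map_inv, Category.assoc] }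
  id_comp f := StrictArrow.ext (Category.id_comp _) (Category.id_comp _)
  comp_id f := StrictArrow.ext (Category.comp_id _) (Category.comp_id _)
  assoc f g h := StrictArrow.ext (Category.assoc _ _ _) (Category.assoc _ _ _)

namespace IntGroupoid

@[simp] lemma id_ob (G : IntGroupoid J) : StrictArrow.ob (𝟙 G) = 𝟙 G.Ob := rfl
@[simp] lemma id_ar (G : IntGroupoid J) : StrictArrow.ar (𝟙 G) = 𝟙 G.Ar := rfl
@[simp] lemma comp_ob {G H K : IntGroupoid J} (f : G ⟶ H) (g : H ⟶ K) :
    StrictArrow.ob (f ≫ g) = f.ob ≫ g.ob := rfl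
@[simp] lemma comp_ar {G H K : IntGroupoid J} (f : G ⟶ H) (g : H ⟶ K) :
    StrictArrow.ar (f ≫ g) = f.ar ≫ g.ar := rfl

@[ext] lemma hom_ext {G H : IntGroupoid J} {f g : G ⟶ H} (h₀ : f.ob = g.ob) (h₁ : f.ar = g.ar) :
    f = g := StrictArrow.ext h₀ h₁


variable {G : IntGroupoid J}

lemma comp_congr {T : C} {a a' b b' : T ⟶ G.Ar} (ha : a = a') (hb : b = b') (h) (h') :
    G.comp a b h = G.comp a' b' h' := by
  subst ha hb; rfl

lemma unit_comp' {T : C} (x : T ⟶ G.Ob) (a : T ⟶ G.Ar) (h) : G.comp (x ≫ G.unit) a h = a := by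
  have hx : x = a ≫ G.src := by
    rw [Category.assoc, G.unit_tgt, Category.comp_id] at h; exact h
  subst hx
  exact (comp_congr (by simp) rfl h (by simpa using h)).trans
    (G.unit_comp a (by simpa using h))

lemma comp_unit' {T : C} (x : T ⟶ G.Ob) (a : T ⟶ G.Ar) (h) : G.comp a (x ≫ G.unit) h = a := by
  have hx : x = a ≫ G.tgt := by
    rw [Category.assoc, G.unit_src, Category.comp_id] at h; exact h.symm
  subst hx
  exact (comp_congr rfl (by simp) h (by simpa using h)).trans
    (G.comp_unit a (by simpa using h))

/-- Left cancellation. -/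
lemma comp_left_cancel {T : C} {a b c : T ⟶ G.Ar} {hb} {hc}
    (e : G.comp a b hb = G.comp a c hc) : b = c := by
  have hi : (a ≫ G.inv) ≫ G.tgt = a ≫ G.src := by rw [Category.assoc, G.inv_tgt]
  have key : ∀ (d : T ⟶ G.Ar) (hd : a ≫ G.tgt = d ≫ G.src),
      G.comp (a ≫ G.inv) (G.comp a d hd) (by rw [hi, G.comp_src]) = d := by
    intro d hd
    rw [← G.comp_assoc _ _ _ hi (by rw [G.comp_tgt, hd])]
    exact (comp_congr (G.inv_comp a hi) rfl _ (by simp [G.unit_tgt, hd])).trans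
      ((comp_congr (Category.assoc _ _ _).symm rfl _ (by simp [G.unit_tgt, hd])).trans
        (unit_comp' _ _ _))
  rw [← key b hb, ← key c hc]
  exact comp_congr rfl e _ _

/-- Right cancellation. -/
lemma comp_right_cancel {T : C} {a b c : T ⟶ G.Ar} {ha} {hb}
    (e : G.comp a c ha = G.comp b c hb) : a = b := by
  have hi : c ≫ G.tgt = (c ≫ G.inv) ≫ G.src := by rw [Category.assoc, G.inv_src]
  have key : ∀ (d : T ⟶ G.Ar) (hd : d ≫ G.tgt = c ≫ G.src),
      G.comp (G.comp d c hd) (c ≫ G.inv) (by rw [G.comp_tgt, hi]) = d := by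
    intro d hd
    rw [G.comp_assoc _ _ _ hd _ hi (by rw [G.comp_src, hd])]
    exact (comp_congr rfl (G.comp_inv c hi) _ (by simp [G.unit_src, hd])).trans
      ((comp_congr rfl (Category.assoc _ _ _).symm _ (by simp [G.unit_src, hd])).trans
        (comp_unit' _ _ _))
  rw [← key a ha, ← key b hb]
  exact comp_congr e rfl _ _

/-! #### The path groupoid

The cocylinder `G^I` is the groupoid of functors from the interval groupoid `I` (two objects and
one isomorphism between them) to `G`: its objects are the arrows of `G`, and its arrows are the
commutative squares in `G`. A square with sides `g : x ⟶ x'`, `h : y ⟶ y'` and source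
`a : x ⟶ y`, target `a' : x' ⟶ y'` is determined by `g`, `a'` and `h`. -/

instance (G : IntGroupoid J) {Y : C} (f : Y ⟶ G.Ob) : HasPullback G.tgt f :=
  G.tgt_adm.hasPullback f

variable (G)

/-- The object of commutative squares. -/
noncomputable abbrev Sq : C := pullback G.tgt (pullback.snd G.tgt G.src ≫ G.tgt)

/-- The side of a square between the sources of its source and target. -/
noncomputable def sqLeft : G.Sq ⟶ G.Ar := pullback.snd _ _ ≫ pullback.fst _ _

/-- The target of a square. -/
noncomputable def sqTgt : G.Sq ⟶ G.Ar := pullback.snd _ _ ≫ pullback.snd _ _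

/-- The side of a square between the targets of its source and target. -/
noncomputable def sqRight : G.Sq ⟶ G.Ar := pullback.fst _ _

lemma sqLeft_tgt : G.sqLeft ≫ G.tgt = G.sqTgt ≫ G.src := by
  simp [sqLeft, sqTgt, pullback.condition]

lemma sqRight_tgt : G.sqRight ≫ G.tgt = G.sqTgt ≫ G.tgt := by
  simp [sqRight, sqTgt, pullback.condition]

lemma sq_ext {T : C} {m n : T ⟶ G.Sq} (hl : m ≫ G.sqLeft = n ≫ G.sqLeft)
    (ht : m ≫ G.sqTgt = n ≫ G.sqTgt) (hr : m ≫ G.sqRight = n ≫ G.sqRight) : m = n := by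
  refine pullback.hom_ext hr (pullback.hom_ext ?_ ?_)
  · simpa [sqLeft] using hl
  · simpa [sqTgt] using ht

/-- The square with given sides and target. -/
noncomputable def sqLift {T : C} (l a r : T ⟶ G.Ar) (h₁ : l ≫ G.tgt = a ≫ G.src)
    (h₂ : r ≫ G.tgt = a ≫ G.tgt) : T ⟶ G.Sq :=
  pullback.lift r (pullback.lift l a h₁) (by rw [h₂, pullback.lift_snd_assoc])

section
variable {T : C} (l a r : T ⟶ G.Ar) (h₁ : l ≫ G.tgt = a ≫ G.src) (h₂ : r ≫ G.tgt = a ≫ G.tgt)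

lemma sqLift_left : G.sqLift l a r h₁ h₂ ≫ G.sqLeft = l := by
  rw [sqLift, sqLeft, pullback.lift_snd_assoc, pullback.lift_fst]

lemma sqLift_tgt : G.sqLift l a r h₁ h₂ ≫ G.sqTgt = a := by
  rw [sqLift, sqTgt, pullback.lift_snd_assoc, pullback.lift_snd]

lemma sqLift_right : G.sqLift l a r h₁ h₂ ≫ G.sqRight = r := by
  rw [sqLift, sqRight, pullback.lift_fst]

end

lemma sqSrc_aux : G.comp G.sqLeft G.sqTgt G.sqLeft_tgt ≫ G.tgt = (G.sqRight ≫ G.inv) ≫ G.src := by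
  rw [G.comp_tgt, Category.assoc, G.inv_src, sqRight_tgt]

/-- The source of a square. -/
noncomputable def sqSrc : G.Sq ⟶ G.Ar :=
  G.comp (G.comp G.sqLeft G.sqTgt G.sqLeft_tgt) (G.sqRight ≫ G.inv) G.sqSrc_aux

lemma sqSrc_src : G.sqSrc ≫ G.src = G.sqLeft ≫ G.src := by
  rw [sqSrc, G.comp_src, G.comp_src]

lemma sqSrc_tgt : G.sqSrc ≫ G.tgt = G.sqRight ≫ G.src := by
  rw [sqSrc, G.comp_tgt, Category.assoc, G.inv_tgt]

/-- Squares commute. -/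
lemma sq_comm {T : C} (m : T ⟶ G.Sq) (h) (h') :
    G.comp (m ≫ G.sqSrc) (m ≫ G.sqRight) h = G.comp (m ≫ G.sqLeft) (m ≫ G.sqTgt) h' := by
  have h₀ : G.comp G.sqSrc G.sqRight G.sqSrc_tgt = G.comp G.sqLeft G.sqTgt G.sqLeft_tgt := by
    have hi : (G.sqRight ≫ G.inv) ≫ G.tgt = G.sqRight ≫ G.src := by
      rw [Category.assoc, G.inv_tgt]
    refine (G.comp_assoc _ _ _ G.sqSrc_aux _ hi (by rw [G.comp_src, G.sqSrc_aux])).trans ?_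
    exact (comp_congr rfl ((G.inv_comp _ hi).trans (Category.assoc _ _ _).symm) _
      (by simp [G.unit_src, G.comp_tgt, G.sqRight_tgt])).trans (comp_unit' _ _ _)
  rw [← G.comp_natural m _ _ G.sqSrc_tgt h, h₀, G.comp_natural m _ _ G.sqLeft_tgt h']

variable {G} in
/-- The source of a square is determined by commutativity. -/
lemma eq_sqSrc {T : C} {m : T ⟶ G.Sq} {x : T ⟶ G.Ar} (h) (h')
    (e : G.comp x (m ≫ G.sqRight) h = G.comp (m ≫ G.sqLeft) (m ≫ G.sqTgt) h') :
    x = m ≫ G.sqSrc := by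
  refine comp_right_cancel (c := m ≫ G.sqRight) (ha := h)
    (hb := by simp only [Category.assoc, sqSrc_tgt]) (e.trans ?_)
  rw [sq_comm]

lemma hasPullback_sqTgt {Y : C} (f : Y ⟶ G.Ar) : HasPullback G.sqTgt f := by
  have h₁ : HasPullback (pullback.snd G.tgt G.src) f := by
    have h := IsPullback.of_hasPullback G.tgt (f ≫ G.src)
    have h' := IsPullback.of_hasPullback G.tgt G.src
    exact (IsPullback.of_right (h₁₁ := h'.lift (pullback.fst _ _) (pullback.snd _ _ ≫ f)
      (by rw [Category.assoc, pullback.condition])) (by simpa using h) (by simp) h').hasPullback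
  have h₂ : ∀ {Z : C} (k : Z ⟶ pullback G.tgt G.src),
      HasPullback (pullback.snd G.tgt (pullback.snd G.tgt G.src ≫ G.tgt)) k := by
    intro Z k
    have h := IsPullback.of_hasPullback G.tgt (k ≫ pullback.snd G.tgt G.src ≫ G.tgt)
    have h' := IsPullback.of_hasPullback G.tgt (pullback.snd G.tgt G.src ≫ G.tgt)
    exact (IsPullback.of_right (h₁₁ := h'.lift (pullback.fst _ _) (pullback.snd _ _ ≫ k)
      (by rw [Category.assoc]; exact pullback.condition)) (by simpa using h) (by simp)
      h').hasPullback
  have h₃ := h₂ (pullback.fst (pullback.snd G.tgt G.src) f)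
  exact ((IsPullback.of_hasPullback (pullback.snd G.tgt (pullback.snd G.tgt G.src ≫ G.tgt))
    (pullback.fst (pullback.snd G.tgt G.src) f)).flip.paste_horiz
    (IsPullback.of_hasPullback (pullback.snd G.tgt G.src) f).flip).flip.hasPullback

instance {Y : C} (f : Y ⟶ G.Ar) : HasPullback G.sqTgt f := G.hasPullback_sqTgt f

/-- The identity square on an arrow. -/
noncomputable def sqUnit : G.Ar ⟶ G.Sq :=
  G.sqLift (G.src ≫ G.unit) (𝟙 _) (G.tgt ≫ G.unit) (by simp [G.unit_tgt]) (by simp [G.unit_tgt])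

lemma sqUnit_src : G.sqUnit ≫ G.sqSrc = 𝟙 _ := by
  refine (eq_sqSrc ?_ ?_ ?_).symm
  · rw [sqUnit, sqLift_right]; simp [G.unit_src]
  · rw [Category.assoc, Category.assoc, sqLeft_tgt]
  · refine (comp_congr rfl (G.sqLift_right _ _ _ _ _) _ (by simp [G.unit_src])).trans ?_
    rw [comp_unit']
    refine Eq.trans ?_ (comp_congr (G.sqLift_left _ _ _ _ _) (G.sqLift_tgt _ _ _ _ _)
      (by rw [Category.assoc, Category.assoc, sqLeft_tgt])
      (by rw [Category.assoc, G.unit_tgt]; simp)).symm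
    rw [unit_comp']

/-- The inverse square. -/
noncomputable def sqInv : G.Sq ⟶ G.Sq :=
  G.sqLift (G.sqLeft ≫ G.inv) G.sqSrc (G.sqRight ≫ G.inv)
    (by rw [Category.assoc, G.inv_tgt, sqSrc_src])
    (by rw [Category.assoc, G.inv_tgt, sqSrc_tgt])

lemma sqInv_src : G.sqInv ≫ G.sqSrc = G.sqTgt := by
  have h₁ : G.sqTgt ≫ G.tgt = (G.sqRight ≫ G.inv) ≫ G.src := by
    rw [Category.assoc, G.inv_src, sqRight_tgt]
  have h₂ : (G.sqLeft ≫ G.inv) ≫ G.tgt = G.sqSrc ≫ G.src := by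
    rw [Category.assoc, G.inv_tgt, sqSrc_src]
  have h₃ : G.sqLeft ≫ G.tgt = (G.sqLeft ≫ G.inv) ≫ G.src := by
    rw [Category.assoc, G.inv_src]
  have key : G.comp G.sqTgt (G.sqRight ≫ G.inv) h₁ = G.comp (G.sqLeft ≫ G.inv) G.sqSrc h₂ := by
    refine comp_left_cancel (a := G.sqLeft) (hb := by rw [G.comp_src, sqLeft_tgt])
      (hc := by rw [G.comp_src, h₃]) ?_
    rw [← G.comp_assoc _ _ _ G.sqLeft_tgt G.sqSrc_aux h₁,
      ← G.comp_assoc _ _ _ h₃ (by rw [G.comp_tgt, h₂]) h₂]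
    refine Eq.trans ?_ (comp_congr ((G.comp_inv _ h₃).trans (Category.assoc _ _ _).symm) rfl
      (by rw [G.comp_tgt, h₂]) (by
        rw [Category.assoc, Category.assoc, G.unit_tgt, Category.comp_id, sqSrc_src])).symm
    rw [unit_comp']
    rfl
  refine (eq_sqSrc ?_ ?_ ?_).symm
  · rw [sqInv, sqLift_right, h₁]
  · rw [sqInv, sqLift_left, sqLift_tgt, h₂]
  · exact (comp_congr rfl (G.sqLift_right _ _ _ _ _) _ h₁).trans (key.trans
      (comp_congr (G.sqLift_left _ _ _ _ _) (G.sqLift_tgt _ _ _ _ _) _ h₂).symm)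

lemma sqComp_aux₁ {T : C} (m n : T ⟶ G.Sq) (h : m ≫ G.sqTgt = n ≫ G.sqSrc) :
    (m ≫ G.sqLeft) ≫ G.tgt = (n ≫ G.sqLeft) ≫ G.src := by
  rw [Category.assoc, Category.assoc, sqLeft_tgt, ← Category.assoc, h, Category.assoc, sqSrc_src]

lemma sqComp_aux₂ {T : C} (m n : T ⟶ G.Sq) (h : m ≫ G.sqTgt = n ≫ G.sqSrc) :
    (m ≫ G.sqRight) ≫ G.tgt = (n ≫ G.sqRight) ≫ G.src := by
  rw [Category.assoc, Category.assoc, sqRight_tgt, ← Category.assoc, h, Category.assoc, sqSrc_tgt]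

section
variable {T : C} (m n : T ⟶ G.Sq) (h : m ≫ G.sqTgt = n ≫ G.sqSrc)

/-- The composite of two squares. -/
noncomputable def sqComp : T ⟶ G.Sq :=
  G.sqLift (G.comp (m ≫ G.sqLeft) (n ≫ G.sqLeft) (G.sqComp_aux₁ m n h)) (n ≫ G.sqTgt)
    (G.comp (m ≫ G.sqRight) (n ≫ G.sqRight) (G.sqComp_aux₂ m n h))
    (by rw [G.comp_tgt, Category.assoc, Category.assoc, sqLeft_tgt])
    (by rw [G.comp_tgt, Category.assoc, Category.assoc, sqRight_tgt])

lemma sqComp_left : G.sqComp m n h ≫ G.sqLeft =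
    G.comp (m ≫ G.sqLeft) (n ≫ G.sqLeft) (G.sqComp_aux₁ m n h) := G.sqLift_left _ _ _ _ _

lemma sqComp_tgt : G.sqComp m n h ≫ G.sqTgt = n ≫ G.sqTgt := G.sqLift_tgt _ _ _ _ _

lemma sqComp_right : G.sqComp m n h ≫ G.sqRight =
    G.comp (m ≫ G.sqRight) (n ≫ G.sqRight) (G.sqComp_aux₂ m n h) := G.sqLift_right _ _ _ _ _

lemma sqSrc_tgt' : (m ≫ G.sqSrc) ≫ G.tgt = (m ≫ G.sqRight) ≫ G.src := by
  rw [Category.assoc, sqSrc_tgt, Category.assoc]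

lemma sqLeft_tgt' : (m ≫ G.sqLeft) ≫ G.tgt = (m ≫ G.sqTgt) ≫ G.src := by
  rw [Category.assoc, sqLeft_tgt, Category.assoc]

lemma sqComp_src : G.sqComp m n h ≫ G.sqSrc = m ≫ G.sqSrc := by
  have a₁ := G.sqComp_aux₁ m n h
  have a₂ := G.sqComp_aux₂ m n h
  have a₃ := G.sqSrc_tgt' m
  have a₄ := G.sqLeft_tgt' m
  have a₅ := G.sqSrc_tgt' n
  have a₆ := G.sqLeft_tgt' n
  have b₁ : (m ≫ G.sqSrc) ≫ G.tgt = G.comp (m ≫ G.sqRight) (n ≫ G.sqRight) a₂ ≫ G.src := by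
    rw [G.comp_src, a₃]
  have b₂ : G.comp (m ≫ G.sqLeft) (n ≫ G.sqLeft) a₁ ≫ G.tgt = (n ≫ G.sqTgt) ≫ G.src := by
    rw [G.comp_tgt, a₆]
  have b₃ : (m ≫ G.sqTgt) ≫ G.tgt = (n ≫ G.sqRight) ≫ G.src := by rw [h, a₅]
  refine (eq_sqSrc (m := G.sqComp m n h) (by rw [sqComp_right, b₁])
    (by rw [sqComp_left, sqComp_tgt, b₂]) ?_).symm
  calc _ = G.comp (m ≫ G.sqSrc) (G.comp (m ≫ G.sqRight) (n ≫ G.sqRight) a₂) b₁ :=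
        comp_congr rfl (G.sqComp_right m n h) _ _
    _ = G.comp (G.comp (m ≫ G.sqSrc) (m ≫ G.sqRight) a₃) (n ≫ G.sqRight)
          (by rw [G.comp_tgt, a₂]) := (G.comp_assoc _ _ _ _ _ _ _).symm
    _ = G.comp (G.comp (m ≫ G.sqLeft) (m ≫ G.sqTgt) a₄) (n ≫ G.sqRight)
          (by rw [G.comp_tgt, b₃]) := comp_congr (G.sq_comm m _ _) rfl _ _
    _ = G.comp (m ≫ G.sqLeft) (G.comp (m ≫ G.sqTgt) (n ≫ G.sqRight) b₃)
          (by rw [G.comp_src, a₄]) := G.comp_assoc _ _ _ _ _ _ _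
    _ = G.comp (m ≫ G.sqLeft) (G.comp (n ≫ G.sqLeft) (n ≫ G.sqTgt) a₆)
          (by rw [G.comp_src, a₁]) :=
        comp_congr rfl ((comp_congr h rfl _ a₅).trans (G.sq_comm n _ _)) _ _
    _ = G.comp (G.comp (m ≫ G.sqLeft) (n ≫ G.sqLeft) a₁) (n ≫ G.sqTgt) b₂ :=
        (G.comp_assoc _ _ _ _ _ _ _).symm
    _ = _ := (comp_congr (G.sqComp_left m n h) (G.sqComp_tgt m n h) _ _).symm

lemma sqComp_natural {S : C} (s : S ⟶ T) (h') :
    s ≫ G.sqComp m n h = G.sqComp (s ≫ m) (s ≫ n) h' := by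
  refine G.sq_ext ?_ ?_ ?_
  · rw [Category.assoc, sqComp_left, sqComp_left, G.comp_natural s _ _ _ (by
      simpa using s ≫= (G.sqComp_aux₁ m n h))]
    exact comp_congr (Category.assoc _ _ _).symm (Category.assoc _ _ _).symm _ _
  · rw [Category.assoc, sqComp_tgt, sqComp_tgt, Category.assoc]
  · rw [Category.assoc, sqComp_right, sqComp_right, G.comp_natural s _ _ _ (by
      simpa using s ≫= (G.sqComp_aux₂ m n h))]
    exact comp_congr (Category.assoc _ _ _).symm (Category.assoc _ _ _).symm _ _

end

lemma sqUnit_sqTgt : G.sqUnit ≫ G.sqTgt = 𝟙 _ := by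
  rw [sqUnit, sqLift_tgt]

lemma sqUnit_left {T : C} (a : T ⟶ G.Ar) :
    (a ≫ G.sqUnit) ≫ G.sqLeft = (a ≫ G.src) ≫ G.unit := by
  rw [Category.assoc, sqUnit, sqLift_left, Category.assoc]

lemma sqUnit_right {T : C} (a : T ⟶ G.Ar) :
    (a ≫ G.sqUnit) ≫ G.sqRight = (a ≫ G.tgt) ≫ G.unit := by
  rw [Category.assoc, sqUnit, sqLift_right, Category.assoc]

lemma sqUnit_tgt {T : C} (a : T ⟶ G.Ar) : (a ≫ G.sqUnit) ≫ G.sqTgt = a := by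
  rw [Category.assoc, sqUnit, sqLift_tgt, Category.comp_id]

lemma sqInv_left {T : C} (m : T ⟶ G.Sq) :
    (m ≫ G.sqInv) ≫ G.sqLeft = (m ≫ G.sqLeft) ≫ G.inv := by
  rw [Category.assoc, sqInv, sqLift_left, Category.assoc]

lemma sqInv_right {T : C} (m : T ⟶ G.Sq) :
    (m ≫ G.sqInv) ≫ G.sqRight = (m ≫ G.sqRight) ≫ G.inv := by
  rw [Category.assoc, sqInv, sqLift_right, Category.assoc]

lemma sqInv_tgt : G.sqInv ≫ G.sqTgt = G.sqSrc := G.sqLift_tgt _ _ _ _ _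

section Path

variable [J.HasIsos]

/-- The structure arrows of the path groupoid. -/
noncomputable abbrev pathPre (G : IntGroupoid J) : PreGroupoid J where
  Ob := G.Ar
  Ar := G.Sq
  src := G.sqSrc
  tgt := G.sqTgt
  tgt_adm := .of_section G.sqTgt G.sqUnit G.sqUnit_sqTgt (fun _ => inferInstance)
  unit := G.sqUnit
  inv := G.sqInv
  mul := G.sqComp (pullback.fst _ _) (pullback.snd _ _) pullback.condition

lemma pathPre_comp {T : C} (m n : T ⟶ G.Sq) (h : m ≫ G.sqTgt = n ≫ G.sqSrc) :
    G.pathPre.comp m n h = G.sqComp m n h := by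
  have e : G.pathPre.comp m n h = pullback.lift m n h ≫
    G.sqComp (pullback.fst _ _) (pullback.snd _ _) pullback.condition := rfl
  rw [e, G.sqComp_natural _ _ _ _ (by
    rw [pullback.lift_fst, pullback.lift_snd, h])]
  congr 1
  · exact pullback.lift_fst _ _ _
  · exact pullback.lift_snd _ _ _

section
variable {T : C} (m n : T ⟶ G.Sq) (h : m ≫ G.sqTgt = n ≫ G.sqSrc)

lemma pathPre_comp_left : G.pathPre.comp m n h ≫ G.sqLeft =
    G.comp (m ≫ G.sqLeft) (n ≫ G.sqLeft) (G.sqComp_aux₁ m n h) :=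
  (congrArg (· ≫ G.sqLeft) (G.pathPre_comp m n h)).trans (G.sqComp_left m n h)

lemma pathPre_comp_tgt : G.pathPre.comp m n h ≫ G.sqTgt = n ≫ G.sqTgt :=
  (congrArg (· ≫ G.sqTgt) (G.pathPre_comp m n h)).trans (G.sqComp_tgt m n h)

lemma pathPre_comp_src : G.pathPre.comp m n h ≫ G.sqSrc = m ≫ G.sqSrc :=
  (congrArg (· ≫ G.sqSrc) (G.pathPre_comp m n h)).trans (G.sqComp_src m n h)

lemma pathPre_comp_right : G.pathPre.comp m n h ≫ G.sqRight =
    G.comp (m ≫ G.sqRight) (n ≫ G.sqRight) (G.sqComp_aux₂ m n h) :=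
  (congrArg (· ≫ G.sqRight) (G.pathPre_comp m n h)).trans (G.sqComp_right m n h)

end

/-- The path groupoid `G^I`. -/
noncomputable abbrev pathObj (G : IntGroupoid J) : IntGroupoid J where
  toPreGroupoid := G.pathPre
  unit_src := G.sqUnit_src
  unit_tgt := G.sqUnit_sqTgt
  comp_src m n h := G.pathPre_comp_src m n h
  comp_tgt m n h := G.pathPre_comp_tgt m n h
  unit_comp {T} m h := by
    change T ⟶ G.Sq at m
    change ((m ≫ G.sqSrc ≫ G.sqUnit) ≫ G.sqTgt) = m ≫ G.sqSrc at h
    change G.pathPre.comp (m ≫ G.sqSrc ≫ G.sqUnit) m h = m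
    refine G.sq_ext ?_ (G.pathPre_comp_tgt _ _ h) ?_
    · have e := (congrArg (· ≫ G.sqLeft) (Category.assoc m G.sqSrc G.sqUnit).symm).trans
        (G.sqUnit_left (m ≫ G.sqSrc))
      refine (G.pathPre_comp_left _ _ h).trans ((comp_congr e rfl _ ?_).trans
        (unit_comp' _ _ ?_)) <;> simp [G.unit_tgt, G.sqSrc_src]
    · have e := (congrArg (· ≫ G.sqRight) (Category.assoc m G.sqSrc G.sqUnit).symm).trans
        (G.sqUnit_right (m ≫ G.sqSrc))
      refine (G.pathPre_comp_right _ _ h).trans ((comp_congr e rfl _ ?_).trans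
        (unit_comp' _ _ ?_)) <;> simp [G.unit_tgt, G.sqSrc_tgt]
  comp_unit {T} m h := by
    change T ⟶ G.Sq at m
    change m ≫ G.sqTgt = ((m ≫ G.sqTgt ≫ G.sqUnit) ≫ G.sqSrc) at h
    change G.pathPre.comp m (m ≫ G.sqTgt ≫ G.sqUnit) h = m
    have e₀ := Category.assoc m G.sqTgt G.sqUnit
    refine G.sq_ext ?_ ((G.pathPre_comp_tgt _ _ h).trans ?_) ?_
    · have e := (congrArg (· ≫ G.sqLeft) e₀.symm).trans (G.sqUnit_left (m ≫ G.sqTgt))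
      refine (G.pathPre_comp_left _ _ h).trans ((comp_congr rfl e _ ?_).trans
        (comp_unit' _ _ ?_)) <;> simp [G.unit_src, G.sqLeft_tgt]
    · rw [← e₀, sqUnit_tgt]
    · have e := (congrArg (· ≫ G.sqRight) e₀.symm).trans (G.sqUnit_right (m ≫ G.sqTgt))
      refine (G.pathPre_comp_right _ _ h).trans ((comp_congr rfl e _ ?_).trans
        (comp_unit' _ _ ?_)) <;> simp [G.unit_src, G.sqRight_tgt]
  comp_assoc {T} m n k h₁ h₂ h₃ h₄ := by
    change T ⟶ G.Sq at m n k
    have f₁ : m ≫ G.sqTgt = n ≫ G.sqSrc := h₁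
    have f₃ : n ≫ G.sqTgt = k ≫ G.sqSrc := h₃
    have a₁ := G.sqComp_aux₁ m n f₁
    have a₃ := G.sqComp_aux₁ n k f₃
    have b₁ := G.sqComp_aux₂ m n f₁
    have b₃ := G.sqComp_aux₂ n k f₃
    refine G.sq_ext ?_ ?_ ?_
    · refine (G.pathPre_comp_left _ _ h₂).trans (Eq.trans ?_ (G.pathPre_comp_left _ _ h₄).symm)
      refine (comp_congr (G.pathPre_comp_left m n h₁) rfl _ (by rw [G.comp_tgt, a₃])).trans
        (Eq.trans ?_ (comp_congr rfl (G.pathPre_comp_left n k h₃) _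
          (by rw [G.comp_src, a₁])).symm)
      exact G.comp_assoc _ _ _ _ _ _ _
    · exact (G.pathPre_comp_tgt _ _ h₂).trans (((G.pathPre_comp_tgt _ _ h₄).trans
        (G.pathPre_comp_tgt _ _ h₃)).symm)
    · refine (G.pathPre_comp_right _ _ h₂).trans (Eq.trans ?_ (G.pathPre_comp_right _ _ h₄).symm)
      refine (comp_congr (G.pathPre_comp_right m n h₁) rfl _ (by rw [G.comp_tgt, b₃])).trans
        (Eq.trans ?_ (comp_congr rfl (G.pathPre_comp_right n k h₃) _
          (by rw [G.comp_src, b₁])).symm)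
      exact G.comp_assoc _ _ _ _ _ _ _
  inv_src := G.sqInv_src
  inv_tgt := G.sqInv_tgt
  comp_inv {T} m h := by
    change T ⟶ G.Sq at m
    have e₀ := Category.assoc m G.sqSrc G.sqUnit
    refine G.sq_ext ?_ ?_ ?_
    · refine (G.pathPre_comp_left _ _ h).trans ((comp_congr rfl (G.sqInv_left m) _ (by
        simp [G.inv_src])).trans ((G.comp_inv _ (by simp [G.inv_src])).trans ?_))
      refine Eq.trans ?_ (congrArg (· ≫ G.sqLeft) e₀)
      refine Eq.trans ?_ (G.sqUnit_left (m ≫ G.sqSrc)).symm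
      rw [Category.assoc m G.sqSrc, sqSrc_src]
      simp only [Category.assoc]
    · refine (G.pathPre_comp_tgt _ _ h).trans ?_
      refine Eq.trans ?_ (congrArg (· ≫ G.sqTgt) e₀)
      refine Eq.trans ?_ (G.sqUnit_tgt (m ≫ G.sqSrc)).symm
      exact (Category.assoc _ _ _).trans (congrArg (m ≫ ·) G.sqInv_tgt)
    · refine (G.pathPre_comp_right _ _ h).trans ((comp_congr rfl (G.sqInv_right m) _ (by
        simp [G.inv_src])).trans ((G.comp_inv _ (by simp [G.inv_src])).trans ?_))
      refine Eq.trans ?_ (congrArg (· ≫ G.sqRight) e₀)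
      refine Eq.trans ?_ (G.sqUnit_right (m ≫ G.sqSrc)).symm
      rw [Category.assoc m G.sqSrc, sqSrc_tgt]
      simp only [Category.assoc]
  inv_comp {T} m h := by
    change T ⟶ G.Sq at m
    have e₀ := Category.assoc m G.sqTgt G.sqUnit
    refine G.sq_ext ?_ ?_ ?_
    · refine (G.pathPre_comp_left _ _ h).trans ((comp_congr (G.sqInv_left m) rfl _ (by
        simp [G.inv_tgt])).trans ((G.inv_comp _ (by simp [G.inv_tgt])).trans ?_))
      refine Eq.trans ?_ (congrArg (· ≫ G.sqLeft) e₀)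
      refine Eq.trans ?_ (G.sqUnit_left (m ≫ G.sqTgt)).symm
      rw [Category.assoc m G.sqTgt, ← sqLeft_tgt]
      simp only [Category.assoc]
    · refine (G.pathPre_comp_tgt _ _ h).trans ?_
      refine Eq.trans ?_ (congrArg (· ≫ G.sqTgt) e₀)
      exact (G.sqUnit_tgt (m ≫ G.sqTgt)).symm
    · refine (G.pathPre_comp_right _ _ h).trans ((comp_congr (G.sqInv_right m) rfl _ (by
        simp [G.inv_tgt])).trans ((G.inv_comp _ (by simp [G.inv_tgt])).trans ?_))
      refine Eq.trans ?_ (congrArg (· ≫ G.sqRight) e₀)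
      refine Eq.trans ?_ (G.sqUnit_right (m ≫ G.sqTgt)).symm
      rw [Category.assoc m G.sqTgt, ← sqRight_tgt]
      simp only [Category.assoc]

section
variable {G H : IntGroupoid J} (f : G ⟶ H)

lemma pathAr_aux₁ : (G.sqLeft ≫ f.ar) ≫ H.tgt = (G.sqTgt ≫ f.ar) ≫ H.src := by
  rw [Category.assoc, Category.assoc, f.ar_tgt, f.ar_src, ← Category.assoc, sqLeft_tgt,
    Category.assoc]

lemma pathAr_aux₂ : (G.sqRight ≫ f.ar) ≫ H.tgt = (G.sqTgt ≫ f.ar) ≫ H.tgt := by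
  rw [Category.assoc, Category.assoc, f.ar_tgt, ← Category.assoc, sqRight_tgt, Category.assoc]

/-- The image of a square under a strict arrow. -/
noncomputable def pathAr : G.Sq ⟶ H.Sq :=
  H.sqLift (G.sqLeft ≫ f.ar) (G.sqTgt ≫ f.ar) (G.sqRight ≫ f.ar) (pathAr_aux₁ f) (pathAr_aux₂ f)

lemma pathAr_left : pathAr f ≫ H.sqLeft = G.sqLeft ≫ f.ar := H.sqLift_left _ _ _ _ _

lemma pathAr_tgt : pathAr f ≫ H.sqTgt = G.sqTgt ≫ f.ar := H.sqLift_tgt _ _ _ _ _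

lemma pathAr_right : pathAr f ≫ H.sqRight = G.sqRight ≫ f.ar := H.sqLift_right _ _ _ _ _

lemma pathAr_src : pathAr f ≫ H.sqSrc = G.sqSrc ≫ f.ar := by
  have h₁ : (G.sqSrc ≫ f.ar) ≫ H.tgt = (G.sqRight ≫ f.ar) ≫ H.src := by
    rw [Category.assoc, Category.assoc, f.ar_tgt, f.ar_src, ← Category.assoc, sqSrc_tgt,
      Category.assoc]
  refine (eq_sqSrc (by rw [pathAr_right, h₁])
    (by rw [Category.assoc, Category.assoc, sqLeft_tgt]) ?_).symm
  refine (comp_congr rfl (pathAr_right f) _ h₁).trans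
    (Eq.trans ?_ (comp_congr (pathAr_left f) (pathAr_tgt f) _ (pathAr_aux₁ f)).symm)
  rw [← f.map_comp _ _ G.sqSrc_tgt h₁, ← f.map_comp _ _ G.sqLeft_tgt (pathAr_aux₁ f)]
  refine congrArg (· ≫ f.ar) ?_
  have := G.sq_comm (𝟙 _) (by simpa using G.sqSrc_tgt) (by simpa using G.sqLeft_tgt)
  exact (comp_congr (Category.id_comp _).symm (Category.id_comp _).symm _ _).trans
    (this.trans (comp_congr (Category.id_comp _) (Category.id_comp _) _ _))

/-- The path functor on strict arrows. -/
noncomputable def pathMap : G.pathObj ⟶ H.pathObj :=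
  StrictArrow.mk (G := G.pathObj) (H := H.pathObj) f.ar (pathAr f) (pathAr_src f) (pathAr_tgt f)
    (by
      intro T m n h h'
      change T ⟶ G.Sq at m n
      have e : ∀ k : T ⟶ G.Sq, ((k ≫ pathAr f) ≫ H.sqLeft = (k ≫ G.sqLeft) ≫ f.ar) ∧
          ((k ≫ pathAr f) ≫ H.sqTgt = (k ≫ G.sqTgt) ≫ f.ar) ∧
          ((k ≫ pathAr f) ≫ H.sqRight = (k ≫ G.sqRight) ≫ f.ar) := fun k =>
        ⟨by rw [Category.assoc, Category.assoc, pathAr_left],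
          by rw [Category.assoc, Category.assoc, pathAr_tgt],
          by rw [Category.assoc, Category.assoc, pathAr_right]⟩
      refine H.sq_ext ?_ ?_ ?_
      · refine (e _).1.trans (Eq.trans ?_ (H.pathPre_comp_left _ _ h').symm)
        refine (congrArg (· ≫ f.ar) (G.pathPre_comp_left m n h)).trans ?_
        have a := H.sqComp_aux₁ _ _ h'
        have b : ((m ≫ G.sqLeft) ≫ f.ar) ≫ H.tgt = ((n ≫ G.sqLeft) ≫ f.ar) ≫ H.src :=
          (congrArg (· ≫ H.tgt) (e m).1).symm.trans (a.trans (congrArg (· ≫ H.src) (e n).1))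
        exact (f.map_comp _ _ _ b).trans (comp_congr (e m).1.symm (e n).1.symm _ _)
      · refine (e _).2.1.trans (Eq.trans ?_ (H.pathPre_comp_tgt _ _ h').symm)
        exact (congrArg (· ≫ f.ar) (G.pathPre_comp_tgt m n h)).trans (e n).2.1.symm
      · refine (e _).2.2.trans (Eq.trans ?_ (H.pathPre_comp_right _ _ h').symm)
        refine (congrArg (· ≫ f.ar) (G.pathPre_comp_right m n h)).trans ?_
        have a := H.sqComp_aux₂ _ _ h'
        have b : ((m ≫ G.sqRight) ≫ f.ar) ≫ H.tgt = ((n ≫ G.sqRight) ≫ f.ar) ≫ H.src :=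
          (congrArg (· ≫ H.tgt) (e m).2.2).symm.trans
            (a.trans (congrArg (· ≫ H.src) (e n).2.2))
        exact (f.map_comp _ _ _ b).trans (comp_congr (e m).2.2.symm (e n).2.2.symm _ _))
    (by
      change G.sqInv ≫ pathAr f = pathAr f ≫ H.sqInv
      refine H.sq_ext ?_ ?_ ?_
      · rw [sqInv_left, pathAr_left, Category.assoc, pathAr_left, Category.assoc, ← f.map_inv,
          ← Category.assoc, ← Category.assoc, sqInv, sqLift_left]
      · rw [Category.assoc, pathAr_tgt, Category.assoc, sqInv_tgt, pathAr_src, ← Category.assoc,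
          sqInv_tgt]
      · rw [sqInv_right, pathAr_right, Category.assoc, pathAr_right, Category.assoc, ← f.map_inv,
          ← Category.assoc, ← Category.assoc, sqInv, sqLift_right])

@[simp] lemma pathMap_ob : (pathMap f).ob = f.ar := rfl
@[simp] lemma pathMap_ar : (pathMap f).ar = pathAr f := rfl

end

section
variable (G : IntGroupoid J)

lemma sqInv_left₀ : G.sqInv ≫ G.sqLeft = G.sqLeft ≫ G.inv := by rw [sqInv, sqLift_left]

lemma sqInv_right₀ : G.sqInv ≫ G.sqRight = G.sqRight ≫ G.inv := by rw [sqInv, sqLift_right]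

/-- The face `G^I ⟶ G` which evaluates at the first object of `I`. -/
noncomputable def face₀ : G.pathObj ⟶ G :=
  StrictArrow.mk (G := G.pathObj) (H := G) G.src G.sqLeft G.sqSrc_src.symm G.sqLeft_tgt
    (fun m n h _ => G.pathPre_comp_left m n h) G.sqInv_left₀

/-- The face `G^I ⟶ G` which evaluates at the second object of `I`. -/
noncomputable def face₁ : G.pathObj ⟶ G :=
  StrictArrow.mk (G := G.pathObj) (H := G) G.tgt G.sqRight G.sqSrc_tgt.symm G.sqRight_tgt
    (fun m n h _ => G.pathPre_comp_right m n h) G.sqInv_right₀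

/-- The square of an arrow `a : x ⟶ y` with sides `a`, from the unit of `x` to the unit of `y`. -/
noncomputable def constAr : G.Ar ⟶ G.Sq :=
  G.sqLift (𝟙 _) (G.tgt ≫ G.unit) (𝟙 _) (by simp [G.unit_src]) (by simp [G.unit_tgt])

lemma constAr_left : G.constAr ≫ G.sqLeft = 𝟙 _ := G.sqLift_left _ _ _ _ _

lemma constAr_tgt : G.constAr ≫ G.sqTgt = G.tgt ≫ G.unit := G.sqLift_tgt _ _ _ _ _

lemma constAr_right : G.constAr ≫ G.sqRight = 𝟙 _ := G.sqLift_right _ _ _ _ _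

lemma constAr_src : G.constAr ≫ G.sqSrc = G.src ≫ G.unit := by
  have h₁ : (G.src ≫ G.unit) ≫ G.tgt = 𝟙 _ ≫ G.src := by simp [G.unit_tgt]
  have h₂ : 𝟙 _ ≫ G.tgt = (G.tgt ≫ G.unit) ≫ G.src := by simp [G.unit_src]
  refine (eq_sqSrc (by rw [constAr_right, h₁])
    (by rw [constAr_left, constAr_tgt, h₂]) ?_).symm
  refine (comp_congr rfl G.constAr_right _ h₁).trans
    (Eq.trans ?_ (comp_congr G.constAr_left G.constAr_tgt _ h₂).symm)
  rw [unit_comp', comp_unit']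

/-- The degeneracy `G ⟶ G^I`. -/
noncomputable def degen : G ⟶ G.pathObj :=
  StrictArrow.mk (G := G) (H := G.pathObj) G.unit G.constAr G.constAr_src G.constAr_tgt
    (by
      intro T a b h h'
      have e : ∀ c : T ⟶ G.Ar, ((c ≫ G.constAr) ≫ G.sqLeft = c) ∧
          ((c ≫ G.constAr) ≫ G.sqTgt = (c ≫ G.tgt) ≫ G.unit) ∧
          ((c ≫ G.constAr) ≫ G.sqRight = c) := fun c =>
        ⟨by rw [Category.assoc, constAr_left, Category.comp_id],
          by rw [Category.assoc, constAr_tgt, Category.assoc],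
          by rw [Category.assoc, constAr_right, Category.comp_id]⟩
      refine G.sq_ext ?_ ?_ ?_
      · exact (e _).1.trans ((comp_congr (e a).1.symm (e b).1.symm _ (by
          rw [(e a).1, (e b).1, h])).trans (G.pathPre_comp_left _ _ h').symm)
      · exact (e _).2.1.trans ((congrArg (· ≫ G.unit) (G.comp_tgt a b h)).trans
          ((e b).2.1.symm.trans (G.pathPre_comp_tgt _ _ h').symm))
      · exact (e _).2.2.trans ((comp_congr (e a).2.2.symm (e b).2.2.symm _ (by
          rw [(e a).2.2, (e b).2.2, h])).trans (G.pathPre_comp_right _ _ h').symm))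
    (by
      change G.inv ≫ G.constAr = G.constAr ≫ G.sqInv
      refine G.sq_ext ?_ ?_ ?_
      · rw [sqInv_left, constAr_left, Category.assoc, constAr_left, Category.comp_id,
          Category.id_comp]
      · rw [Category.assoc, constAr_tgt, Category.assoc, sqInv_tgt, constAr_src, ← Category.assoc,
          G.inv_tgt]
      · rw [sqInv_right, constAr_right, Category.assoc, constAr_right, Category.comp_id,
          Category.id_comp])

end

@[simp] lemma face₀_ob (G : IntGroupoid J) : G.face₀.ob = G.src := rfl
@[simp] lemma face₀_ar (G : IntGroupoid J) : G.face₀.ar = G.sqLeft := rfl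
@[simp] lemma face₁_ob (G : IntGroupoid J) : G.face₁.ob = G.tgt := rfl
@[simp] lemma face₁_ar (G : IntGroupoid J) : G.face₁.ar = G.sqRight := rfl
@[simp] lemma degen_ob (G : IntGroupoid J) : G.degen.ob = G.unit := rfl
@[simp] lemma degen_ar (G : IntGroupoid J) : G.degen.ar = G.constAr := rfl

/-- Strict arrows preserve units. -/
lemma unit_ar {G H : IntGroupoid J} (f : G ⟶ H) : G.unit ≫ f.ar = f.ob ≫ H.unit := by
  have h : (𝟙 G.Ob ≫ G.unit) ≫ G.tgt = G.unit ≫ G.src := by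
    rw [Category.id_comp, G.unit_tgt, G.unit_src]
  have h₁ : ((𝟙 G.Ob ≫ G.unit) ≫ f.ar) ≫ H.tgt = (G.unit ≫ f.ar) ≫ H.src := by
    simp only [Category.assoc, f.ar_tgt, f.ar_src, Category.id_comp]
    rw [reassoc_of% G.unit_tgt, reassoc_of% G.unit_src]
  have h₂ : (G.unit ≫ f.ar) ≫ H.tgt = (f.ob ≫ H.unit) ≫ H.src := by
    rw [Category.assoc, Category.assoc, f.ar_tgt, ← Category.assoc, G.unit_tgt, H.unit_src]
    simp
  have e := (f.map_comp _ _ h h₁).symm.trans (congrArg (· ≫ f.ar) (unit_comp' _ _ h))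
  refine comp_left_cancel (a := G.unit ≫ f.ar) (hb := by
    rw [Category.id_comp] at h₁; exact h₁) (hc := h₂) ?_
  rw [comp_unit']
  exact (comp_congr (by rw [Category.id_comp]) rfl _ _).trans e

/-- The cocylinder on the category of internal groupoids: `G^I` is the groupoid of functors from
the groupoid `I` on two objects to `G`. -/
noncomputable def cocylinder (J : Precoverage C) [J.HasIsos] : Cocylinder (IntGroupoid J) where
  path :=
    { obj := fun G => G.pathObj
      map := fun f => pathMap f
      map_id := fun G => hom_ext rfl (G.sq_ext
        (by simp [pathAr_left]) (by simp [pathAr_tgt]) (by simp [pathAr_right]))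
      map_comp := fun {G H K} f g => hom_ext rfl (K.sq_ext
        (by simp [pathAr_left, reassoc_of% (pathAr_left f)])
        (by simp [pathAr_tgt, reassoc_of% (pathAr_tgt f)])
        (by simp [pathAr_right, reassoc_of% (pathAr_right f)])) }
  e₀ :=
    { app := fun G => G.face₀
      naturality := fun G H f => by
        apply hom_ext
        · simpa using f.ar_src
        · simpa using pathAr_left f }
  e₁ :=
    { app := fun G => G.face₁
      naturality := fun G H f => by
        apply hom_ext
        · simpa using f.ar_tgt
        · simpa using pathAr_right f }
  t :=
    { app := fun G => G.degen
      naturality := fun G H f => by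
        apply hom_ext
        · simpa using (unit_ar f).symm
        · refine H.sq_ext ?_ ?_ ?_
          · simp [pathAr_left, constAr_left, reassoc_of% G.constAr_left]
          · simp [pathAr_tgt, constAr_tgt, reassoc_of% G.constAr_tgt, unit_ar,
              reassoc_of% f.ar_tgt]
          · simp [pathAr_right, constAr_right, reassoc_of% G.constAr_right] }
  t_e₀ := by
    ext G : 2
    apply hom_ext
    · simpa using G.unit_src
    · simpa using G.constAr_left
  t_e₁ := by
    ext G : 2
    apply hom_ext
    · simpa using G.unit_tgt
    · simpa using G.constAr_right

end Path

instance (G : IntGroupoid J) {Y : C} (f : Y ⟶ G.Ob) : HasPullback G.src f := by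
  have hi : G.inv ≫ G.inv = 𝟙 _ := by
    have h₁ : G.inv ≫ G.tgt = 𝟙 _ ≫ G.src := by rw [G.inv_tgt, Category.id_comp]
    have h₂ : G.inv ≫ G.tgt = (G.inv ≫ G.inv) ≫ G.src := by rw [Category.assoc, G.inv_src]
    refine comp_left_cancel (a := G.inv) (hb := h₂) (hc := h₁) ?_
    have e := (comp_congr (Category.id_comp _).symm rfl h₁ (by simpa using h₁)).trans
      (G.inv_comp (𝟙 _) (by simpa using h₁))
    rw [G.comp_inv, e, ← G.inv_src, Category.id_comp, Category.assoc]
  have : IsIso G.inv := ⟨G.inv, hi, hi⟩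
  have h : IsPullback G.inv G.tgt G.src (𝟙 _) := IsPullback.of_horiz_isIso ⟨by simp [G.inv_src]⟩
  have h' := (IsPullback.of_hasPullback G.tgt f).paste_horiz h
  rw [Category.comp_id] at h'
  exact h'.hasPullback

/-- Essential equivalences of internal groupoids: the strict arrow `φ : H ⟶ G` is
* essentially surjective: the range map on the object `G₁ ×_{G₀} H₀` of arrows of `G` which start
  in the image of `φ` is an admissible epimorphism;
* fully faithful: the square formed by `(src, tgt) : H₁ ⟶ H₀ × H₀`, `(src, tgt) : G₁ ⟶ G₀ × G₀`
  and `φ` is a pullback, in terms of generalized elements. -/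
structure IsEssentialEquivalence {H G : IntGroupoid J} (φ : H ⟶ G) : Prop where
  essSurj : Admissible J (pullback.fst G.src φ.ob ≫ G.tgt)
  fullyFaithful : ∀ {T : C} (x y : T ⟶ H.Ob) (γ : T ⟶ G.Ar),
    γ ≫ G.src = x ≫ φ.ob → γ ≫ G.tgt = y ≫ φ.ob →
      ∃! η : T ⟶ H.Ar, η ≫ H.src = x ∧ η ≫ H.tgt = y ∧ η ≫ φ.ar = γ

/-- If `C` has binary products, then full faithfulness is the usual pullback condition. -/
lemma fullyFaithful_iff [HasBinaryProducts C] {H G : IntGroupoid J} (φ : H ⟶ G) :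
    (∀ {T : C} (x y : T ⟶ H.Ob) (γ : T ⟶ G.Ar),
      γ ≫ G.src = x ≫ φ.ob → γ ≫ G.tgt = y ≫ φ.ob →
        ∃! η : T ⟶ H.Ar, η ≫ H.src = x ∧ η ≫ H.tgt = y ∧ η ≫ φ.ar = γ) ↔
    IsPullback φ.ar (prod.lift H.src H.tgt) (prod.lift G.src G.tgt) (prod.map φ.ob φ.ob) := by
  have w : φ.ar ≫ prod.lift G.src G.tgt = prod.lift H.src H.tgt ≫ prod.map φ.ob φ.ob := by
    ext <;> simp [φ.ar_src, φ.ar_tgt, prod.lift_fst, prod.lift_snd]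
  constructor
  · intro h
    have c₁ : ∀ s : PullbackCone (prod.lift G.src G.tgt) (prod.map φ.ob φ.ob),
        s.fst ≫ G.src = (s.snd ≫ prod.fst) ≫ φ.ob := fun s => by
      simpa [prod.lift_fst] using s.condition =≫ prod.fst
    have c₂ : ∀ s : PullbackCone (prod.lift G.src G.tgt) (prod.map φ.ob φ.ob),
        s.fst ≫ G.tgt = (s.snd ≫ prod.snd) ≫ φ.ob := fun s => by
      simpa [prod.lift_snd] using s.condition =≫ prod.snd
    refine ⟨⟨w⟩, ⟨PullbackCone.IsLimit.mk _ (fun s => (h _ _ s.fst (c₁ s) (c₂ s)).choose)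
      (fun s => (h _ _ s.fst (c₁ s) (c₂ s)).choose_spec.1.2.2) (fun s => ?_)
      (fun s m hm hm' => (h _ _ s.fst (c₁ s) (c₂ s)).choose_spec.2 m
        ⟨by simp [← hm', prod.lift_fst, -prod.comp_lift],
          by simp [← hm', prod.lift_snd, -prod.comp_lift], hm⟩)⟩⟩
    have e := (h _ _ s.fst (c₁ s) (c₂ s)).choose_spec.1
    ext
    · simpa [prod.lift_fst, -prod.comp_lift] using e.1
    · simpa [prod.lift_snd, -prod.comp_lift] using e.2.1
  · intro h T x y γ h₁ h₂
    have c : γ ≫ prod.lift G.src G.tgt = prod.lift x y ≫ prod.map φ.ob φ.ob := by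
      ext <;> simp [h₁, h₂, prod.lift_fst, prod.lift_snd]
    have e := h.lift_snd γ (prod.lift x y) c
    refine ⟨h.lift γ (prod.lift x y) c, ⟨?_, ?_, h.lift_fst _ _ _⟩, ?_⟩
    · have e' := e =≫ prod.fst
      rwa [Category.assoc, prod.lift_fst, prod.lift_fst] at e'
    · have e' := e =≫ prod.snd
      rwa [Category.assoc, prod.lift_snd, prod.lift_snd] at e'
    · rintro m ⟨h₃, h₄, h₅⟩
      apply h.hom_ext
      · rw [h₅, h.lift_fst]
      · rw [e]
        ext <;> simp [h₃, h₄, prod.lift_fst, prod.lift_snd]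

/-- Essential homotopy equivalences: strict arrows which are, up to strong homotopy, a strong
homotopy equivalence followed by an essential equivalence. -/
def IsEssentialHomotopyEquivalence [J.HasIsos] {K G : IntGroupoid J} (η : K ⟶ G) : Prop :=
  ∃ (L : IntGroupoid J) (h : K ⟶ L) (ε : L ⟶ G),
    (cocylinder J).IsStrongHomotopyEquivalence h ∧ IsEssentialEquivalence ε ∧
      (cocylinder J).StronglyHomotopic (h ≫ ε) η

end IntGroupoid

/-- The bicategory of internal groupoids, strict arrows, and homotopy classes of strong
homotopies. -/
abbrev AHG₂ (J : Precoverage C) [J.HasIsos] : Type (max u v) := HoBicat (IntGroupoid.cocylinder J)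

/-- The class of essential homotopy equivalences in the bicategory of internal groupoids. -/
def essentialHomotopyEquivalences (J : Precoverage C) [J.HasIsos] :
    ∀ ⦃K G : AHG₂ J⦄, (K ⟶ G) → Prop :=
  fun _ _ η => IntGroupoid.IsEssentialHomotopyEquivalence η.arrow

end Groupoid

/-! ### Bicalculus of fractions and localization of bicategories -/

section Localization

open Bicategory
open scoped Pseudofunctor.StrongTrans

variable {A : Type u₁} [Bicategory.{w₁, v₁} A]

/-- The 1-cell `f` is an equivalence: it has an inverse up to invertible 2-cells. -/
def IsEquivalence {a b : A} (f : a ⟶ b) : Prop :=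
  ∃ g : b ⟶ a, Nonempty (f ≫ g ≅ 𝟙 a) ∧ Nonempty (g ≫ f ≅ 𝟙 b)

/-- A solution of the lifting problem for a 2-cell `α : f ≫ w ⟶ g ≫ w` along `w`: a 1-cell `v` in
`W` and a 2-cell `β : v ≫ f ⟶ v ≫ g` such that `β` whiskered with `w` is `α` whiskered with `v`. -/
structure TwoCellLift (W : ∀ ⦃a b : A⦄, (a ⟶ b) → Prop) {a b c : A} {f g : a ⟶ b} {w : b ⟶ c}
    (α : f ≫ w ⟶ g ≫ w) where
  dom : A
  v : dom ⟶ a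
  mem : W v
  β : v ≫ f ⟶ v ≫ g
  comm : v ◁ α = (α_ v f w).inv ≫ β ▷ w ≫ (α_ v g w).hom

/-- The class `W` of 1-cells admits a bicalculus of (right) fractions. -/
structure BicalculusOfFractions (W : ∀ ⦃a b : A⦄, (a ⟶ b) → Prop) : Prop where
  /-- All equivalences belong to `W`. -/
  equivalence : ∀ ⦃a b : A⦄ (f : a ⟶ b), IsEquivalence f → W f
  /-- `W` is closed under composition. -/
  comp : ∀ ⦃a b c : A⦄ (f : a ⟶ b) (g : b ⟶ c), W f → W g → W (f ≫ g)
  /-- Every cospan with one side in `W` can be completed to a square which commutes up to an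
  invertible 2-cell and whose opposite side is in `W`. -/
  square : ∀ ⦃a b c : A⦄ (w : a ⟶ b) (f : c ⟶ b), W w →
    ∃ (p : A) (w' : p ⟶ c) (f' : p ⟶ a), W w' ∧ Nonempty (w' ≫ f ≅ f' ≫ w)
  /-- Every 2-cell `α : f ≫ w ⟶ g ≫ w` with `w` in `W` can be lifted along `w`. -/
  lift : ∀ ⦃a b c : A⦄ (f g : a ⟶ b) (w : b ⟶ c) (α : f ≫ w ⟶ g ≫ w), W w →
    ∃ L : TwoCellLift W α, IsIso α → IsIso L.β
  /-- Any two lifts become isomorphic after restriction along suitable 1-cells. -/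
  lift_unique : ∀ ⦃a b c : A⦄ (f g : a ⟶ b) (w : b ⟶ c) (α : f ≫ w ⟶ g ≫ w), W w →
    ∀ L L' : TwoCellLift W α,
      ∃ (q : A) (s : q ⟶ L.dom) (s' : q ⟶ L'.dom) (e : s ≫ L.v ≅ s' ≫ L'.v),
        W (s ≫ L.v) ∧ W (s' ≫ L'.v) ∧
        ((α_ s L.v f).hom ≫ s ◁ L.β ≫ (α_ s L.v g).inv) ≫ e.hom ▷ g =
          e.hom ▷ f ≫ (α_ s' L'.v f).hom ≫ s' ◁ L'.β ≫ (α_ s' L'.v g).inv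
  /-- `W` is closed under invertible 2-cells. -/
  iso : ∀ ⦃a b : A⦄ (f g : a ⟶ b), Nonempty (f ≅ g) → W f → W g

variable {B : Type u₂} [Bicategory.{w₂, v₂} B]

/-- The pseudofunctor `F` sends the 1-cells in `W` to equivalences. -/
def Inverts (W : ∀ ⦃a b : A⦄, (a ⟶ b) → Prop) (F : A ⥤ᵖ B) : Prop :=
  ∀ ⦃a b : A⦄ (f : a ⟶ b), W f → IsEquivalence (F.map f)

variable {D : Type u₃} [Bicategory.{w₃, v₃} D]

/-- Precomposition of a pseudonatural transformation with a pseudofunctor. -/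
def precompTrans (U : A ⥤ᵖ B) {G G' : B ⥤ᵖ D} (η : G ⟶ G') : U.comp G ⟶ U.comp G' :=
  Pseudofunctor.StrongTrans.mk (F := U.comp G) (G := U.comp G')
    (fun a => η.app (U.obj a)) (fun f => η.naturality (U.map f))
    (fun θ => η.naturality_naturality (U.map₂ θ))
    (fun a => by
      have h₁ := η.naturality_naturality (U.mapId a).hom
      have h₂ := η.naturality_id (U.obj a)
      change (η.naturality (U.map (𝟙 a))).hom ≫
        η.app (U.obj a) ◁ (G'.map₂ (U.mapId a).hom ≫ (G'.mapId (U.obj a)).hom) =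
          (G.map₂ (U.mapId a).hom ≫ (G.mapId (U.obj a)).hom) ▷ η.app (U.obj a) ≫ _
      rw [Bicategory.whiskerLeft_comp, comp_whiskerRight, ← reassoc_of% h₁, h₂]
      exact (Category.assoc _ _ _).symm)
    (fun {a b c} f g => by
      have h₁ := η.naturality_naturality (U.mapComp f g).hom
      have h₂ := η.naturality_comp (U.map f) (U.map g)
      change (η.naturality (U.map (f ≫ g))).hom ≫ η.app (U.obj a) ◁
        (G'.map₂ (U.mapComp f g).hom ≫ (G'.mapComp (U.map f) (U.map g)).hom) =
          (G.map₂ (U.mapComp f g).hom ≫ (G.mapComp (U.map f) (U.map g)).hom) ▷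
            η.app (U.obj c) ≫ _
      rw [Bicategory.whiskerLeft_comp, comp_whiskerRight, ← reassoc_of% h₁, h₂]
      exact (Category.assoc _ _ _).symm)

/-- Precomposition with a pseudofunctor `U`, as a functor from the category of pseudonatural
transformations `G ⟶ G'` and modifications to the one for the composites with `U`. -/
def precomp (U : A ⥤ᵖ B) (G G' : B ⥤ᵖ D) : (G ⟶ G') ⥤ (U.comp G ⟶ U.comp G') where
  obj η := precompTrans U η
  map Γ := ⟨⟨fun a => Γ.as.app (U.obj a), fun f => Γ.as.naturality (U.map f)⟩⟩

/-- `U : A ⥤ᵖ B` is a localization of the bicategory `A` at `W`: it sends the 1-cells in `W` to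
equivalences and is universal with this property (among bicategories `D` in given universes).
That is, every pseudofunctor `A ⥤ᵖ D` which sends the 1-cells in `W` to equivalences factors
through `U` up to equivalence, and composition with `U` is an equivalence between the categories
of pseudonatural transformations and modifications. -/
structure IsLocalization (W : ∀ ⦃a b : A⦄, (a ⟶ b) → Prop) (U : A ⥤ᵖ B) : Prop where
  inverts : Inverts W U
  factor : ∀ (D : Type u₃) [Bicategory.{w₃, v₃} D] (F : A ⥤ᵖ D), Inverts W F →
    ∃ (G : B ⥤ᵖ D) (η : U.comp G ⟶ F), IsEquivalence η
  isEquivalence : ∀ (D : Type u₃) [Bicategory.{w₃, v₃} D] (G G' : B ⥤ᵖ D),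
    (precomp U G G').IsEquivalence

end Localization

end IntGpd

/-!
Homotopy classes of strong homotopies are the same as internal natural transformations
(`IntGroupoid.cellEquiv`): a strong homotopy has a composite, and a two-dimensional homotopy can be
written down which shows that it is homotopic to the right homotopy given by its composite. All
2-cells are therefore invertible, and they can be compared by their components, which are arrows of
the site.

The essential homotopy equivalences are the strict arrows which are fully faithful and locally
essentially surjective, that is, every object of the target is isomorphic to one in the image over
the members of a cover (`IntGroupoid.isEssentialHomotopyEquivalence_iff`). The only point which is
not formal is that a fully faithful, locally essentially surjective `φ : H ⟶ G` is an essential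
equivalence: the arrow `G₁ ×_{G₀} H₀ ⟶ G₀` must have pullbacks. Over an object on which the
essential surjectivity is witnessed, its pullback is a pullback of the range map of `H`
(`IntGroupoid.FullyFaithful.hasPullback`), and effective descent glues the local pullbacks
(`hasPullback_of_locally`).

With this description the bicalculus of fractions is close to the one for categories. Both
properties are stable under composition and isomorphism. A square over a cospan `φ`, `f` is given by
the groupoid induced by the source of `f` on the object of arrows from the image of `φ` to the image
of `f` (`IntGroupoid.IsEssentialEquivalence.exists_square`); full faithfulness of `φ` provides the
remaining side. Whiskering with a fully faithful arrow is bijective on 2-cells, which gives the two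
conditions on 2-cells.

The localization does not need fractions: it exists for any class `W` of 1-cells in any bicategory.
The 1-cells of `FormalLoc W` are zigzags, whose backward steps are in `W`, and its 2-cells are
formal composites, modulo the equations of a bicategory, those making the inclusion a pseudofunctor,
and those making each backward step an adjoint inverse. Pseudofunctors which invert `W` extend to it
after a choice of adjoint inverses. A pseudonatural transformation is determined by its restriction
along the inclusion, because its component on a backward step is forced by the one on the forward
step, and the same holds for modifications (`FormalLoc.isLocalization_incl`).
-/

namespace IntGpd

/-! ### The bicategory freely generated by formal inverses -/

open Bicategory
open scoped Pseudofunctor.StrongTrans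

section FormalLocalization

variable {A : Type u₁} [Bicategory.{w₁, v₁} A] (W : ∀ ⦃a b : A⦄, (a ⟶ b) → Prop)

/-- Formal composites of 1-cells of `A` and of formal inverses of 1-cells in `W`. -/
inductive Zigzag : A → A → Type (max u₁ v₁)
  | of {a b : A} (f : a ⟶ b) : Zigzag a b
  | inv {a b : A} (w : a ⟶ b) (hw : W w) : Zigzag b a
  | id (a : A) : Zigzag a a
  | comp {a b c : A} (f : Zigzag a b) (g : Zigzag b c) : Zigzag a c

namespace Zigzag

/-- The generating invertible 2-cells between formal composites: the coherence 2-cells of a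
bicategory, those of a pseudofunctor on `A`, and the unit and counit which make `inv w` an inverse
of `w`. -/
inductive Gen : ∀ {a b : A}, Zigzag W a b → Zigzag W a b → Type (max u₁ v₁)
  | associator {a b c d : A} (f : Zigzag W a b) (g : Zigzag W b c) (h : Zigzag W c d) :
      Gen ((f.comp g).comp h) (f.comp (g.comp h))
  | leftUnitor {a b : A} (f : Zigzag W a b) : Gen ((id a).comp f) f
  | rightUnitor {a b : A} (f : Zigzag W a b) : Gen (f.comp (id b)) f
  | mapId (a : A) : Gen (of (𝟙 a)) (id a)
  | mapComp {a b c : A} (f : a ⟶ b) (g : b ⟶ c) : Gen (of (f ≫ g)) ((of f).comp (of g))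
  | unit {a b : A} (w : a ⟶ b) (hw : W w) : Gen (id a) ((of w).comp (inv w hw))
  | counit {a b : A} (w : a ⟶ b) (hw : W w) : Gen ((inv w hw).comp (of w)) (id b)

/-- Formal composites of 2-cells. -/
inductive Cell : ∀ {a b : A}, Zigzag W a b → Zigzag W a b → Type (max u₁ v₁ w₁)
  | of {a b : A} {f g : a ⟶ b} (θ : f ⟶ g) : Cell (of f) (of g)
  | hom {a b : A} {f g : Zigzag W a b} (c : Gen W f g) : Cell f g
  | inv {a b : A} {f g : Zigzag W a b} (c : Gen W f g) : Cell g f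
  | id {a b : A} (f : Zigzag W a b) : Cell f f
  | comp {a b : A} {f g h : Zigzag W a b} (η : Cell f g) (θ : Cell g h) : Cell f h
  | whiskerLeft {a b c : A} (f : Zigzag W a b) {g h : Zigzag W b c} (η : Cell g h) :
      Cell (f.comp g) (f.comp h)
  | whiskerRight {a b c : A} {f g : Zigzag W a b} (h : Zigzag W b c) (η : Cell f g) :
      Cell (f.comp h) (g.comp h)

section

local infixr:80 " ≫' " => Cell.comp
local infixr:81 " ◁' " => Cell.whiskerLeft
local notation:81 η:81 " ▷' " h:82 => Cell.whiskerRight h η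

open Gen in
/-- The relations between formal composites of 2-cells: the axioms of a bicategory, the axioms of
a pseudofunctor on `A`, and the triangle identity for the unit and counit of `inv w`. -/
inductive Rel : ∀ {a b : A} {f g : Zigzag W a b}, Cell W f g → Cell W f g → Prop
  | comp_right {a b : A} {f g h : Zigzag W a b} (η : Cell W f g) (θ θ' : Cell W g h) :
      Rel θ θ' → Rel (η ≫' θ) (η ≫' θ')
  | comp_left {a b : A} {f g h : Zigzag W a b} (η η' : Cell W f g) (θ : Cell W g h) :
      Rel η η' → Rel (η ≫' θ) (η' ≫' θ)
  | id_comp {a b : A} {f g : Zigzag W a b} (η : Cell W f g) : Rel (.id f ≫' η) η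
  | comp_id {a b : A} {f g : Zigzag W a b} (η : Cell W f g) : Rel (η ≫' .id g) η
  | assoc {a b : A} {f g h i : Zigzag W a b} (η : Cell W f g) (θ : Cell W g h) (ι : Cell W h i) :
      Rel ((η ≫' θ) ≫' ι) (η ≫' θ ≫' ι)
  | hom_inv {a b : A} {f g : Zigzag W a b} (c : Gen W f g) : Rel (.hom c ≫' .inv c) (.id f)
  | inv_hom {a b : A} {f g : Zigzag W a b} (c : Gen W f g) : Rel (.inv c ≫' .hom c) (.id g)
  | whiskerLeft {a b c : A} (f : Zigzag W a b) (g h : Zigzag W b c) (η η' : Cell W g h) :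
      Rel η η' → Rel (f ◁' η) (f ◁' η')
  | whiskerLeft_id {a b c : A} (f : Zigzag W a b) (g : Zigzag W b c) :
      Rel (f ◁' .id g) (.id (f.comp g))
  | whiskerLeft_comp {a b c : A} (f : Zigzag W a b) {g h i : Zigzag W b c} (η : Cell W g h)
      (θ : Cell W h i) : Rel (f ◁' (η ≫' θ)) ((f ◁' η) ≫' (f ◁' θ))
  | id_whiskerLeft {a b : A} {f g : Zigzag W a b} (η : Cell W f g) :
      Rel (id a ◁' η) (.hom (leftUnitor f) ≫' η ≫' .inv (leftUnitor g))
  | comp_whiskerLeft {a b c d : A} (f : Zigzag W a b) (g : Zigzag W b c) {h h' : Zigzag W c d}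
      (η : Cell W h h') : Rel (f.comp g ◁' η)
        (.hom (associator f g h) ≫' (f ◁' g ◁' η) ≫' .inv (associator f g h'))
  | whiskerRight {a b c : A} (f g : Zigzag W a b) (h : Zigzag W b c) (η η' : Cell W f g) :
      Rel η η' → Rel (η ▷' h) (η' ▷' h)
  | id_whiskerRight {a b c : A} (f : Zigzag W a b) (g : Zigzag W b c) :
      Rel (.id f ▷' g) (.id (f.comp g))
  | comp_whiskerRight {a b c : A} {f g h : Zigzag W a b} (i : Zigzag W b c) (η : Cell W f g)
      (θ : Cell W g h) : Rel ((η ≫' θ) ▷' i) ((η ▷' i) ≫' (θ ▷' i))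
  | whiskerRight_id {a b : A} {f g : Zigzag W a b} (η : Cell W f g) :
      Rel (η ▷' id b) (.hom (rightUnitor f) ≫' η ≫' .inv (rightUnitor g))
  | whiskerRight_comp {a b c d : A} {f f' : Zigzag W a b} (g : Zigzag W b c) (h : Zigzag W c d)
      (η : Cell W f f') : Rel (η ▷' g.comp h)
        (.inv (associator f g h) ≫' ((η ▷' g) ▷' h) ≫' .hom (associator f' g h))
  | whisker_assoc {a b c d : A} (f : Zigzag W a b) {g g' : Zigzag W b c} (η : Cell W g g')
      (h : Zigzag W c d) : Rel ((f ◁' η) ▷' h)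
        (.hom (associator f g h) ≫' (f ◁' (η ▷' h)) ≫' .inv (associator f g' h))
  | whisker_exchange {a b c : A} {f g : Zigzag W a b} {h i : Zigzag W b c} (η : Cell W f g)
      (θ : Cell W h i) : Rel ((f ◁' θ) ≫' (η ▷' i)) ((η ▷' h) ≫' (g ◁' θ))
  | pentagon {a b c d e : A} (f : Zigzag W a b) (g : Zigzag W b c) (h : Zigzag W c d)
      (i : Zigzag W d e) : Rel
        ((.hom (associator f g h) ▷' i) ≫' .hom (associator f (g.comp h) i) ≫'
          (f ◁' .hom (associator g h i)))
        (.hom (associator (f.comp g) h i) ≫' .hom (associator f g (h.comp i)))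
  | triangle {a b c : A} (f : Zigzag W a b) (g : Zigzag W b c) :
      Rel (.hom (associator f (id b) g) ≫' (f ◁' .hom (leftUnitor g)))
        (.hom (rightUnitor f) ▷' g)
  | of_id {a b : A} (f : a ⟶ b) : Rel (.of (𝟙 f)) (.id (of f))
  | of_comp {a b : A} {f g h : a ⟶ b} (η : f ⟶ g) (θ : g ⟶ h) :
      Rel (.of (η ≫ θ)) (.of η ≫' .of θ)
  | of_whiskerLeft {a b c : A} (f : a ⟶ b) {g h : b ⟶ c} (η : g ⟶ h) :
      Rel (.of (f ◁ η)) (.hom (mapComp f g) ≫' (of f ◁' .of η) ≫' .inv (mapComp f h))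
  | of_whiskerRight {a b c : A} {f g : a ⟶ b} (η : f ⟶ g) (h : b ⟶ c) :
      Rel (.of (η ▷ h)) (.hom (mapComp f h) ≫' (.of η ▷' of h) ≫' .inv (mapComp g h))
  | of_associator {a b c d : A} (f : a ⟶ b) (g : b ⟶ c) (h : c ⟶ d) :
      Rel (.of (α_ f g h).hom) (.hom (mapComp (f ≫ g) h) ≫' (.hom (mapComp f g) ▷' of h) ≫'
        .hom (associator (of f) (of g) (of h)) ≫' (of f ◁' .inv (mapComp g h)) ≫'
          .inv (mapComp f (g ≫ h)))
  | of_leftUnitor {a b : A} (f : a ⟶ b) :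
      Rel (.of (λ_ f).hom) (.hom (mapComp (𝟙 a) f) ≫' (.hom (mapId a) ▷' of f) ≫'
        .hom (leftUnitor (of f)))
  | of_rightUnitor {a b : A} (f : a ⟶ b) :
      Rel (.of (ρ_ f).hom) (.hom (mapComp f (𝟙 b)) ≫' (of f ◁' .hom (mapId b)) ≫'
        .hom (rightUnitor (of f)))
  | zigzag {a b : A} (w : a ⟶ b) (hw : W w) :
      Rel ((.hom (unit w hw) ▷' of w) ≫' .hom (associator (of w) (inv w hw) (of w)) ≫'
        (of w ◁' .hom (counit w hw))) (.hom (leftUnitor (of w)) ≫' .inv (rightUnitor (of w)))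

end

end Zigzag

/-- The formal localization of `A` at `W`: its objects are those of `A`, its 1-cells are the
formal composites of 1-cells of `A` and of inverses of 1-cells in `W`, and its 2-cells are the
formal composites of 2-cells modulo the relations `Zigzag.Rel`. -/
structure FormalLoc {A : Type u₁} [Bicategory.{w₁, v₁} A] (W : ∀ ⦃a b : A⦄, (a ⟶ b) → Prop) where
  as : A

namespace FormalLoc

variable {W}

instance : CategoryStruct (FormalLoc W) where
  Hom a b := Zigzag W a.as b.as
  id a := .id a.as
  comp f g := .comp f g

instance (a b : FormalLoc W) : Category.{max u₁ v₁ w₁} (a ⟶ b) where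
  Hom f g := Quot (Zigzag.Rel W (f := f) (g := g))
  id f := Quot.mk _ (.id f)
  comp := Quot.map₂ .comp .comp_right .comp_left
  id_comp := by rintro f g ⟨η⟩; exact Quot.sound (.id_comp η)
  comp_id := by rintro f g ⟨η⟩; exact Quot.sound (.comp_id η)
  assoc := by rintro f g h i ⟨η⟩ ⟨θ⟩ ⟨ι⟩; exact Quot.sound (.assoc η θ ι)

/-- The class of a formal composite of 2-cells. -/
def cell {a b : FormalLoc W} {f g : a ⟶ b} (η : Zigzag.Cell W f g) : f ⟶ g := Quot.mk _ η

/-- A generating invertible 2-cell, as an isomorphism. -/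
def genIso {a b : FormalLoc W} {f g : a ⟶ b} (c : Zigzag.Gen W f g) : f ≅ g where
  hom := cell (.hom c)
  inv := cell (.inv c)
  hom_inv_id := Quot.sound (.hom_inv c)
  inv_hom_id := Quot.sound (.inv_hom c)

instance : Bicategory.{max u₁ v₁ w₁, max u₁ v₁} (FormalLoc W) where
  homCategory _ _ := inferInstance
  whiskerLeft f g h η := Quot.map (.whiskerLeft f) (.whiskerLeft f g h) η
  whiskerRight {_ _ _ f g} η h := Quot.map (.whiskerRight h) (.whiskerRight f g h) η
  associator f g h := genIso (.associator f g h)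
  leftUnitor f := genIso (.leftUnitor f)
  rightUnitor f := genIso (.rightUnitor f)
  whiskerLeft_id f g := Quot.sound (.whiskerLeft_id f g)
  whiskerLeft_comp := by rintro a b c f g h i ⟨η⟩ ⟨θ⟩; exact Quot.sound (.whiskerLeft_comp f η θ)
  id_whiskerLeft := by rintro a b f g ⟨η⟩; exact Quot.sound (.id_whiskerLeft η)
  comp_whiskerLeft := by
    rintro a b c d f g h h' ⟨η⟩; exact Quot.sound (.comp_whiskerLeft f g η)
  id_whiskerRight f g := Quot.sound (.id_whiskerRight f g)
  comp_whiskerRight := by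
    rintro a b c f g h ⟨η⟩ ⟨θ⟩ i; exact Quot.sound (.comp_whiskerRight i η θ)
  whiskerRight_id := by rintro a b f g ⟨η⟩; exact Quot.sound (.whiskerRight_id η)
  whiskerRight_comp := by
    rintro a b c d f f' ⟨η⟩ g h; exact Quot.sound (.whiskerRight_comp g h η)
  whisker_assoc := by
    rintro a b c d f g g' ⟨η⟩ h; exact Quot.sound (.whisker_assoc f η h)
  whisker_exchange := by
    rintro a b c f g h i ⟨η⟩ ⟨θ⟩; exact Quot.sound (.whisker_exchange η θ)
  pentagon f g h i := Quot.sound (.pentagon f g h i)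
  triangle f g := Quot.sound (.triangle f g)

/-- A 1-cell of `A` as a 1-cell of the formal localization. -/
abbrev ofHom {a b : A} (f : a ⟶ b) : (⟨a⟩ : FormalLoc W) ⟶ ⟨b⟩ := Zigzag.of f

/-- The formal inverse of a 1-cell in `W`. -/
abbrev invHom {a b : A} (w : a ⟶ b) (hw : W w) : (⟨b⟩ : FormalLoc W) ⟶ ⟨a⟩ := Zigzag.inv w hw

variable (W) in
/-- The pseudofunctor from `A` to its formal localization. -/
def incl : A ⥤ᵖ FormalLoc W where
  obj a := ⟨a⟩
  map f := ofHom f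
  map₂ θ := cell (.of θ)
  map₂_id f := Quot.sound (.of_id f)
  map₂_comp η θ := Quot.sound (.of_comp η θ)
  mapId a := genIso (.mapId a)
  mapComp f g := genIso (.mapComp f g)
  map₂_whisker_left f _ _ η := Quot.sound (.of_whiskerLeft f η)
  map₂_whisker_right η h := Quot.sound (.of_whiskerRight η h)
  map₂_associator f g h := Quot.sound (.of_associator f g h)
  map₂_left_unitor f := Quot.sound (.of_leftUnitor f)
  map₂_right_unitor f := Quot.sound (.of_rightUnitor f)

/-- The unit of the formal inverse. -/
def unitIso {a b : A} (w : a ⟶ b) (hw : W w) :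
    𝟙 (⟨a⟩ : FormalLoc W) ≅ ofHom w ≫ invHom w hw := genIso (.unit w hw)

/-- The counit of the formal inverse. -/
def counitIso {a b : A} (w : a ⟶ b) (hw : W w) :
    invHom w hw ≫ ofHom w ≅ 𝟙 (⟨b⟩ : FormalLoc W) := genIso (.counit w hw)

lemma unitIso_counitIso {a b : A} (w : a ⟶ b) (hw : W w) :
    (unitIso w hw).hom ▷ ofHom w ≫ (α_ (ofHom w) (invHom w hw) (ofHom w)).hom ≫
      ofHom w ◁ (counitIso w hw).hom = (λ_ (ofHom w)).hom ≫ (ρ_ (ofHom w)).inv :=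
  Quot.sound (.zigzag w hw)

lemma inverts_incl : Inverts W (incl W) := fun _ _ w hw =>
  ⟨invHom w hw, ⟨(unitIso w hw).symm⟩, ⟨counitIso w hw⟩⟩

end FormalLoc

/-! ### Extending pseudofunctors to the formal localization -/

variable {D : Type u₂} [Bicategory.{w₂, v₂} D]

/-- An inverse of a 1-cell up to invertible 2-cells which satisfy a triangle identity. -/
structure AdjointInverse {a b : D} (f : a ⟶ b) where
  inv : b ⟶ a
  unit : 𝟙 a ≅ f ≫ inv
  counit : inv ≫ f ≅ 𝟙 b
  triangle : unit.hom ▷ f ≫ (α_ f inv f).hom ≫ f ◁ counit.hom = (λ_ f).hom ≫ (ρ_ f).inv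

lemma IsEquivalence.nonempty_adjointInverse {a b : D} {f : a ⟶ b} (h : IsEquivalence f) :
    Nonempty (AdjointInverse f) := by
  obtain ⟨g, ⟨i⟩, ⟨j⟩⟩ := h
  refine ⟨⟨g, i.symm, adjointifyCounit i.symm j, ?_⟩⟩
  have := congrArg Iso.hom (adjointifyCounit_left_triangle i.symm j)
  simpa [leftZigzagIso, bicategoricalIsoComp] using this

namespace FormalLoc

variable {W}
variable (F : A ⥤ᵖ D) (E : ∀ ⦃a b : A⦄ (w : a ⟶ b), W w → AdjointInverse (F.map w))

/-- The extension of a pseudofunctor to formal composites of 1-cells. -/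
def liftHom : ∀ {a b : A}, Zigzag W a b → (F.obj a ⟶ F.obj b)
  | _, _, .of f => F.map f
  | _, _, .inv w hw => (E w hw).inv
  | _, _, .id a => 𝟙 (F.obj a)
  | _, _, .comp f g => liftHom f ≫ liftHom g

/-- The extension of a pseudofunctor to the generating invertible 2-cells. -/
def liftGen : ∀ {a b : A} {f g : Zigzag W a b}, Zigzag.Gen W f g → (liftHom F E f ≅ liftHom F E g)
  | _, _, _, _, .associator _ _ _ => α_ _ _ _
  | _, _, _, _, .leftUnitor _ => λ_ _
  | _, _, _, _, .rightUnitor _ => ρ_ _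
  | _, _, _, _, .mapId a => F.mapId a
  | _, _, _, _, .mapComp f g => F.mapComp f g
  | _, _, _, _, .unit w hw => (E w hw).unit
  | _, _, _, _, .counit w hw => (E w hw).counit

/-- The extension of a pseudofunctor to formal composites of 2-cells. -/
def liftCell : ∀ {a b : A} {f g : Zigzag W a b}, Zigzag.Cell W f g →
    (liftHom F E f ⟶ liftHom F E g)
  | _, _, _, _, .of θ => F.map₂ θ
  | _, _, _, _, .hom c => (liftGen F E c).hom
  | _, _, _, _, .inv c => (liftGen F E c).inv
  | _, _, _, _, .id _ => 𝟙 _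
  | _, _, _, _, .comp η θ => liftCell η ≫ liftCell θ
  | _, _, _, _, .whiskerLeft f η => liftHom F E f ◁ liftCell η
  | _, _, _, _, .whiskerRight h η => liftCell η ▷ liftHom F E h

lemma liftCell_congr {a b : A} {f g : Zigzag W a b} {η θ : Zigzag.Cell W f g}
    (h : Zigzag.Rel W η θ) : liftCell F E η = liftCell F E θ := by
  induction h with
  | whisker_exchange η θ => exact whisker_exchange _ _
  | zigzag w hw => exact (E w hw).triangle
  | of_whiskerLeft f η => exact F.map₂_whisker_left f η
  | of_whiskerRight f η => exact F.map₂_whisker_right f η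
  | of_associator f g h => exact F.map₂_associator f g h
  | of_leftUnitor f => exact F.map₂_left_unitor f
  | of_rightUnitor f => exact F.map₂_right_unitor f
  | _ => simp_all [liftCell, liftHom, liftGen]

/-- The extension to the formal localization of a pseudofunctor with chosen inverses of the images
of the 1-cells in `W`. -/
def lift : FormalLoc W ⥤ᵖ D where
  obj a := F.obj a.as
  map f := liftHom F E f
  map₂ := Quot.lift (liftCell F E) fun _ _ h => liftCell_congr F E h
  map₂_id _ := rfl
  map₂_comp := by rintro _ _ _ _ _ ⟨η⟩ ⟨θ⟩; rfl
  mapId _ := Iso.refl _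
  mapComp _ _ := Iso.refl _
  map₂_whisker_left := by
    rintro _ _ _ f _ _ ⟨η⟩; exact ((Category.id_comp _).trans (Category.comp_id _)).symm
  map₂_whisker_right := by
    rintro _ _ _ f _ ⟨η⟩ _; exact ((Category.id_comp _).trans (Category.comp_id _)).symm
  map₂_associator f g h := by
    change (α_ (liftHom F E f) (liftHom F E g) (liftHom F E h)).hom = _
    simp [CategoryStruct.comp, liftHom]
  map₂_left_unitor f := by
    change (λ_ (liftHom F E f)).hom = _
    simp [CategoryStruct.comp, CategoryStruct.id, liftHom]
  map₂_right_unitor f := by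
    change (ρ_ (liftHom F E f)).hom = _
    simp [CategoryStruct.comp, CategoryStruct.id, liftHom]

lemma _root_.CategoryTheory.Pseudofunctor.eq_of_heq {F G : A ⥤ᵖ D}
    (h : F.toPrelaxFunctor = G.toPrelaxFunctor) (h₁ : F.mapId ≍ G.mapId)
    (h₂ : @F.mapComp ≍ @G.mapComp) : F = G := by
  cases F
  cases G
  cases h
  cases h₁
  cases h₂
  rfl

lemma incl_comp_lift : (incl W).comp (lift F E) = F := by
  have h₁ : ((incl W).comp (lift F E)).mapId = F.mapId := by
    funext a; ext; exact Category.comp_id _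
  have h₂ : @Pseudofunctor.mapComp _ _ _ _ ((incl W).comp (lift F E)) = @F.mapComp := by
    funext a b c f g; ext; exact Category.comp_id _
  exact Pseudofunctor.eq_of_heq rfl (heq_of_eq h₁) (heq_of_eq h₂)

lemma exists_factor (F : A ⥤ᵖ D) (hF : Inverts W F) :
    ∃ (G : FormalLoc W ⥤ᵖ D) (η : (incl W).comp G ⟶ F), IsEquivalence η := by
  let E : ∀ ⦃a b : A⦄ (w : a ⟶ b), W w → AdjointInverse (F.map w) := fun _ _ w hw =>
    (hF w hw).nonempty_adjointInverse.some
  refine ⟨lift F E, ?_⟩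
  rw [incl_comp_lift F E]
  exact ⟨𝟙 F, 𝟙 F, ⟨λ_ _⟩, ⟨λ_ _⟩⟩

end FormalLoc
end FormalLocalization
end IntGpd

namespace IntGpd
open Bicategory
open scoped Pseudofunctor.StrongTrans

/-! ### Whiskering with equivalences -/

section Whiskering

variable {B : Type u₁} [Bicategory.{w₁, v₁} B]

lemma whiskerLeft_injective_of_leftInverse {a b c : B} {f : a ⟶ b} {g : b ⟶ a}
    (e : g ≫ f ≅ 𝟙 b) {p q : b ⟶ c} {r r' : p ⟶ q} (h : f ◁ r = f ◁ r') : r = r' := by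
  have key : ∀ r : p ⟶ q, r = (λ_ p).inv ≫ e.inv ▷ p ≫ (α_ g f p).hom ≫ g ◁ f ◁ r ≫
      (α_ g f q).inv ≫ e.hom ▷ q ≫ (λ_ q).hom := by
    intro r
    have h : (α_ g f p).hom ≫ g ◁ f ◁ r ≫ (α_ g f q).inv = (g ≫ f) ◁ r := by simp
    rw [reassoc_of% h, whisker_exchange_assoc, ← comp_whiskerRight_assoc, e.inv_hom_id]
    simp
  rw [key r, key r', h]

lemma IsEquivalence.whiskerLeft_injective {a b c : B} {f : a ⟶ b} (hf : IsEquivalence f)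
    {p q : b ⟶ c} {r r' : p ⟶ q} (h : f ◁ r = f ◁ r') : r = r' := by
  obtain ⟨g, -, ⟨e⟩⟩ := hf
  exact whiskerLeft_injective_of_leftInverse e h

lemma IsEquivalence.exists_whiskerLeft_eq {a b c : B} {f : a ⟶ b} (hf : IsEquivalence f)
    {p q : b ⟶ c} (x : f ≫ p ⟶ f ≫ q) : ∃ r : p ⟶ q, f ◁ r = x := by
  obtain ⟨g, ⟨d⟩, ⟨e⟩⟩ := hf
  refine ⟨(λ_ p).inv ≫ e.inv ▷ p ≫ (α_ g f p).hom ≫ g ◁ x ≫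
      (α_ g f q).inv ≫ e.hom ▷ q ≫ (λ_ q).hom, whiskerLeft_injective_of_leftInverse d ?_⟩
  rw [← cancel_epi (α_ g f p).hom, ← cancel_mono (α_ g f q).inv, Category.assoc, Category.assoc,
    ← comp_whiskerLeft, ← cancel_epi (e.inv ▷ p), ← cancel_mono (e.hom ▷ q)]
  simp only [Category.assoc]
  rw [← whisker_exchange_assoc, ← comp_whiskerRight, e.inv_hom_id]
  simp

lemma IsEquivalence.exists_whiskerLeftIso_eq {a b c : B} {f : a ⟶ b} (hf : IsEquivalence f)
    {p q : b ⟶ c} (x : f ≫ p ≅ f ≫ q) : ∃ r : p ≅ q, f ◁ r.hom = x.hom := by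
  obtain ⟨r, hr⟩ := hf.exists_whiskerLeft_eq x.hom
  obtain ⟨s, hs⟩ := hf.exists_whiskerLeft_eq x.inv
  exact ⟨⟨r, s, hf.whiskerLeft_injective (by simp [hr, hs]),
    hf.whiskerLeft_injective (by simp [hr, hs])⟩, hr⟩

lemma IsEquivalence.map {D : Type u₂} [Bicategory.{w₂, v₂} D] (G : B ⥤ᵖ D) {a b : B} {f : a ⟶ b}
    (hf : IsEquivalence f) : IsEquivalence (G.map f) := by
  obtain ⟨g, ⟨d⟩, ⟨e⟩⟩ := hf
  exact ⟨G.map g, ⟨(G.mapComp f g).symm ≪≫ G.map₂Iso d ≪≫ G.mapId a⟩,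
    ⟨(G.mapComp g f).symm ≪≫ G.map₂Iso e ≪≫ G.mapId b⟩⟩

end Whiskering

/-! ### Naturality squares of pseudonatural transformations -/

section Squares

variable {B : Type u₁} [Bicategory.{w₁, v₁} B] {D : Type u₂} [Bicategory.{w₂, v₂} D]
variable {G G' : B ⥤ᵖ D}

/-- A candidate for the component at the 1-cell `f` of a pseudonatural transformation `G ⟶ G'` with
1-cells `x : G.obj a ⟶ G'.obj a` and `y : G.obj b ⟶ G'.obj b` at the ends of `f`. -/
abbrev NatSquare {a b : B} (f : a ⟶ b) (x : G.obj a ⟶ G'.obj a) (y : G.obj b ⟶ G'.obj b) :=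
  G.map f ≫ y ≅ x ≫ G'.map f

namespace NatSquare

variable {a b c d : B} {x : G.obj a ⟶ G'.obj a} {y : G.obj b ⟶ G'.obj b} {z : G.obj c ⟶ G'.obj c}
  {t : G.obj d ⟶ G'.obj d}

/-- The square at an identity. -/
def id (x : G.obj a ⟶ G'.obj a) : NatSquare (𝟙 a) x x :=
  whiskerRightIso (G.mapId a) x ≪≫ λ_ x ≪≫ (ρ_ x).symm ≪≫ whiskerLeftIso x (G'.mapId a).symm

/-- The square at a composite. -/
def comp {f : a ⟶ b} {g : b ⟶ c} (s : NatSquare f x y) (s' : NatSquare g y z) :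
    NatSquare (f ≫ g) x z :=
  whiskerRightIso (G.mapComp f g) z ≪≫ α_ _ _ _ ≪≫ whiskerLeftIso (G.map f) s' ≪≫
    (α_ _ _ _).symm ≪≫ whiskerRightIso s (G'.map g) ≪≫ α_ _ _ _ ≪≫
      whiskerLeftIso x (G'.mapComp f g).symm

lemma id_hom_comp (x : G.obj a ⟶ G'.obj a) :
    (id x).hom ≫ x ◁ (G'.mapId a).hom = (G.mapId a).hom ▷ x ≫ (λ_ x).hom ≫ (ρ_ x).inv := by
  simp [id]

lemma comp_hom_comp {f : a ⟶ b} {g : b ⟶ c} (s : NatSquare f x y) (s' : NatSquare g y z) :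
    (s.comp s').hom ≫ x ◁ (G'.mapComp f g).hom = (G.mapComp f g).hom ▷ z ≫ (α_ _ _ _).hom ≫
      G.map f ◁ s'.hom ≫ (α_ _ _ _).inv ≫ s.hom ▷ G'.map g ≫ (α_ _ _ _).hom := by
  simp [comp]

/-- Compatibility of two squares with a 2-cell. -/
def Natural {f g : a ⟶ b} (s : NatSquare f x y) (s' : NatSquare g x y) (θ : f ⟶ g) : Prop :=
  G.map₂ θ ▷ y ≫ s'.hom = s.hom ≫ x ◁ G'.map₂ θ

lemma natural_id_of {f : a ⟶ a} {s : NatSquare f x x} (e : f ≅ 𝟙 a)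
    (h : s.hom ≫ x ◁ (G'.map₂ e.hom ≫ (G'.mapId a).hom) =
      (G.map₂ e.hom ≫ (G.mapId a).hom) ▷ x ≫ (λ_ x).hom ≫ (ρ_ x).inv) :
    Natural s (id x) e.hom := by
  unfold Natural
  rw [← cancel_mono (x ◁ (G'.mapId a).hom), Category.assoc, Category.assoc, id_hom_comp,
    ← Bicategory.whiskerLeft_comp, h, comp_whiskerRight_assoc]

lemma natural_comp_of {f : a ⟶ b} {g : b ⟶ c} {h : a ⟶ c} {s : NatSquare f x y}
    {s' : NatSquare g y z} {s'' : NatSquare h x z} (e : h ≅ f ≫ g)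
    (h : s''.hom ≫ x ◁ (G'.map₂ e.hom ≫ (G'.mapComp f g).hom) =
      (G.map₂ e.hom ≫ (G.mapComp f g).hom) ▷ z ≫ (α_ _ _ _).hom ≫
      G.map f ◁ s'.hom ≫ (α_ _ _ _).inv ≫ s.hom ▷ G'.map g ≫ (α_ _ _ _).hom) :
    Natural s'' (s.comp s') e.hom := by
  unfold Natural
  rw [← cancel_mono (x ◁ (G'.mapComp f g).hom), Category.assoc, Category.assoc, comp_hom_comp,
    ← Bicategory.whiskerLeft_comp, h, comp_whiskerRight_assoc]

namespace Natural

lemma refl {f : a ⟶ b} (s : NatSquare f x y) : Natural s s (𝟙 f) := by simp [Natural]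

lemma trans {f g h : a ⟶ b} {s : NatSquare f x y} {s' : NatSquare g x y} {s'' : NatSquare h x y}
    {θ : f ⟶ g} {ι : g ⟶ h} (p : Natural s s' θ) (q : Natural s' s'' ι) :
    Natural s s'' (θ ≫ ι) := by
  unfold Natural at *
  rw [PrelaxFunctor.map₂_comp, PrelaxFunctor.map₂_comp, comp_whiskerRight, Category.assoc, q,
    reassoc_of% p, ← Bicategory.whiskerLeft_comp]

lemma inv {f g : a ⟶ b} {s : NatSquare f x y} {s' : NatSquare g x y} {θ : f ≅ g}
    (p : Natural s s' θ.hom) : Natural s' s θ.inv := by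
  unfold Natural at *
  rw [← cancel_epi (G.map₂ θ.hom ▷ y), reassoc_of% p, ← comp_whiskerRight_assoc,
    ← Bicategory.whiskerLeft_comp, ← PrelaxFunctor.map₂_comp, ← PrelaxFunctor.map₂_comp]
  simp

lemma whiskerLeft {f : a ⟶ b} (s : NatSquare f x y) {g g' : b ⟶ c} {s' : NatSquare g y z}
    {s'' : NatSquare g' y z} {θ : g ⟶ g'} (p : Natural s' s'' θ) :
    Natural (s.comp s') (s.comp s'') (f ◁ θ) := by
  unfold Natural at *
  simp [comp]
  rw [← Bicategory.whiskerLeft_comp_assoc, p, Bicategory.whiskerLeft_comp_assoc,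
    associator_inv_naturality_right_assoc, whisker_exchange_assoc,
    associator_naturality_right_assoc]

lemma whiskerRight {f f' : a ⟶ b} {s : NatSquare f x y} {s' : NatSquare f' x y} {θ : f ⟶ f'}
    (p : Natural s s' θ) {g : b ⟶ c} (s'' : NatSquare g y z) :
    Natural (s.comp s'') (s'.comp s'') (θ ▷ g) := by
  unfold Natural at *
  simp [comp]
  rw [associator_naturality_left_assoc, ← whisker_exchange_assoc,
    associator_inv_naturality_left_assoc, ← comp_whiskerRight_assoc, p, comp_whiskerRight_assoc,
    associator_naturality_middle_assoc]

lemma associator {f : a ⟶ b} {g : b ⟶ c} {h : c ⟶ d} (s : NatSquare f x y) (s' : NatSquare g y z)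
    (s'' : NatSquare h z t) :
    Natural ((s.comp s').comp s'') (s.comp (s'.comp s'')) (α_ f g h).hom := by
  unfold Natural at *
  simp [comp]
  rw [associator_inv_naturality_right_assoc, whisker_exchange_assoc,
    associator_naturality_right_assoc, ← associator_inv_naturality_left_assoc,
    whisker_exchange_assoc, ← associator_naturality_left_assoc]
  bicategory

lemma leftUnitor {f : a ⟶ b} (s : NatSquare f x y) :
    Natural ((id x).comp s) s (λ_ f).hom := by
  unfold Natural at *
  simp [comp, id]
  rw [← associator_inv_naturality_left_assoc, whisker_exchange_assoc,
    ← associator_naturality_left_assoc]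
  simp

lemma rightUnitor {f : a ⟶ b} (s : NatSquare f x y) :
    Natural (s.comp (id y)) s (ρ_ f).hom := by
  unfold Natural at *
  simp [comp, id]
  rw [associator_inv_naturality_right_assoc, whisker_exchange_assoc,
    associator_naturality_right_assoc, ← Bicategory.whiskerLeft_comp_assoc,
    ← Bicategory.whiskerLeft_comp_assoc]
  simp

/-- If `s` is a square at an equivalence `f`, then compatibility with a 2-cell can be tested after
composition with `s`. -/
lemma of_whiskerLeft {f : a ⟶ b} (hf : IsEquivalence f) (s : NatSquare f x y) {g g' : b ⟶ c}
    {s' : NatSquare g y z} {s'' : NatSquare g' y z} {θ : g ⟶ g'}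
    (p : Natural (s.comp s') (s.comp s'') (f ◁ θ)) : Natural s' s'' θ := by
  unfold Natural at *
  refine (hf.map G).whiskerLeft_injective ?_
  simp [comp] at p
  rw [← associator_naturality_right_assoc, ← whisker_exchange_assoc,
    ← associator_inv_naturality_right_assoc] at p
  simp only [← Category.assoc, cancel_mono] at p
  simp only [Category.assoc, cancel_epi] at p
  simpa using p

end Natural

/-- Transport of a square along an invertible 2-cell. -/
def transport {f g : a ⟶ b} (s : NatSquare f x y) (θ : f ≅ g) : NatSquare g x y :=
  whiskerRightIso (G.map₂Iso θ.symm) y ≪≫ s ≪≫ whiskerLeftIso x (G'.map₂Iso θ)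

lemma natural_transport {f g : a ⟶ b} (s : NatSquare f x y) (θ : f ≅ g) :
    Natural s (s.transport θ) θ.hom := by
  simp only [Natural, transport, Iso.trans_hom, whiskerRightIso_hom, whiskerLeftIso_hom]
  rw [← comp_whiskerRight_assoc]
  simp [← PrelaxFunctor.map₂_comp]

/-- A square at an equivalence extends every square at a composite. -/
lemma exists_comp_eq {f : a ⟶ b} (hf : IsEquivalence f) (s : NatSquare f x y) {g : b ⟶ c}
    (u : NatSquare (f ≫ g) x z) : ∃ s' : NatSquare g y z, s.comp s' = u := by
  obtain ⟨r, hr⟩ := (hf.map G).exists_whiskerLeftIso_eq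
    ((α_ _ _ _).symm ≪≫ whiskerRightIso (G.mapComp f g).symm z ≪≫ u ≪≫
      whiskerLeftIso x (G'.mapComp f g) ≪≫ (α_ _ _ _).symm ≪≫ whiskerRightIso s.symm (G'.map g) ≪≫
      α_ _ _ _)
  refine ⟨r, Iso.ext ?_⟩
  simp [comp, hr]

lemma exists_natural_unit {f : a ⟶ b} {g : b ⟶ a} (e : 𝟙 a ≅ f ≫ g) (hf : IsEquivalence f)
    (s : NatSquare f x y) : ∃ s' : NatSquare g y x, Natural (id x) (s.comp s') e.hom := by
  obtain ⟨s', h⟩ := exists_comp_eq hf s ((id x).transport e)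
  exact ⟨s', h ▸ natural_transport _ _⟩

/-- By the triangle identity, compatibility with the unit of an inverse implies compatibility with
the counit. -/
lemma natural_counit {f : a ⟶ b} {g : b ⟶ a} (e : 𝟙 a ≅ f ≫ g) (e' : g ≫ f ≅ 𝟙 b)
    (h : e.hom ▷ f ≫ (α_ f g f).hom ≫ f ◁ e'.hom = (λ_ f).hom ≫ (ρ_ f).inv)
    {s : NatSquare f x y} {s' : NatSquare g y x} (p : Natural (id x) (s.comp s') e.hom) :
    Natural (s'.comp s) (id y) e'.hom := by
  refine Natural.of_whiskerLeft (f := f) ⟨g, ⟨e.symm⟩, ⟨e'⟩⟩ s ?_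
  have h' : f ◁ e'.hom = (α_ f g f).inv ≫ e.inv ▷ f ≫ (λ_ f).hom ≫ (ρ_ f).inv := by
    rw [← h, ← comp_whiskerRight_assoc]
    simp
  rw [h']
  exact (Natural.associator s s' s).inv.trans ((p.whiskerRight s).inv (θ := whiskerRightIso e f)
    |>.trans ((Natural.leftUnitor s).trans (Natural.rightUnitor s).inv))

end NatSquare

/-- The condition on 2-cells `m`, `n` to be compatible with two squares at the 1-cell `f`, as the
components of a modification are. -/
def ModSquare {a b : B} {f : a ⟶ b} {x x' : G.obj a ⟶ G'.obj a} {y y' : G.obj b ⟶ G'.obj b}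
    (s : NatSquare f x y) (s' : NatSquare f x' y') (m : x ⟶ x') (n : y ⟶ y') : Prop :=
  G.map f ◁ n ≫ s'.hom = s.hom ≫ m ▷ G'.map f

namespace ModSquare

variable {a b c : B} {x x' : G.obj a ⟶ G'.obj a} {y y' : G.obj b ⟶ G'.obj b}
  {z z' : G.obj c ⟶ G'.obj c} {m : x ⟶ x'} {n : y ⟶ y'} {k : z ⟶ z'}

lemma id (m : x ⟶ x') : ModSquare (NatSquare.id x) (.id x') m m := by
  simp [ModSquare, NatSquare.id, whisker_exchange, whisker_exchange_assoc]

lemma comp_iff {f : a ⟶ b} {g : b ⟶ c} {s : NatSquare f x y} {s' : NatSquare f x' y'}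
    {t : NatSquare g y z} {t' : NatSquare g y' z'} (h : ModSquare s s' m n) :
    ModSquare (s.comp t) (s'.comp t') m k ↔
      G.map f ◁ (G.map g ◁ k ≫ t'.hom) = G.map f ◁ (t.hom ≫ n ▷ G'.map g) := by
  unfold ModSquare at *
  simp only [NatSquare.comp, Iso.trans_hom, whiskerRightIso_hom, whiskerLeftIso_hom, Iso.symm_hom,
    Category.assoc]
  rw [whisker_exchange_assoc, whisker_exchange, associator_naturality_right_assoc,
    ← associator_naturality_left_assoc, ← comp_whiskerRight_assoc, ← h, comp_whiskerRight_assoc,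
    ← associator_inv_naturality_middle_assoc, ← Bicategory.whiskerLeft_comp_assoc,
    ← Bicategory.whiskerLeft_comp_assoc]
  simp only [← Category.assoc, cancel_mono]
  simp only [Category.assoc, cancel_epi]

lemma of_natural {f g : a ⟶ b} {s : NatSquare f x y} {s' : NatSquare f x' y'}
    {t : NatSquare g x y} {t' : NatSquare g x' y'} {θ : f ≅ g} (p : NatSquare.Natural s t θ.hom)
    (p' : NatSquare.Natural s' t' θ.hom) (h : ModSquare s s' m n) : ModSquare t t' m n := by
  unfold ModSquare NatSquare.Natural at *
  rw [← cancel_epi (G.map₂ θ.hom ▷ y), ← whisker_exchange_assoc, p', reassoc_of% h,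
    ← whisker_exchange, ← reassoc_of% p]

end ModSquare

section

variable {η θ : G ⟶ G'} {a b c : B}

lemma modSquare_id (m : η.app a ⟶ θ.app a) :
    ModSquare (η.naturality (𝟙 a)) (θ.naturality (𝟙 a)) m m := by
  rw [Pseudofunctor.StrongTrans.naturality_id_iso, Pseudofunctor.StrongTrans.naturality_id_iso]
  exact .id m

lemma modSquare_comp_iff {f : a ⟶ b} {g : b ⟶ c} {m : η.app a ⟶ θ.app a} {n : η.app b ⟶ θ.app b}
    {k : η.app c ⟶ θ.app c} (h : ModSquare (η.naturality f) (θ.naturality f) m n) :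
    ModSquare (η.naturality (f ≫ g)) (θ.naturality (f ≫ g)) m k ↔
      G.map f ◁ (G.map g ◁ k ≫ (θ.naturality g).hom) =
        G.map f ◁ ((η.naturality g).hom ≫ n ▷ G'.map g) := by
  rw [Pseudofunctor.StrongTrans.naturality_comp_iso, Pseudofunctor.StrongTrans.naturality_comp_iso]
  exact ModSquare.comp_iff h

/-- Compatibility of a modification with an equivalence implies compatibility with an inverse. -/
lemma modSquare_inverse {f : a ⟶ b} {g : b ⟶ a} (e : 𝟙 a ≅ f ≫ g) (hf : IsEquivalence f)
    {m : η.app a ⟶ θ.app a} {n : η.app b ⟶ θ.app b}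
    (h : ModSquare (η.naturality f) (θ.naturality f) m n) :
    ModSquare (η.naturality g) (θ.naturality g) n m :=
  (hf.map G).whiskerLeft_injective <| (modSquare_comp_iff h).1 <|
    ModSquare.of_natural (η.naturality_naturality e.hom) (θ.naturality_naturality e.hom)
      (modSquare_id m)

end

end Squares

namespace FormalLoc

variable {A : Type u₁} [Bicategory.{w₁, v₁} A] {W : ∀ ⦃a b : A⦄, (a ⟶ b) → Prop}
variable {D : Type u₂} [Bicategory.{w₂, v₂} D] {G G' : FormalLoc W ⥤ᵖ D}

section Extension

variable (η : (incl W).comp G ⟶ (incl W).comp G')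

/-- The component of the extension of `η` at a formal inverse is determined by compatibility with
the unit. -/
noncomputable def invSquare {a b : A} (w : a ⟶ b) (hw : W w) :
    NatSquare (G := G) (G' := G') (invHom w hw) (η.app b) (η.app a) :=
  (NatSquare.exists_natural_unit (G := G) (G' := G') (unitIso w hw) (inverts_incl w hw)
    (η.naturality w)).choose

lemma natural_invSquare {a b : A} (w : a ⟶ b) (hw : W w) :
    NatSquare.Natural (G := G) (G' := G') (.id (a := (⟨a⟩ : FormalLoc W)) (η.app a))
      (.comp (η.naturality w) (invSquare η w hw))
      (unitIso w hw).hom :=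
  (NatSquare.exists_natural_unit (G := G) (G' := G') (unitIso w hw) (inverts_incl w hw)
    (η.naturality w)).choose_spec

/-- The components of the extension of a pseudonatural transformation from `A` to its formal
localization. -/
noncomputable def extSquare : ∀ {a b : A} (f : Zigzag W a b),
    NatSquare (G := G) (G' := G') (a := ⟨a⟩) (b := ⟨b⟩) f (η.app a) (η.app b)
  | _, _, .of f => η.naturality f
  | _, _, .inv w hw => invSquare η w hw
  | _, _, .id _ => .id _
  | _, _, .comp f g => .comp (extSquare f) (extSquare g)

lemma natural_extSquare_gen {a b : A} {f g : Zigzag W a b} (c : Zigzag.Gen W f g) :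
    NatSquare.Natural (extSquare η f) (extSquare η g) (genIso c).hom := by
  cases c with
  | associator f g h => exact .associator _ _ _
  | leftUnitor f => exact .leftUnitor _
  | rightUnitor f => exact .rightUnitor _
  | mapId a =>
    exact NatSquare.natural_id_of (genIso (.mapId a)) (η.naturality_id a)
  | mapComp f g =>
    exact NatSquare.natural_comp_of (genIso (.mapComp f g)) (η.naturality_comp f g)
  | unit w hw => exact natural_invSquare η w hw
  | counit w hw =>
    exact NatSquare.natural_counit _ _ (unitIso_counitIso w hw) (natural_invSquare η w hw)

lemma natural_extSquare {a b : A} {f g : Zigzag W a b} (θ : Zigzag.Cell W f g) :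
    NatSquare.Natural (extSquare η f) (extSquare η g) (cell θ) := by
  induction θ with
  | of θ => exact η.naturality_naturality θ
  | hom c => exact natural_extSquare_gen η c
  | inv c => exact (natural_extSquare_gen η c).inv
  | id f => exact .refl _
  | comp _ _ p q => exact p.trans q
  | whiskerLeft f _ p => exact p.whiskerLeft _
  | whiskerRight h _ p => exact p.whiskerRight _

/-- The extension of a pseudonatural transformation from `A` to its formal localization. -/
noncomputable def ext : G ⟶ G' :=
  Pseudofunctor.StrongTrans.mk (F := G) (G := G') (fun a => η.app a.as) (fun f => extSquare η f)
    (by rintro a b f g ⟨θ⟩; exact natural_extSquare η θ)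
    (fun a => NatSquare.id_hom_comp (G := G) (G' := G') (η.app a.as))
    (fun f g => NatSquare.comp_hom_comp (extSquare η f) (extSquare η g))

end Extension

lemma modSquare {η θ : G ⟶ G'} (Γ : (precomp (incl W) G G').obj η ⟶ (precomp (incl W) G G').obj θ)
    {a b : A} (f : Zigzag W a b) :
    ModSquare (G := G) (G' := G') (a := ⟨a⟩) (b := ⟨b⟩) (η.naturality f) (θ.naturality f)
      (Γ.as.app a) (Γ.as.app b) := by
  induction f with
  | of f => exact Γ.as.naturality f
  | inv w hw => exact modSquare_inverse (unitIso w hw) (inverts_incl w hw) (Γ.as.naturality w)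
  | id a => exact modSquare_id (a := (⟨a⟩ : FormalLoc W)) (Γ.as.app a)
  | comp f g p q => exact (modSquare_comp_iff p).2 (congrArg _ q)

instance : (precomp (incl W) G G').IsEquivalence where
  faithful := ⟨fun {_ _} _ _ h =>
    Pseudofunctor.StrongTrans.homCategory.ext fun a => congrArg (fun m => m.as.app a.as) h⟩
  full := ⟨fun {_ _} Γ => ⟨⟨⟨fun a => Γ.as.app a.as, fun f => modSquare Γ f⟩⟩, rfl⟩⟩
  essSurj := ⟨fun η => ⟨ext η, ⟨Iso.refl _⟩⟩⟩

variable (W) in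
/-- The formal localization of a bicategory is a localization. -/
theorem isLocalization_incl :
    IsLocalization.{w₁, max u₁ v₁ w₁, w₃, v₁, max u₁ v₁, v₃} W (incl W) where
  inverts := inverts_incl
  factor _ _ F hF := exists_factor F hF
  isEquivalence _ _ _ _ := inferInstance

end FormalLoc
end IntGpd

namespace IntGpd

/-! ### Multiplication of generalized elements -/

namespace IntGroupoid

variable {C : Type u} [Category.{v} C] {J : Precoverage C} {G H K : IntGroupoid J} {S T : C}

open Classical in
/-- The composite `G.comp a b` of two generalized elements of the object of arrows, with the value
`a` if they are not composable; its arguments can be rewritten freely. -/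
noncomputable def star (a b : T ⟶ G.Ar) : T ⟶ G.Ar :=
  if h : a ≫ G.tgt = b ≫ G.src then G.comp a b h else a

local infixr:75 " ⋆ " => star

lemma comp_eq_star (a b : T ⟶ G.Ar) (h) : G.comp a b h = a ⋆ b := (dif_pos h).symm

section

variable {a b c : T ⟶ G.Ar}

lemma star_src (h : a ≫ G.tgt = b ≫ G.src) : (a ⋆ b) ≫ G.src = a ≫ G.src := by
  rw [← comp_eq_star _ _ h, G.comp_src]

lemma star_tgt (h : a ≫ G.tgt = b ≫ G.src) : (a ⋆ b) ≫ G.tgt = b ≫ G.tgt := by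
  rw [← comp_eq_star _ _ h, G.comp_tgt]

lemma star_assoc (h : a ≫ G.tgt = b ≫ G.src) (h' : b ≫ G.tgt = c ≫ G.src) :
    (a ⋆ b) ⋆ c = a ⋆ b ⋆ c := by
  simpa only [comp_eq_star] using G.comp_assoc a b c h (by rw [G.comp_tgt, h']) h'
    (by rw [G.comp_src, h])

lemma comp_star (s : S ⟶ T) (h : a ≫ G.tgt = b ≫ G.src) : s ≫ (a ⋆ b) = (s ≫ a) ⋆ (s ≫ b) := by
  have h' : (s ≫ a) ≫ G.tgt = (s ≫ b) ≫ G.src := by simp [h]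
  rw [← comp_eq_star _ _ h, ← comp_eq_star _ _ h', G.comp_natural]

lemma star_ar (f : G ⟶ H) (h : a ≫ G.tgt = b ≫ G.src) :
    (a ⋆ b) ≫ f.ar = (a ≫ f.ar) ⋆ (b ≫ f.ar) := by
  have h' : (a ≫ f.ar) ≫ H.tgt = (b ≫ f.ar) ≫ H.src := by
    simp only [Category.assoc, f.ar_src, f.ar_tgt, reassoc_of% h]
  rw [← comp_eq_star _ _ h, ← comp_eq_star _ _ h', f.map_comp]

lemma unit_star {x : T ⟶ G.Ob} (h : x = a ≫ G.src) : (x ≫ G.unit) ⋆ a = a := by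
  rw [← comp_eq_star _ _ (by simp [G.unit_tgt, h]), unit_comp']

lemma star_unit {x : T ⟶ G.Ob} (h : a ≫ G.tgt = x) : a ⋆ (x ≫ G.unit) = a := by
  rw [← comp_eq_star _ _ (by simp [G.unit_src, h]), comp_unit']

lemma star_inv : a ⋆ (a ≫ G.inv) = (a ≫ G.src) ≫ G.unit := by
  rw [← comp_eq_star _ _ (by simp [G.inv_src]), G.comp_inv, Category.assoc]

lemma inv_star : (a ≫ G.inv) ⋆ a = (a ≫ G.tgt) ≫ G.unit := by
  rw [← comp_eq_star _ _ (by simp [G.inv_tgt]), G.inv_comp, Category.assoc]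

lemma star_left_cancel (hb : a ≫ G.tgt = b ≫ G.src) (hc : a ≫ G.tgt = c ≫ G.src)
    (h : a ⋆ b = a ⋆ c) : b = c := by
  rw [← comp_eq_star _ _ hb, ← comp_eq_star _ _ hc] at h
  exact comp_left_cancel h

lemma star_right_cancel (ha : a ≫ G.tgt = c ≫ G.src) (hb : b ≫ G.tgt = c ≫ G.src)
    (h : a ⋆ c = b ⋆ c) : a = b := by
  rw [← comp_eq_star _ _ ha, ← comp_eq_star _ _ hb] at h
  exact comp_right_cancel h

end

/-! ### Internal natural transformations -/

/-- Internal natural transformations between strict arrows. -/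
@[ext]
structure Trans (f g : K ⟶ G) where
  app : K.Ob ⟶ G.Ar
  app_src : app ≫ G.src = f.ob
  app_tgt : app ≫ G.tgt = g.ob
  naturality : (K.src ≫ app) ⋆ g.ar = f.ar ⋆ (K.tgt ≫ app)

namespace Trans

variable {f g h k : K ⟶ G}

lemma src_app_tgt (α : Trans f g) : (K.src ≫ α.app) ≫ G.tgt = g.ar ≫ G.src := by
  rw [Category.assoc, α.app_tgt, g.ar_src]

lemma ar_tgt_app (α : Trans f g) : f.ar ≫ G.tgt = (K.tgt ≫ α.app) ≫ G.src := by
  rw [Category.assoc, α.app_src, f.ar_tgt]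

lemma ar_tgt_app_tgt (α : Trans f g) : g.ar ≫ G.tgt = (K.tgt ≫ α.app) ≫ G.tgt := by
  rw [Category.assoc, α.app_tgt, g.ar_tgt]

/-- The identity transformation. -/
def id (f : K ⟶ G) : Trans f f where
  app := f.ob ≫ G.unit
  app_src := by simp [G.unit_src]
  app_tgt := by simp [G.unit_tgt]
  naturality := by
    rw [← Category.assoc, ← Category.assoc, unit_star f.ar_src.symm, star_unit f.ar_tgt]

/-- Composition of transformations. -/
noncomputable def comp (α : Trans f g) (β : Trans g h) : Trans f h where
  app := α.app ⋆ β.app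
  app_src := by rw [star_src (α.app_tgt.trans β.app_src.symm), α.app_src]
  app_tgt := by rw [star_tgt (α.app_tgt.trans β.app_src.symm), β.app_tgt]
  naturality := by
    have e := α.app_tgt.trans β.app_src.symm
    have e' : ∀ {T : C} (s : T ⟶ K.Ob), (s ≫ α.app) ≫ G.tgt = (s ≫ β.app) ≫ G.src := by simp [e]
    rw [comp_star _ e, comp_star _ e, star_assoc (e' _) β.src_app_tgt, β.naturality,
      ← star_assoc α.src_app_tgt β.ar_tgt_app, α.naturality, star_assoc α.ar_tgt_app (e' _)]

/-- The inverse transformation. -/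
def inv (α : Trans f g) : Trans g f where
  app := α.app ≫ G.inv
  app_src := by rw [Category.assoc, G.inv_src, α.app_tgt]
  app_tgt := by rw [Category.assoc, G.inv_tgt, α.app_src]
  naturality := by
    have e : ∀ {T : C} (s : T ⟶ K.Ob), (s ≫ α.app) ≫ G.tgt = (s ≫ α.app ≫ G.inv) ≫ G.src := by
      simp [G.inv_src]
    have e' : ∀ {T : C} (s : T ⟶ K.Ob), (s ≫ α.app ≫ G.inv) ≫ G.tgt = s ≫ f.ob := by
      simp [G.inv_tgt, α.app_src]
    have e₁ : g.ar ≫ G.tgt = (K.tgt ≫ α.app ≫ G.inv) ≫ G.src := by rw [← e, Category.assoc,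
      α.app_tgt, g.ar_tgt]
    have e₂ : (K.src ≫ α.app ≫ G.inv) ≫ G.tgt = f.ar ≫ G.src := by rw [e', f.ar_src]
    refine star_left_cancel (a := K.src ≫ α.app) ?_ ?_ ?_
    · rw [star_src e₂, e]
    · rw [star_src e₁, α.src_app_tgt]
    · rw [← star_assoc (e _) e₂, ← star_assoc α.src_app_tgt e₁, α.naturality,
        star_assoc α.ar_tgt_app (e _)]
      have := star_inv (a := K.src ≫ α.app)
      have h' := star_inv (a := K.tgt ≫ α.app)
      rw [Category.assoc K.src, Category.assoc K.src, α.app_src] at this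
      rw [Category.assoc K.tgt, Category.assoc K.tgt, α.app_src] at h'
      rw [this, h', unit_star, star_unit]
      · rw [f.ar_tgt]
      · rw [f.ar_src]

/-- Postcomposition with a strict arrow. -/
def whiskerRight (α : Trans f g) (b : G ⟶ H) : Trans (f ≫ b) (g ≫ b) where
  app := α.app ≫ b.ar
  app_src := by rw [Category.assoc, b.ar_src, ← Category.assoc, α.app_src]; rfl
  app_tgt := by rw [Category.assoc, b.ar_tgt, ← Category.assoc, α.app_tgt]; rfl
  naturality := by
    have h := congrArg (· ≫ b.ar) α.naturality
    simp only [star_ar _ α.src_app_tgt, star_ar _ α.ar_tgt_app] at h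
    simpa using h

end Trans

variable [J.HasIsos]

/-! ### Right homotopies as natural transformations -/

namespace Trans

variable {f g h : K ⟶ G}

/-- A natural transformation, as a strict arrow to the path groupoid. -/
noncomputable def toPath (α : Trans f g) : K ⟶ G.pathObj :=
  have h₁ := α.ar_tgt_app
  have h₂ := α.ar_tgt_app_tgt
  have e : ∀ {T : C} (c : T ⟶ K.Ar),
      ((c ≫ G.sqLift f.ar (K.tgt ≫ α.app) g.ar h₁ h₂) ≫ G.sqLeft = c ≫ f.ar) ∧
      ((c ≫ G.sqLift f.ar (K.tgt ≫ α.app) g.ar h₁ h₂) ≫ G.sqTgt = c ≫ K.tgt ≫ α.app) ∧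
      ((c ≫ G.sqLift f.ar (K.tgt ≫ α.app) g.ar h₁ h₂) ≫ G.sqRight = c ≫ g.ar) := fun c => by
    simp only [Category.assoc, sqLift_left, sqLift_tgt, sqLift_right, and_self]
  have hs : G.sqLift f.ar (K.tgt ≫ α.app) g.ar h₁ h₂ ≫ G.sqSrc = K.src ≫ α.app := by
    refine (eq_sqSrc ?_ ?_ ?_).symm
    · rw [sqLift_right, α.src_app_tgt]
    · rw [sqLift_left, sqLift_tgt, h₁]
    · rw [comp_eq_star, comp_eq_star, sqLift_left, sqLift_tgt, sqLift_right, α.naturality]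
  StrictArrow.mk (G := K) (H := G.pathObj) α.app
    (G.sqLift f.ar (K.tgt ≫ α.app) g.ar h₁ h₂) hs (sqLift_tgt ..)
    (by
      intro T a b h h'
      refine G.sq_ext ?_ ?_ ?_
      · refine (e _).1.trans (Eq.trans ?_ (G.pathPre_comp_left _ _ h').symm)
        rw [comp_eq_star, comp_eq_star, star_ar _ h, (e a).1, (e b).1]
      · refine (e _).2.1.trans (Eq.trans ?_ (G.pathPre_comp_tgt _ _ h').symm)
        rw [← Category.assoc, K.comp_tgt, (e b).2.1, Category.assoc]
      · refine (e _).2.2.trans (Eq.trans ?_ (G.pathPre_comp_right _ _ h').symm)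
        rw [comp_eq_star, comp_eq_star, star_ar _ h, (e a).2.2, (e b).2.2])
    (by
      change _ = _ ≫ G.sqInv
      refine G.sq_ext ?_ ?_ ?_
      · rw [(e _).1, sqInv_left, sqLift_left, f.map_inv]
      · rw [(e _).2.1, Category.assoc, sqInv_tgt, hs, ← Category.assoc, K.inv_tgt]
      · rw [(e _).2.2, sqInv_right, sqLift_right, g.map_inv])

/-- A natural transformation, as a right homotopy. -/
noncomputable def toHomotopy (α : Trans f g) : (cocylinder J).Homotopy f g where
  map := α.toPath
  map_e₀ := hom_ext α.app_src (G.sqLift_left _ _ _ α.ar_tgt_app α.ar_tgt_app_tgt)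
  map_e₁ := hom_ext α.app_tgt (G.sqLift_right _ _ _ α.ar_tgt_app α.ar_tgt_app_tgt)

end Trans

section

variable {f g h : K ⟶ G}

lemma homotopy_ar_left (F : (cocylinder J).Homotopy f g) : F.map.ar ≫ G.sqLeft = f.ar :=
  congrArg StrictArrow.ar F.map_e₀

lemma homotopy_ar_right (F : (cocylinder J).Homotopy f g) : F.map.ar ≫ G.sqRight = g.ar :=
  congrArg StrictArrow.ar F.map_e₁

lemma homotopy_ext {F F' : (cocylinder J).Homotopy f g} (e : F.map.ob = F'.map.ob) : F = F' := by
  refine Cocylinder.Homotopy.ext (hom_ext e (G.sq_ext ?_ ?_ ?_))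
  · exact (homotopy_ar_left F).trans (homotopy_ar_left F').symm
  · exact F.map.ar_tgt.trans ((congrArg (K.tgt ≫ ·) e).trans F'.map.ar_tgt.symm)
  · exact (homotopy_ar_right F).trans (homotopy_ar_right F').symm

/-- The natural transformation given by a right homotopy. -/
noncomputable def homotopyTrans (F : (cocylinder J).Homotopy f g) : Trans f g where
  app := F.map.ob
  app_src := congrArg StrictArrow.ob F.map_e₀
  app_tgt := congrArg StrictArrow.ob F.map_e₁
  naturality := by
    have h := sq_comm G F.map.ar (G.sqSrc_tgt' _) (G.sqLeft_tgt' _)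
    rw [comp_eq_star, comp_eq_star] at h
    exact (congrArg₂ star F.map.ar_src (homotopy_ar_right F)).symm.trans
      (h.trans (congrArg₂ star (homotopy_ar_left F) F.map.ar_tgt))

lemma homotopyTrans_toHomotopy (F : (cocylinder J).Homotopy f g) :
    (homotopyTrans F).toHomotopy = F := homotopy_ext rfl

end

end IntGroupoid
end IntGpd

namespace IntGpd

/-! ### Homotopy classes of strong homotopies as natural transformations -/

namespace IntGroupoid

variable {C : Type u} [Category.{v} C] {J : Precoverage C} {G H K : IntGroupoid J} {S T : C}
local infixr:75 " ⋆ " => star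

namespace Trans

variable {f g h k : K ⟶ G}

lemma id_comp (α : Trans f g) : (Trans.id f).comp α = α :=
  Trans.ext (unit_star α.app_src.symm)

lemma comp_assoc (α : Trans f g) (β : Trans g h) (γ : Trans h k) :
    (α.comp β).comp γ = α.comp (β.comp γ) :=
  Trans.ext (star_assoc (α.app_tgt.trans β.app_src.symm) (β.app_tgt.trans γ.app_src.symm))

lemma comp_inv (α : Trans f g) : α.comp α.inv = Trans.id f :=
  Trans.ext (star_inv.trans (congrArg (· ≫ G.unit) α.app_src))

lemma inv_comp (α : Trans f g) : α.inv.comp α = Trans.id g :=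
  Trans.ext (inv_star.trans (congrArg (· ≫ G.unit) α.app_tgt))

end Trans

variable [J.HasIsos]

section

variable {m n : T ⟶ G.Sq} (h : m ≫ G.sqTgt = n ≫ G.sqSrc)
include h

lemma path_star_left :
    star (G := G.pathObj) m n ≫ G.sqLeft = (m ≫ G.sqLeft) ⋆ (n ≫ G.sqLeft) :=
  (congrArg (· ≫ G.sqLeft) (comp_eq_star (G := G.pathObj) m n h)).symm.trans
    ((G.pathPre_comp_left m n h).trans (comp_eq_star _ _ _))

lemma path_star_right :
    star (G := G.pathObj) m n ≫ G.sqRight = (m ≫ G.sqRight) ⋆ (n ≫ G.sqRight) :=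
  (congrArg (· ≫ G.sqRight) (comp_eq_star (G := G.pathObj) m n h)).symm.trans
    ((G.pathPre_comp_right m n h).trans (comp_eq_star _ _ _))

lemma path_star_tgt : star (G := G.pathObj) m n ≫ G.sqTgt = n ≫ G.sqTgt :=
  (congrArg (· ≫ G.sqTgt) (comp_eq_star (G := G.pathObj) m n h)).symm.trans
    (G.pathPre_comp_tgt m n h)

end

section

variable {f g h k : K ⟶ G}

open Cocylinder

/-- The composite of the natural transformations in a strong homotopy. -/
noncomputable def strongTrans {f g : K ⟶ G} : (cocylinder J).StrongHomotopy f g → Trans f g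
  | .nil f => .id f
  | .cons F p => (homotopyTrans F).comp (strongTrans p)

lemma strongTrans_comp (p : (cocylinder J).StrongHomotopy f g)
    (q : (cocylinder J).StrongHomotopy g h) :
    strongTrans (p.comp q) = (strongTrans p).comp (strongTrans q) := by
  induction p with
  | nil f => exact (Trans.id_comp _).symm
  | cons F p ih => exact (congrArg _ (ih q)).trans (Trans.comp_assoc _ _ _).symm

lemma strongTrans_single (F : (cocylinder J).Homotopy f g) :
    strongTrans (.single F) = homotopyTrans F :=
  Trans.ext (star_unit (homotopyTrans F).app_tgt)

lemma strongTrans_rel {p q : (cocylinder J).StrongHomotopy f g} (r : p.Rel q) :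
    strongTrans p = strongTrans q := by
  induction r with
  | const F hF =>
    rw [strongTrans_single]
    exact Trans.ext (congrArg StrictArrow.ob hF)
  | square Θ H₀ H₁ K₀ K₁ h₀ h₁ k₀ k₁ =>
    rw [strongTrans_comp, strongTrans_comp, strongTrans_single, strongTrans_single,
      strongTrans_single, strongTrans_single]
    have e := sq_comm G Θ.ob (G.sqSrc_tgt' _) (G.sqLeft_tgt' _)
    rw [comp_eq_star, comp_eq_star] at e
    exact Trans.ext ((congrArg₂ star (congrArg StrictArrow.ob h₀)
      (congrArg StrictArrow.ob k₁)).trans (e.trans (congrArg₂ star (congrArg StrictArrow.ob k₀)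
        (congrArg StrictArrow.ob h₁)).symm))
  | comp_left p _ ih => rw [strongTrans_comp, strongTrans_comp, ih]
  | comp_right q _ ih => rw [strongTrans_comp, strongTrans_comp, ih]

/-- The natural transformation given by a homotopy class of strong homotopies. -/
noncomputable def classTrans (η : (cocylinder J).HomotopyClass f g) : Trans f g :=
  Quot.lift strongTrans (fun _ _ => strongTrans_rel) η

/-- The homotopy class given by a natural transformation. -/
noncomputable def Trans.toClass (α : Trans f g) : (cocylinder J).HomotopyClass f g :=
  .mk (.single α.toHomotopy)

lemma classTrans_toClass (α : Trans f g) : classTrans α.toClass = α :=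
  strongTrans_single _

lemma toClass_id (f : K ⟶ G) : (Trans.id f).toClass = .mk (.nil f) := by
  refine Quot.sound (.const _ (hom_ext rfl (G.sq_ext ?_ ?_ ?_)))
  · refine (homotopy_ar_left (Trans.id f).toHomotopy).trans ?_
    exact (Category.comp_id _).symm.trans ((congrArg (f.ar ≫ ·) G.constAr_left).symm.trans
      (Category.assoc _ _ _).symm)
  · refine (Trans.id f).toHomotopy.map.ar_tgt.trans ?_
    refine (Category.assoc _ _ _).symm.trans ((congrArg (· ≫ G.unit) f.ar_tgt).symm.trans ?_)
    exact (Category.assoc _ _ _).trans ((congrArg (f.ar ≫ ·) G.constAr_tgt).symm.trans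
      (Category.assoc _ _ _).symm)
  · refine (homotopy_ar_right (Trans.id f).toHomotopy).trans ?_
    exact (Category.comp_id _).symm.trans ((congrArg (f.ar ≫ ·) G.constAr_right).symm.trans
      (Category.assoc _ _ _).symm)

/-- For composable `α` and `β`, the squares with source `α`, right side `β`, left side the composite
of `α` and `β`, and an identity as target. -/
noncomputable def Trans.compSquare (α : Trans f g) (β : Trans g h) :
    Trans (G := G.pathObj) α.toPath (Trans.id h).toPath :=
  have h₁ : (α.comp β).app ≫ G.tgt = (h.ob ≫ G.unit) ≫ G.src := by
    simp [(α.comp β).app_tgt, G.unit_src]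
  have h₂ : β.app ≫ G.tgt = (h.ob ≫ G.unit) ≫ G.tgt := by
    simp [β.app_tgt, G.unit_tgt]
  have hs : G.sqLift (α.comp β).app (h.ob ≫ G.unit) β.app h₁ h₂ ≫ G.sqSrc = α.app := by
    refine (eq_sqSrc ?_ ?_ ?_).symm
    · rw [sqLift_right, α.app_tgt, β.app_src]
    · rw [sqLift_left, sqLift_tgt, h₁]
    · rw [comp_eq_star, comp_eq_star, sqLift_left, sqLift_tgt, sqLift_right,
        star_unit (α.comp β).app_tgt]
      rfl
  { app := G.sqLift (α.comp β).app (h.ob ≫ G.unit) β.app h₁ h₂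
    app_src := hs
    app_tgt := sqLift_tgt ..
    naturality := by
      have t₀ : (K.src ≫ G.sqLift (α.comp β).app (h.ob ≫ G.unit) β.app h₁ h₂) ≫ G.sqTgt =
          (Trans.id h).toPath.ar ≫ G.sqSrc := by
        rw [Category.assoc, sqLift_tgt]
        exact (Trans.id h).toPath.ar_src.symm
      have t₁ : α.toPath.ar ≫ G.sqTgt =
          (K.tgt ≫ G.sqLift (α.comp β).app (h.ob ≫ G.unit) β.app h₁ h₂) ≫ G.sqSrc := by
        rw [Category.assoc, hs]
        exact α.toPath.ar_tgt
      have l₀ : (Trans.id h).toPath.ar ≫ G.sqLeft = h.ar := homotopy_ar_left (Trans.id h).toHomotopy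
      have r₀ : (Trans.id h).toPath.ar ≫ G.sqRight = h.ar :=
        homotopy_ar_right (Trans.id h).toHomotopy
      have l₁ : α.toPath.ar ≫ G.sqLeft = f.ar := homotopy_ar_left α.toHomotopy
      have r₁ : α.toPath.ar ≫ G.sqRight = g.ar := homotopy_ar_right α.toHomotopy
      have t₂ : (Trans.id h).toPath.ar ≫ G.sqTgt = K.tgt ≫ h.ob ≫ G.unit :=
        (Trans.id h).toPath.ar_tgt
      refine G.sq_ext ?_ ?_ ?_
      · refine (path_star_left t₀).trans (Eq.trans ?_ (path_star_left t₁).symm)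
        rw [Category.assoc, Category.assoc, sqLift_left, l₀, l₁]
        exact (α.comp β).naturality
      · refine (path_star_tgt t₀).trans (Eq.trans ?_ (path_star_tgt t₁).symm)
        rw [Category.assoc, sqLift_tgt, t₂]
      · refine (path_star_right t₀).trans (Eq.trans ?_ (path_star_right t₁).symm)
        rw [Category.assoc, Category.assoc, sqLift_right, r₀, r₁]
        exact β.naturality }

lemma Trans.compSquare_left (α : Trans f g) (β : Trans g h) :
    (α.compSquare β).app ≫ G.sqLeft = (α.comp β).app := by
  dsimp only [compSquare]
  rw [sqLift_left]

lemma Trans.compSquare_right (α : Trans f g) (β : Trans g h) :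
    (α.compSquare β).app ≫ G.sqRight = β.app := by
  dsimp only [compSquare]
  rw [sqLift_right]

lemma toClass_comp (α : Trans f g) (β : Trans g h) :
    (α.comp β).toClass = α.toClass.comp β.toClass := by
  let F := (α.compSquare β).toHomotopy
  have q : α.toClass.comp β.toClass = (α.comp β).toClass.comp (Trans.id h).toClass := by
    have e₀ := (cocylinder J).e₀.naturality G.face₀
    have e₁ := (cocylinder J).e₁.naturality G.face₀
    have e₀' := (cocylinder J).e₀.naturality G.face₁
    have e₁' := (cocylinder J).e₁.naturality G.face₁
    let K₀ : (cocylinder J).Homotopy f h := ⟨F.map ≫ (cocylinder J).path.map G.face₀, by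
      refine (Category.assoc _ _ _).trans ((congrArg (F.map ≫ ·) e₀).trans ?_)
      refine (Category.assoc _ _ _).symm.trans ((congrArg (· ≫ G.face₀) F.map_e₀).trans ?_)
      exact α.toHomotopy.map_e₀, by
      refine (Category.assoc _ _ _).trans ((congrArg (F.map ≫ ·) e₁).trans ?_)
      refine (Category.assoc _ _ _).symm.trans ((congrArg (· ≫ G.face₀) F.map_e₁).trans ?_)
      exact (Trans.id h).toHomotopy.map_e₀⟩
    let K₁ : (cocylinder J).Homotopy g h := ⟨F.map ≫ (cocylinder J).path.map G.face₁, by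
      refine (Category.assoc _ _ _).trans ((congrArg (F.map ≫ ·) e₀').trans ?_)
      refine (Category.assoc _ _ _).symm.trans ((congrArg (· ≫ G.face₁) F.map_e₀).trans ?_)
      exact α.toHomotopy.map_e₁, by
      refine (Category.assoc _ _ _).trans ((congrArg (F.map ≫ ·) e₁').trans ?_)
      refine (Category.assoc _ _ _).symm.trans ((congrArg (· ≫ G.face₁) F.map_e₁).trans ?_)
      exact (Trans.id h).toHomotopy.map_e₁⟩
    have k₀ : (α.comp β).toHomotopy = K₀ := homotopy_ext (α.compSquare_left β).symm
    have k₁ : β.toHomotopy = K₁ := homotopy_ext (α.compSquare_right β).symm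
    exact Quot.sound (.square F.map α.toHomotopy (Trans.id h).toHomotopy (α.comp β).toHomotopy
      β.toHomotopy F.map_e₀.symm F.map_e₁.symm (congrArg Homotopy.map k₀)
      (congrArg Homotopy.map k₁))
  rw [q, toClass_id]
  exact congrArg HomotopyClass.mk (StrongHomotopy.comp_nil _).symm

lemma toClass_classTrans (η : (cocylinder J).HomotopyClass f g) : (classTrans η).toClass = η := by
  obtain ⟨p⟩ := η
  change (strongTrans p).toClass = .mk p
  induction p with
  | nil f => exact toClass_id f
  | cons F p ih =>
    refine (toClass_comp _ _).trans ?_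
    rw [ih (.mk p)]
    exact congrArg (fun F => HomotopyClass.mk (StrongHomotopy.cons F p))
      (homotopyTrans_toHomotopy F)

lemma classTrans_whiskerRight (η : (cocylinder J).HomotopyClass f g) (b : G ⟶ H) :
    classTrans (η.whiskerRight b) = (classTrans η).whiskerRight b := by
  rw [← toClass_classTrans η]
  generalize classTrans η = α
  rw [classTrans_toClass]
  exact (strongTrans_single _).trans (Trans.ext rfl)

end

/-! ### The 2-cells of the bicategory of internal groupoids -/

section

open Bicategory

variable {K G H : AHG₂ J} {f g h : K ⟶ G}

/-- The 2-cells of the bicategory of internal groupoids are the natural transformations. -/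
noncomputable def cellEquiv (f g : K ⟶ G) : (f ⟶ g) ≃ Trans f.arrow g.arrow where
  toFun := classTrans
  invFun := Trans.toClass
  left_inv := toClass_classTrans
  right_inv := classTrans_toClass

/-- The component of a 2-cell. -/
noncomputable def component (η : f ⟶ g) : K.as.Ob ⟶ G.as.Ar := (cellEquiv f g η).app

lemma component_src (η : f ⟶ g) : component η ≫ G.as.src = f.arrow.ob := (cellEquiv f g η).app_src

lemma component_tgt (η : f ⟶ g) : component η ≫ G.as.tgt = g.arrow.ob := (cellEquiv f g η).app_tgt

lemma component_injective {η θ : f ⟶ g} (e : component η = component θ) : η = θ :=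
  (cellEquiv f g).injective (Trans.ext e)

lemma component_whiskerRight (η : f ⟶ g) (b : G ⟶ H) :
    component (η ▷ b) = component η ≫ b.arrow.ar :=
  congrArg Trans.app (classTrans_whiskerRight η b.arrow)

lemma component_naturality (η : f ⟶ g) :
    (K.as.src ≫ component η) ⋆ g.arrow.ar = f.arrow.ar ⋆ (K.as.tgt ≫ component η) :=
  (cellEquiv f g η).naturality

/-- A natural transformation, as an invertible 2-cell. -/
noncomputable def Trans.cellIso (α : Trans f.arrow g.arrow) : f ≅ g where
  hom := (cellEquiv f g).symm α
  inv := (cellEquiv g f).symm α.inv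
  hom_inv_id := (toClass_comp α α.inv).symm.trans
    ((congrArg _ α.comp_inv).trans (toClass_id _))
  inv_hom_id := (toClass_comp α.inv α).symm.trans
    ((congrArg _ α.inv_comp).trans (toClass_id _))

instance (η : f ⟶ g) : IsIso η := by
  have : η = (Trans.cellIso (cellEquiv f g η)).hom := ((cellEquiv f g).left_inv η).symm
  rw [this]
  infer_instance

end

end IntGroupoid
end IntGpd

namespace IntGpd

/-! ### Gluing along covers -/

section Gluing

variable {C : Type u} [Category.{v} C] {J : Precoverage C}

/-- A property of arrows to `X` holds locally if it holds for the members of some cover of `X`. -/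
def Locally (J : Precoverage C) (X : C) (P : ∀ ⦃U : C⦄, (U ⟶ X) → Prop) : Prop :=
  ∃ R ∈ J X, ∀ ⦃U : C⦄ ⦃g : U ⟶ X⦄, R g → P g

lemma Locally.exists_family {X : C} {P : ∀ ⦃U : C⦄, (U ⟶ X) → Prop} (h : Locally J X P) :
    ∃ (ι : Type (max u v)) (U : ι → C) (φ : ∀ i, U i ⟶ X),
      Presieve.ofArrows U φ ∈ J X ∧ ∀ i, P (φ i) := by
  obtain ⟨R, hR, h⟩ := h
  obtain ⟨ι, U, φ, rfl⟩ := R.exists_eq_ofArrows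
  exact ⟨ι, U, φ, hR, fun i => h (.mk i)⟩

lemma Locally.of_family {X : C} {P : ∀ ⦃U : C⦄, (U ⟶ X) → Prop} {ι : Type w} {U : ι → C}
    {φ : ∀ i, U i ⟶ X} (hφ : Presieve.ofArrows U φ ∈ J X) (h : ∀ i, P (φ i)) : Locally J X P :=
  ⟨_, hφ, by rintro _ _ ⟨i⟩; exact h i⟩

lemma Locally.mono {X : C} {P Q : ∀ ⦃U : C⦄, (U ⟶ X) → Prop} (h : Locally J X P)
    (hPQ : ∀ ⦃U : C⦄ (g : U ⟶ X), P g → Q g) : Locally J X Q := by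
  obtain ⟨R, hR, h⟩ := h
  exact ⟨R, hR, fun _ _ hg => hPQ _ (h hg)⟩

lemma Locally.of_id [J.HasIsos] {X : C} {P : ∀ ⦃U : C⦄, (U ⟶ X) → Prop} (h : P (𝟙 X)) :
    Locally J X P :=
  ⟨_, Precoverage.mem_coverings_of_isIso (𝟙 X), by rintro _ _ ⟨⟩; exact h⟩

/-- Base change of a cover. -/
lemma Locally.pullback [J.HasPullbacks] [J.IsStableUnderBaseChange] {X Y : C}
    {P : ∀ ⦃U : C⦄, (U ⟶ X) → Prop} (h : Locally J X P) (f : Y ⟶ X) :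
    Locally J Y fun V g => ∃ (U : C) (k : V ⟶ U) (g' : U ⟶ X), P g' ∧ k ≫ g' = g ≫ f := by
  obtain ⟨ι, U, φ, hφ, h⟩ := h.exists_family
  have := fun i => hasPullback_of_covering J φ hφ i f
  exact .of_family (Precoverage.mem_coverings_of_isPullback φ hφ f _ _
    fun i => IsPullback.of_hasPullback f (φ i)) fun i => ⟨_, _, _, h i, pullback.condition.symm⟩

/-- Composition of covers. -/
lemma Locally.bind [J.IsStableUnderComposition] {X : C} {P : ∀ ⦃U : C⦄, (U ⟶ X) → Prop}
    {Q : ∀ ⦃U : C⦄, (U ⟶ X) → Prop} (h : Locally J X P)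
    (h' : ∀ ⦃U : C⦄ (g : U ⟶ X), P g → Locally J U fun _ k => Q (k ≫ g)) : Locally J X Q := by
  obtain ⟨ι, U, φ, hφ, h⟩ := h.exists_family
  choose σ V ψ hψ hQ using fun i => (h' _ (h i)).exists_family
  exact .of_family (Precoverage.comp_mem_coverings φ hφ ψ hψ) fun p => hQ p.1 p.2

lemma hom_ext_of_cover (hsub : Subcanonical J) {X Z : C} {ι : Type w} {U : ι → C}
    {φ : ∀ i, U i ⟶ X} (hφ : Presieve.ofArrows U φ ∈ J X) {a b : X ⟶ Z}
    (h : ∀ i, φ i ≫ a = φ i ≫ b) : a = b :=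
  (hsub hφ Z).isSeparatedFor.ext (by rintro _ _ ⟨i⟩; exact h i)

/-- In a subcanonical site, compatible arrows on the members of a cover glue. -/
lemma exists_glue (hsub : Subcanonical J) {X Z : C} {ι : Type w} {U : ι → C}
    {φ : ∀ i, U i ⟶ X} (hφ : Presieve.ofArrows U φ ∈ J X) (t : ∀ i, U i ⟶ Z)
    (ht : ∀ ⦃T : C⦄ (i j : ι) (a : T ⟶ U i) (b : T ⟶ U j),
      a ≫ φ i = b ≫ φ j → a ≫ t i = b ≫ t j) :
    ∃ m : X ⟶ Z, ∀ i, φ i ≫ m = t i :=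
  ((Presieve.isSheafFor_arrows_iff _ _).1 (hsub hφ Z) t
    fun i j _ a b h => ht i j a b h).exists

/-! ### Pullbacks by descent -/

section

variable {S X Y : C} (f : S ⟶ X) (y : Y ⟶ X) {ι : Type w} {U : ι → C} (φ : ∀ i, U i ⟶ Y)

/-- The pullbacks of `f` along the restrictions of `y` to a cover, as a descent datum. -/
noncomputable def pullbackDatum [∀ i, HasPullback f (φ i ≫ y)] : DescentDatum φ where
  obj i := pullback f (φ i ≫ y)
  proj i := pullback.snd f (φ i ≫ y)
  glue i j p x h := pullback.lift (p ≫ pullback.fst _ _) x (by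
    rw [Category.assoc, pullback.condition]
    simpa using h =≫ y)
  glue_natural s i j p x h h' := by
    apply pullback.hom_ext <;> simp [pullback.lift_fst, pullback.lift_snd]
  glue_proj i j p x h := pullback.lift_snd _ _ _
  glue_self i p h := by
    apply pullback.hom_ext <;> simp [pullback.lift_fst, pullback.lift_snd]
  glue_glue i j k p x x' h h' h'' := by
    apply pullback.hom_ext <;> simp [pullback.lift_fst, pullback.lift_snd]

end

/-- By effective descent, a pullback exists if it exists locally: the local pullbacks form a descent
datum, and the object obtained from it is the pullback. -/
lemma hasPullback_of_locally [J.HasPullbacks] [J.IsStableUnderBaseChange] (hsub : Subcanonical J)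
    (hdesc : EffectiveDescent J) {S X Y : C} (f : S ⟶ X) (y : Y ⟶ X)
    (h : Locally J Y fun _ g => HasPullback f (g ≫ y)) : HasPullback f y := by
  obtain ⟨ι, U, φ, hφ, h⟩ := h.exists_family
  have hpb := fun (i : ι) {Y' : C} (f : Y' ⟶ Y) => hasPullback_of_covering J φ hφ i f
  have heq : (descentFunctor φ).IsEquivalence := hdesc ι Y U φ hφ
  let A : Over Y := (descentFunctor φ).objPreimage (pullbackDatum f y φ)
  let e : (descentFunctor φ).obj A ≅ pullbackDatum f y φ := (descentFunctor φ).objObjPreimageIso _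
  let s : ∀ i, pullback A.hom (φ i) ⟶ pullback f (φ i ≫ y) := e.hom.hom
  let r : ∀ i, pullback f (φ i ≫ y) ⟶ pullback A.hom (φ i) := e.inv.hom
  have sr : ∀ i, s i ≫ r i = 𝟙 _ := fun i =>
    congrFun (congrArg DescentDatum.Hom.hom e.hom_inv_id) i
  have rs : ∀ i, r i ≫ s i = 𝟙 _ := fun i =>
    congrFun (congrArg DescentDatum.Hom.hom e.inv_hom_id) i
  have s_snd : ∀ i, s i ≫ pullback.snd f (φ i ≫ y) = pullback.snd A.hom (φ i) := e.hom.hom_proj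
  have r_snd : ∀ i, r i ≫ pullback.snd A.hom (φ i) = pullback.snd f (φ i ≫ y) := e.inv.hom_proj
  -- the projection to `S` is glued from the local projections
  have hA := Precoverage.mem_coverings_of_isPullback φ hφ A.hom _ _
    fun i => IsPullback.of_hasPullback A.hom (φ i)
  obtain ⟨p, hp⟩ := exists_glue hsub hA (fun i => s i ≫ pullback.fst f (φ i ≫ y)) (by
    intro T i j a b hab
    have c : a ≫ pullback.snd A.hom (φ i) ≫ φ i = (b ≫ pullback.snd A.hom (φ j)) ≫ φ j := by
      rw [← pullback.condition, ← Category.assoc, hab, Category.assoc, pullback.condition,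
        Category.assoc]
    have c' : (a ≫ s i) ≫ pullback.snd f (φ i ≫ y) ≫ φ i =
        (b ≫ pullback.snd A.hom (φ j)) ≫ φ j := by
      rw [Category.assoc, ← Category.assoc (s i), s_snd, c]
    have g := e.hom.hom_glue i j a (b ≫ pullback.snd A.hom (φ j)) c c'
    have hb : ((descentFunctor φ).obj A).glue i j a (b ≫ pullback.snd A.hom (φ j)) c = b :=
      pullback.hom_ext ((pullback.lift_fst _ _ _).trans hab) (pullback.lift_snd _ _ _)
    rw [hb] at g
    have g' := congrArg (· ≫ pullback.fst f (φ j ≫ y)) g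
    exact ((Category.assoc _ _ _).symm.trans (pullback.lift_fst _ _ _).symm).trans
      (g'.trans (Category.assoc _ _ _)))
  have hpf : p ≫ f = A.hom ≫ y := hom_ext_of_cover hsub hA fun i => by
    rw [← Category.assoc, hp, Category.assoc, pullback.condition, ← Category.assoc, s_snd,
      ← Category.assoc, ← Category.assoc, pullback.condition]
  -- `p` and `A.hom` are jointly monic on arrows which factor over a member of the cover
  have local_ext : ∀ {T : C} (i : ι) (z : T ⟶ U i) (m m' : T ⟶ A.left), m ≫ A.hom = z ≫ φ i →
      m' ≫ A.hom = z ≫ φ i → m ≫ p = m' ≫ p → m = m' := by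
    intro T i z m m' hm hm' hp'
    have key : pullback.lift m z hm ≫ s i = pullback.lift m' z hm' ≫ s i := by
      apply pullback.hom_ext
      · rw [Category.assoc, Category.assoc, ← hp, pullback.lift_fst_assoc,
          pullback.lift_fst_assoc, hp']
      · rw [Category.assoc, Category.assoc, s_snd, pullback.lift_snd, pullback.lift_snd]
    have key' := key =≫ r i
    rw [Category.assoc, Category.assoc, sr, Category.comp_id, Category.comp_id] at key'
    rw [← pullback.lift_fst m z hm, key', pullback.lift_fst]
  have cover : ∀ {T : C} (b : T ⟶ Y), Presieve.ofArrows (fun i => pullback b (φ i))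
      (fun i => pullback.fst b (φ i)) ∈ J T := fun b =>
    Precoverage.mem_coverings_of_isPullback φ hφ b _ _ fun i => IsPullback.of_hasPullback b (φ i)
  have lift : ∀ c : PullbackCone f y, ∃ m : c.pt ⟶ A.left, m ≫ p = c.fst ∧ m ≫ A.hom = c.snd := by
    intro c
    have c₀ : ∀ i, (pullback.fst c.snd (φ i) ≫ c.fst) ≫ f =
        pullback.snd c.snd (φ i) ≫ φ i ≫ y := fun i => by
      rw [Category.assoc, c.condition, pullback.condition_assoc]
    let t : ∀ i, pullback c.snd (φ i) ⟶ A.left := fun i =>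
      pullback.lift _ _ (c₀ i) ≫ r i ≫ pullback.fst A.hom (φ i)
    have t_p : ∀ i, t i ≫ p = pullback.fst c.snd (φ i) ≫ c.fst := fun i => by
      simp only [t, Category.assoc]
      rw [hp, reassoc_of% (rs i), pullback.lift_fst]
    have t_hom : ∀ i, t i ≫ A.hom = pullback.snd c.snd (φ i) ≫ φ i := fun i => by
      simp only [t, Category.assoc]
      rw [pullback.condition, reassoc_of% (r_snd i), pullback.lift_snd_assoc]
    clear_value t
    obtain ⟨m, hm⟩ := exists_glue hsub (cover c.snd) t (by
      intro T i j a b hab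
      refine local_ext i (a ≫ pullback.snd c.snd (φ i)) _ _ ?_ ?_ ?_
      · rw [Category.assoc, t_hom, Category.assoc]
      · rw [Category.assoc, t_hom, ← pullback.condition, ← Category.assoc, ← hab, Category.assoc,
          pullback.condition, Category.assoc]
      · rw [Category.assoc, Category.assoc, t_p, t_p, ← Category.assoc, hab, Category.assoc])
    refine ⟨m, hom_ext_of_cover hsub (cover c.snd) fun i => ?_,
      hom_ext_of_cover hsub (cover c.snd) fun i => ?_⟩
    · rw [← Category.assoc, hm, t_p]
    · rw [← Category.assoc, hm, t_hom, pullback.condition]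
  choose l l_p l_hom using lift
  have lim : IsPullback p A.hom f y := by
    refine ⟨⟨hpf⟩, ⟨PullbackCone.IsLimit.mk _ l l_p l_hom fun c m hm hm' => ?_⟩⟩
    refine hom_ext_of_cover hsub (cover c.snd) fun i => ?_
    refine local_ext i (pullback.snd c.snd (φ i)) _ _ ?_ ?_ ?_
    · rw [Category.assoc, hm', pullback.condition]
    · rw [Category.assoc, l_hom, pullback.condition]
    · rw [Category.assoc, Category.assoc, hm, l_p]
  exact lim.hasPullback

end Gluing
end IntGpd

namespace IntGpd

/-! ### Fully faithful and locally essentially surjective arrows -/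

namespace IntGroupoid

variable {C : Type u} [Category.{v} C] {J : Precoverage C} {G H K L : IntGroupoid J} {S T : C}
local infixr:75 " ⋆ " => star

/-- A strict arrow is fully faithful if it is bijective on arrows with given ends, in terms of
generalized elements. -/
def FullyFaithful (φ : H ⟶ G) : Prop :=
  ∀ ⦃T : C⦄ (x y : T ⟶ H.Ob) (γ : T ⟶ G.Ar),
    γ ≫ G.src = x ≫ φ.ob → γ ≫ G.tgt = y ≫ φ.ob →
      ∃! η : T ⟶ H.Ar, η ≫ H.src = x ∧ η ≫ H.tgt = y ∧ η ≫ φ.ar = γ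

/-- A strict arrow is locally essentially surjective if the objects of its target are isomorphic to
objects in its image locally, over the members of a cover. -/
def LocallyEssSurj (φ : H ⟶ G) : Prop :=
  Locally J G.Ob fun U z => ∃ (x : U ⟶ H.Ob) (γ : U ⟶ G.Ar), γ ≫ G.src = x ≫ φ.ob ∧ γ ≫ G.tgt = z

lemma FullyFaithful.ext {φ : H ⟶ G} (hφ : FullyFaithful φ) {a b : T ⟶ H.Ar}
    (hs : a ≫ H.src = b ≫ H.src) (ht : a ≫ H.tgt = b ≫ H.tgt) (h : a ≫ φ.ar = b ≫ φ.ar) : a = b :=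
  (hφ (b ≫ H.src) (b ≫ H.tgt) (b ≫ φ.ar) (by rw [Category.assoc, Category.assoc, φ.ar_src])
    (by rw [Category.assoc, Category.assoc, φ.ar_tgt])).unique ⟨hs, ht, h⟩ ⟨rfl, rfl, rfl⟩

lemma FullyFaithful.id (G : IntGroupoid J) : FullyFaithful (𝟙 G) := by
  intro T x y γ h h'
  refine ⟨γ, ⟨by simpa using h, by simpa using h', Category.comp_id _⟩, fun η hη => ?_⟩
  simpa using hη.2.2

lemma FullyFaithful.comp {f : K ⟶ H} {g : H ⟶ G} (hf : FullyFaithful f) (hg : FullyFaithful g) :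
    FullyFaithful (f ≫ g) := by
  intro T x y γ h h'
  obtain ⟨δ, ⟨h₁, h₂, h₃⟩, -⟩ := hg (x ≫ f.ob) (y ≫ f.ob) γ (by simpa using h) (by simpa using h')
  obtain ⟨η, ⟨h₄, h₅, h₆⟩, -⟩ := hf x y δ h₁ h₂
  refine ⟨η, ⟨h₄, h₅, by rw [comp_ar, ← Category.assoc, h₆, h₃]⟩, ?_⟩
  rintro θ ⟨h₇, h₈, h₉⟩
  refine hf.ext (h₇.trans h₄.symm) (h₈.trans h₅.symm) (hg.ext ?_ ?_ ?_)
  · rw [Category.assoc, Category.assoc, f.ar_src, reassoc_of% h₇, reassoc_of% h₄]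
  · rw [Category.assoc, Category.assoc, f.ar_tgt, reassoc_of% h₈, reassoc_of% h₅]
  · rw [h₆, h₃, Category.assoc]
    exact h₉

/-- Cancellation for fully faithful arrows, as in the two-out-of-six property. -/
lemma FullyFaithful.of_comp {f : K ⟶ H} {g : H ⟶ G} {k : G ⟶ L} (hfg : FullyFaithful (f ≫ g))
    (hgk : FullyFaithful (g ≫ k)) : FullyFaithful f := by
  intro T x y γ h h'
  obtain ⟨η, ⟨h₁, h₂, h₃⟩, hu⟩ := hfg x y (γ ≫ g.ar)
    (by rw [Category.assoc, g.ar_src, ← Category.assoc, h, Category.assoc]; rfl)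
    (by rw [Category.assoc, g.ar_tgt, ← Category.assoc, h', Category.assoc]; rfl)
  refine ⟨η, ⟨h₁, h₂, hgk.ext ?_ ?_ ?_⟩, ?_⟩
  · rw [Category.assoc, f.ar_src, reassoc_of% h₁, h]
  · rw [Category.assoc, f.ar_tgt, reassoc_of% h₂, h']
  · have := h₃ =≫ k.ar
    simpa using this
  · rintro θ ⟨h₄, h₅, rfl⟩
    exact hu θ ⟨h₄, h₅, by simp⟩

/-- The naturality square at a generalized arrow from `x` to `y`. -/
lemma Trans.naturality_apply {f g : K ⟶ G} (α : Trans f g) {η : T ⟶ K.Ar} {x y : T ⟶ K.Ob}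
    (hx : η ≫ K.src = x) (hy : η ≫ K.tgt = y) :
    (x ≫ α.app) ⋆ (η ≫ g.ar) = (η ≫ f.ar) ⋆ (y ≫ α.app) := by
  have h := congrArg (η ≫ ·) α.naturality
  simp only [comp_star _ α.src_app_tgt, comp_star _ α.ar_tgt_app] at h
  rwa [← Category.assoc, hx, ← Category.assoc η K.tgt, hy] at h

lemma FullyFaithful.of_trans {f g : K ⟶ G} (hf : FullyFaithful f) (α : Trans f g) :
    FullyFaithful g := by
  intro T x y γ h h'
  have hx : (x ≫ α.app) ≫ G.tgt = γ ≫ G.src := by rw [Category.assoc, α.app_tgt, h]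
  have hy : γ ≫ G.tgt = ((y ≫ α.app) ≫ G.inv) ≫ G.src := by
    rw [Category.assoc, G.inv_src, Category.assoc, α.app_tgt, h']
  have e : (γ ⋆ ((y ≫ α.app) ≫ G.inv)) ≫ G.tgt = (y ≫ α.app) ≫ G.src := by
    rw [star_tgt hy, Category.assoc, G.inv_tgt]
  have hxy : (x ≫ α.app) ≫ G.tgt = (γ ⋆ ((y ≫ α.app) ≫ G.inv)) ≫ G.src := by rw [star_src hy, hx]
  have key : ((x ≫ α.app) ⋆ γ ⋆ ((y ≫ α.app) ≫ G.inv)) ⋆ (y ≫ α.app) = (x ≫ α.app) ⋆ γ := by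
    rw [star_assoc hxy e, star_assoc hy (by simp [G.inv_tgt]), inv_star, star_unit]
    rw [hy, Category.assoc, G.inv_src]
  have src_ar : ∀ {η : T ⟶ K.Ar} {z} (k : K ⟶ G), η ≫ K.src = z → (η ≫ k.ar) ≫ G.src = z ≫ k.ob :=
    fun k h => by rw [Category.assoc, k.ar_src, reassoc_of% h]
  have tgt_ar : ∀ {η : T ⟶ K.Ar} {z} (k : K ⟶ G), η ≫ K.tgt = z → (η ≫ k.ar) ≫ G.tgt = z ≫ k.ob :=
    fun k h => by rw [Category.assoc, k.ar_tgt, reassoc_of% h]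
  obtain ⟨η, ⟨h₁, h₂, h₃⟩, hu⟩ := hf x y ((x ≫ α.app) ⋆ γ ⋆ ((y ≫ α.app) ≫ G.inv))
    (by rw [star_src hxy, Category.assoc, α.app_src])
    (by rw [star_tgt hxy, e, Category.assoc, α.app_src])
  refine ⟨η, ⟨h₁, h₂, star_left_cancel (a := x ≫ α.app) ?_ hx ?_⟩, ?_⟩
  · rw [src_ar g h₁, Category.assoc, α.app_tgt]
  · rw [α.naturality_apply h₁ h₂, h₃, key]
  · rintro θ ⟨h₄, h₅, h₆⟩
    refine hu θ ⟨h₄, h₅, star_right_cancel (c := y ≫ α.app) ?_ ?_ ?_⟩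
    · rw [tgt_ar f h₅, Category.assoc, α.app_src]
    · rw [star_tgt hxy, e]
    · rw [← α.naturality_apply h₄ h₅, h₆, key]

lemma LocallyEssSurj.id [J.HasIsos] (G : IntGroupoid J) : LocallyEssSurj (𝟙 G) :=
  .of_id ⟨𝟙 _, G.unit, by simp [G.unit_src], G.unit_tgt⟩

lemma LocallyEssSurj.of_trans {f g : K ⟶ G} (hf : LocallyEssSurj f) (α : Trans f g) :
    LocallyEssSurj g := by
  refine hf.mono ?_
  rintro U z ⟨x, γ, h, h'⟩
  have e : (x ≫ α.inv.app) ≫ G.tgt = γ ≫ G.src := by rw [Category.assoc, α.inv.app_tgt, h]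
  exact ⟨x, (x ≫ α.inv.app) ⋆ γ, by rw [star_src e, Category.assoc, α.inv.app_src],
    by rw [star_tgt e, h']⟩

lemma LocallyEssSurj.pullback [J.HasPullbacks] [J.IsStableUnderBaseChange] {φ : H ⟶ G}
    (hφ : LocallyEssSurj φ) {Y : C} (z : Y ⟶ G.Ob) :
    Locally J Y fun U k => ∃ (x : U ⟶ H.Ob) (γ : U ⟶ G.Ar),
      γ ≫ G.src = x ≫ φ.ob ∧ γ ≫ G.tgt = k ≫ z := by
  refine (Locally.pullback hφ z).mono ?_
  rintro V k ⟨U, j, g, ⟨x, γ, h, h'⟩, hj⟩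
  exact ⟨j ≫ x, j ≫ γ, by simp [h], by simp [h', hj]⟩

lemma LocallyEssSurj.comp [J.HasPullbacks] [J.IsStableUnderBaseChange]
    [J.IsStableUnderComposition] {f : K ⟶ H} {g : H ⟶ G} (hf : LocallyEssSurj f)
    (hg : LocallyEssSurj g) : LocallyEssSurj (f ≫ g) := by
  refine hg.bind ?_
  rintro U z ⟨x, γ, h, h'⟩
  refine (hf.pullback x).mono ?_
  rintro V k ⟨y, δ, h₁, h₂⟩
  have e : (δ ≫ g.ar) ≫ G.tgt = (k ≫ γ) ≫ G.src := by
    rw [Category.assoc, Category.assoc, g.ar_tgt, reassoc_of% h₂, h]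
  exact ⟨y, (δ ≫ g.ar) ⋆ (k ≫ γ),
    by rw [star_src e, Category.assoc, g.ar_src, reassoc_of% h₁]; rfl,
    by rw [star_tgt e, Category.assoc, h']⟩

lemma IsEssentialEquivalence.locallyEssSurj {φ : H ⟶ G} (hφ : IsEssentialEquivalence φ) :
    LocallyEssSurj φ := by
  -- an admissible epimorphism is locally split, being a base change of itself
  obtain ⟨-, R, hR, h⟩ := hφ.essSurj.universal
    (IsPullback.of_horiz_isIso ⟨by rw [Category.id_comp, Category.comp_id]⟩ :
      IsPullback (𝟙 _) (pullback.fst G.src φ.ob ≫ G.tgt) (pullback.fst G.src φ.ob ≫ G.tgt) (𝟙 _))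
  refine ⟨R, hR, fun U g hg => ?_⟩
  obtain ⟨l, hl⟩ := h hg
  exact ⟨l ≫ pullback.snd _ _, l ≫ pullback.fst _ _, by simp [pullback.condition],
    by simpa using hl⟩

/-- Over an object `V` with an isomorphism from `φ x` to `z`, the pullback of the object of arrows
starting in the image of `φ` along `z` is the object of arrows of `H` with target `x`. -/
lemma FullyFaithful.hasPullback {φ : H ⟶ G} (hφ : FullyFaithful φ) {V : C} {z : V ⟶ G.Ob}
    {x : V ⟶ H.Ob} {γ : V ⟶ G.Ar} (h : γ ≫ G.src = x ≫ φ.ob) (h' : γ ≫ G.tgt = z) :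
    HasPullback (pullback.fst G.src φ.ob ≫ G.tgt) z := by
  have e : (pullback.fst H.tgt x ≫ φ.ar) ≫ G.tgt = (pullback.snd H.tgt x ≫ γ) ≫ G.src := by
    rw [Category.assoc, φ.ar_tgt, pullback.condition_assoc, Category.assoc, h]
  have e' : ((pullback.fst H.tgt x ≫ φ.ar) ⋆ (pullback.snd H.tgt x ≫ γ)) ≫ G.src =
      (pullback.fst H.tgt x ≫ H.src) ≫ φ.ob := by
    rw [star_src e, Category.assoc, φ.ar_src, Category.assoc]
  have key : ∀ c : PullbackCone (pullback.fst G.src φ.ob ≫ G.tgt) z, ∃ m : c.pt ⟶ pullback H.tgt x,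
      m ≫ pullback.lift _ _ e' = c.fst ∧ m ≫ pullback.snd H.tgt x = c.snd := by
    intro c
    have hc : (c.fst ≫ pullback.fst G.src φ.ob) ≫ G.tgt =
        ((c.snd ≫ γ) ≫ G.inv) ≫ G.src := by
      rw [Category.assoc, c.condition, Category.assoc, G.inv_src, Category.assoc, h']
    -- composing with the inverse of `γ` moves the target into the image of `φ`
    obtain ⟨η, ⟨h₁, h₂, h₃⟩, -⟩ := hφ (c.fst ≫ pullback.snd G.src φ.ob) (c.snd ≫ x)
      ((c.fst ≫ pullback.fst G.src φ.ob) ⋆ ((c.snd ≫ γ) ≫ G.inv))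
      (by rw [star_src hc, Category.assoc, pullback.condition, Category.assoc])
      (by rw [star_tgt hc, Category.assoc, G.inv_tgt, Category.assoc, h, Category.assoc])
    refine ⟨pullback.lift η c.snd h₂, ?_, pullback.lift_snd _ _ _⟩
    apply pullback.hom_ext
    · rw [Category.assoc, pullback.lift_fst, comp_star _ e, pullback.lift_fst_assoc,
        pullback.lift_snd_assoc, h₃, star_assoc hc (by simp [G.inv_tgt]), inv_star, star_unit]
      rw [hc, Category.assoc, G.inv_src]
    · rw [Category.assoc, pullback.lift_snd, pullback.lift_fst_assoc, h₁]
  choose l hl hl' using key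
  refine IsPullback.hasPullback (fst := pullback.lift _ _ e') (snd := pullback.snd H.tgt x)
    ⟨⟨?_⟩, ⟨PullbackCone.IsLimit.mk _ l hl hl' ?_⟩⟩
  · rw [pullback.lift_fst_assoc, star_tgt e, Category.assoc, h']
  · intro c m hm hm'
    have hs : m ≫ pullback.snd H.tgt x = l c ≫ pullback.snd H.tgt x := hm'.trans (hl' c).symm
    have ht := hm.trans (hl c).symm
    refine pullback.hom_ext (hφ.ext ?_ ?_ ?_) hs
    · have := ht =≫ pullback.snd _ _
      simpa only [Category.assoc, pullback.lift_snd] using this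
    · rw [Category.assoc, pullback.condition, Category.assoc, pullback.condition, reassoc_of% hs]
    · have := ht =≫ pullback.fst _ _
      simp only [Category.assoc, pullback.lift_fst, comp_star _ e] at this
      rw [reassoc_of% hs] at this
      rw [Category.assoc, Category.assoc]
      refine star_right_cancel ?_ ?_ this
      · simpa using (m ≫= e).trans (by simp [reassoc_of% hs])
      · simpa using l c ≫= e

lemma FullyFaithful.isEssentialEquivalence [J.HasPullbacks] [J.IsStableUnderBaseChange]
    (hsub : Subcanonical J) (hdesc : EffectiveDescent J) {φ : H ⟶ G} (hφ : FullyFaithful φ)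
    (h : LocallyEssSurj φ) : IsEssentialEquivalence φ where
  fullyFaithful := @hφ
  essSurj :=
    { hasPullback := fun g => hasPullback_of_locally hsub hdesc _ _ <|
        (h.pullback g).mono fun _ _ ⟨_, _, h₁, h₂⟩ => hφ.hasPullback h₁ h₂
      universal := by
        intro Q Y p q g hq
        have split : Locally J Y fun U k => ∃ l : U ⟶ Q, l ≫ q = k :=
          (h.pullback g).mono fun U k ⟨x, γ, h₁, h₂⟩ =>
            ⟨hq.lift (pullback.lift γ x h₁) k (by rw [pullback.lift_fst_assoc, h₂]),
              hq.lift_snd _ _ _⟩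
        refine ⟨⟨fun a b hab => ?_⟩, split⟩
        obtain ⟨ι, U, k, hk, hl⟩ := split.exists_family
        refine hom_ext_of_cover hsub hk fun i => ?_
        obtain ⟨l, hl⟩ := hl i
        rw [← hl, Category.assoc, hab, Category.assoc] }

variable [J.HasIsos]

/-- Equivalences are fully faithful and locally essentially surjective. -/
lemma fullyFaithful_and_locallyEssSurj_of_trans {φ : H ⟶ G} {ψ : G ⟶ H} (α : Trans (φ ≫ ψ) (𝟙 H))
    (β : Trans (ψ ≫ φ) (𝟙 G)) : FullyFaithful φ ∧ LocallyEssSurj φ :=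
  ⟨.of_comp ((FullyFaithful.id _).of_trans α.inv) ((FullyFaithful.id _).of_trans β.inv),
    .of_id ⟨ψ.ob, β.app, β.app_src, β.app_tgt⟩⟩

/-- The essential homotopy equivalences are the fully faithful and locally essentially surjective
arrows. In particular they are essential equivalences: the pullbacks demanded of the range map exist
by effective descent. -/
lemma isEssentialHomotopyEquivalence_iff [J.HasPullbacks] [J.IsStableUnderBaseChange]
    [J.IsStableUnderComposition] (hsub : Subcanonical J) (hdesc : EffectiveDescent J)
    {φ : H ⟶ G} : IsEssentialHomotopyEquivalence φ ↔ FullyFaithful φ ∧ LocallyEssSurj φ := by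
  constructor
  · rintro ⟨L, h, k, ⟨g, ⟨-, q, -⟩, ⟨-, r, -⟩⟩, hk, -, p, -⟩
    obtain ⟨h₁, h₂⟩ := fullyFaithful_and_locallyEssSurj_of_trans (strongTrans q) (strongTrans r)
    have hk' : FullyFaithful k := fun _ => hk.fullyFaithful
    exact ⟨(h₁.comp hk').of_trans (strongTrans p),
      (h₂.comp hk.locallyEssSurj).of_trans (strongTrans p)⟩
  · rintro ⟨h, h'⟩
    refine ⟨H, 𝟙 H, φ, ⟨𝟙 H, ?_, ?_⟩, h.isEssentialEquivalence hsub hdesc h', ?_⟩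
    all_goals
      rw [Category.id_comp]
      exact ⟨_, .nil _, rfl⟩

end IntGroupoid
end IntGpd

namespace IntGpd

/-! ### Groupoids induced along an arrow to the object of objects -/

namespace IntGroupoid

variable {C : Type u} [Category.{v} C] {J : Precoverage C} {G H K L : IntGroupoid J} {S T : C}
local infixr:75 " ⋆ " => star

/-- An arrow of groupoids preserves inverses as soon as it preserves composition. -/
def homOfComp (ob : H.Ob ⟶ G.Ob) (ar : H.Ar ⟶ G.Ar) (ar_src : ar ≫ G.src = H.src ≫ ob)
    (ar_tgt : ar ≫ G.tgt = H.tgt ≫ ob)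
    (map_star : ∀ {T : C} (a b : T ⟶ H.Ar), a ≫ H.tgt = b ≫ H.src →
      (a ⋆ b) ≫ ar = (a ≫ ar) ⋆ (b ≫ ar)) : H ⟶ G :=
  StrictArrow.mk (G := H) (H := G) ob ar ar_src ar_tgt
    (fun a b h h' => by rw [comp_eq_star, comp_eq_star, map_star a b h]) (by
      have hu : (H.unit ≫ ar) ≫ G.tgt = (H.unit ≫ ar) ≫ G.src := by
        rw [Category.assoc, Category.assoc, ar_src, ar_tgt, reassoc_of% H.unit_src,
          reassoc_of% H.unit_tgt]
      have hu' : (H.unit ≫ ar) ≫ G.tgt = ob := by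
        rw [Category.assoc, ar_tgt, reassoc_of% H.unit_tgt]
      have unit_ar : H.unit ≫ ar = ob ≫ G.unit := by
        refine star_left_cancel (a := H.unit ≫ ar) hu ?_ ?_
        · rw [hu', Category.assoc, G.unit_src, Category.comp_id]
        · rw [star_unit hu', ← map_star _ _ (by rw [H.unit_src, H.unit_tgt])]
          congr 1
          simpa using unit_star (a := H.unit) (x := 𝟙 _) H.unit_src.symm
      have h₁ : H.inv ⋆ 𝟙 H.Ar = H.tgt ≫ H.unit := by
        simpa using inv_star (a := 𝟙 H.Ar)
      have e := map_star H.inv (𝟙 _) (by rw [H.inv_tgt, Category.id_comp])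
      rw [h₁, Category.assoc, unit_ar, Category.id_comp] at e
      refine star_right_cancel (c := ar) ?_ ?_ (e.symm.trans ?_)
      · rw [Category.assoc, ar_tgt, ar_src, reassoc_of% H.inv_tgt]
      · rw [Category.assoc, G.inv_tgt]
      · rw [inv_star, ar_tgt, Category.assoc])

/-- The arrows of the groupoid induced by `G` on an object `X` along `q : X ⟶ G.Ob`: an object of
triples `(x, γ, y)` with `x`, `y` in `X` and `γ` an arrow of `G` from `q x` to `q y`. -/
structure Induced (G : IntGroupoid J) {X : C} (q : X ⟶ G.Ob) where
  Ar : C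
  src : Ar ⟶ X
  tgt : Ar ⟶ X
  map : Ar ⟶ G.Ar
  map_src : map ≫ G.src = src ≫ q
  map_tgt : map ≫ G.tgt = tgt ≫ q
  lift : ∀ {T : C} (x y : T ⟶ X) (γ : T ⟶ G.Ar), γ ≫ G.src = x ≫ q → γ ≫ G.tgt = y ≫ q → (T ⟶ Ar)
  lift_src : ∀ {T : C} (x y : T ⟶ X) (γ : T ⟶ G.Ar) (h) (h'), lift x y γ h h' ≫ src = x
  lift_tgt : ∀ {T : C} (x y : T ⟶ X) (γ : T ⟶ G.Ar) (h) (h'), lift x y γ h h' ≫ tgt = y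
  lift_map : ∀ {T : C} (x y : T ⟶ X) (γ : T ⟶ G.Ar) (h) (h'), lift x y γ h h' ≫ map = γ
  hom_ext : ∀ {T : C} {a b : T ⟶ Ar}, a ≫ src = b ≫ src → a ≫ tgt = b ≫ tgt →
    a ≫ map = b ≫ map → a = b
  hasPullback : ∀ {Y : C} (g : Y ⟶ X), HasPullback tgt g

/-- If `q` has pullbacks, then the object of triples is obtained by pulling back twice. -/
noncomputable def Induced.ofHasPullback (G : IntGroupoid J) {X : C} (q : X ⟶ G.Ob)
    [∀ {Y : C} (g : Y ⟶ G.Ob), HasPullback q g] : G.Induced q where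
  Ar := pullback q (pullback.fst G.tgt q ≫ G.src)
  src := pullback.fst _ _
  tgt := pullback.snd _ _ ≫ pullback.snd _ _
  map := pullback.snd _ _ ≫ pullback.fst _ _
  map_src := by rw [Category.assoc, pullback.condition]
  map_tgt := by simp [pullback.condition]
  lift x y γ h h' := pullback.lift x (pullback.lift γ y h') (by rw [pullback.lift_fst_assoc, h])
  lift_src x y γ h h' := pullback.lift_fst _ _ _
  lift_tgt x y γ h h' := by rw [pullback.lift_snd_assoc, pullback.lift_snd]
  lift_map x y γ h h' := by rw [pullback.lift_snd_assoc, pullback.lift_fst]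
  hom_ext h₁ h₂ h₃ := by
    refine pullback.hom_ext h₁ (pullback.hom_ext ?_ ?_)
    · simpa using h₃
    · simpa using h₂
  hasPullback {Y} g := by
    -- `(γ, z)` with `z` in `Y` and `γ` an arrow of `G` with target `q (g z)`
    have h₁ : IsPullback (pullback.lift (pullback.fst G.tgt (g ≫ q)) (pullback.snd _ _ ≫ g)
        (by rw [pullback.condition, Category.assoc])) (pullback.snd G.tgt (g ≫ q))
        (pullback.snd G.tgt q) g :=
      IsPullback.of_right (by rw [pullback.lift_fst]; exact .of_hasPullback _ _)
        (pullback.lift_snd _ _ _) (.of_hasPullback G.tgt q)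
    let k := pullback.lift (pullback.fst G.tgt (g ≫ q)) (pullback.snd _ _ ≫ g)
        (by rw [pullback.condition, Category.assoc])
    have h₂ : IsPullback (pullback.lift (pullback.fst q (k ≫ pullback.fst G.tgt q ≫ G.src))
        (pullback.snd _ _ ≫ k) (by rw [pullback.condition, Category.assoc]))
        (pullback.snd q (k ≫ pullback.fst G.tgt q ≫ G.src))
        (pullback.snd q (pullback.fst G.tgt q ≫ G.src)) k :=
      IsPullback.of_right (by rw [pullback.lift_fst]; exact .of_hasPullback _ _)
        (pullback.lift_snd _ _ _) (.of_hasPullback q _)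
    exact (h₂.paste_vert h₁).hasPullback

namespace Induced

variable {X : C} {q : X ⟶ G.Ob} (I : G.Induced q)

lemma map_tgt_eq {a b : T ⟶ I.Ar} (h : a ≫ I.tgt = b ≫ I.src) :
    (a ≫ I.map) ≫ G.tgt = (b ≫ I.map) ≫ G.src := by
  rw [Category.assoc, Category.assoc, I.map_tgt, I.map_src, reassoc_of% h]

/-- The unit of the induced groupoid. -/
def one : X ⟶ I.Ar :=
  I.lift (𝟙 X) (𝟙 X) (q ≫ G.unit) (by simp [G.unit_src]) (by simp [G.unit_tgt])

lemma one_src : I.one ≫ I.src = 𝟙 X := I.lift_src _ _ _ _ _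
lemma one_tgt : I.one ≫ I.tgt = 𝟙 X := I.lift_tgt _ _ _ _ _
lemma one_map : I.one ≫ I.map = q ≫ G.unit := I.lift_map _ _ _ _ _

/-- The inversion of the induced groupoid. -/
def opp : I.Ar ⟶ I.Ar :=
  I.lift I.tgt I.src (I.map ≫ G.inv) (by rw [Category.assoc, G.inv_src, I.map_tgt])
    (by rw [Category.assoc, G.inv_tgt, I.map_src])

lemma opp_src : I.opp ≫ I.src = I.tgt := I.lift_src _ _ _ _ _
lemma opp_tgt : I.opp ≫ I.tgt = I.src := I.lift_tgt _ _ _ _ _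
lemma opp_map : I.opp ≫ I.map = I.map ≫ G.inv := I.lift_map _ _ _ _ _

/-- The multiplication of the induced groupoid. -/
noncomputable def mul [HasPullback I.tgt I.src] : pullback I.tgt I.src ⟶ I.Ar :=
  have e := I.map_tgt_eq (pullback.condition (f := I.tgt) (g := I.src))
  I.lift (pullback.fst I.tgt I.src ≫ I.src) (pullback.snd I.tgt I.src ≫ I.tgt)
    ((pullback.fst I.tgt I.src ≫ I.map) ⋆ (pullback.snd I.tgt I.src ≫ I.map))
    (by rw [star_src e, Category.assoc, I.map_src, Category.assoc])
    (by rw [star_tgt e, Category.assoc, I.map_tgt, Category.assoc])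

section

variable [HasPullback I.tgt I.src] {a b : T ⟶ I.Ar} (h : a ≫ I.tgt = b ≫ I.src)

lemma lift_mul_src : (pullback.lift a b h ≫ I.mul) ≫ I.src = a ≫ I.src := by
  rw [Category.assoc, mul, lift_src, pullback.lift_fst_assoc]

lemma lift_mul_tgt : (pullback.lift a b h ≫ I.mul) ≫ I.tgt = b ≫ I.tgt := by
  rw [Category.assoc, mul, lift_tgt, pullback.lift_snd_assoc]

lemma lift_mul_map : (pullback.lift a b h ≫ I.mul) ≫ I.map = (a ≫ I.map) ⋆ (b ≫ I.map) := by
  rw [Category.assoc, mul, lift_map, comp_star _ (I.map_tgt_eq pullback.condition),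
    pullback.lift_fst_assoc, pullback.lift_snd_assoc]

end

lemma comp_one_src (a : T ⟶ S) (x : S ⟶ X) : (a ≫ x ≫ I.one) ≫ I.src = a ≫ x := by
  simp [I.one_src]

lemma comp_one_tgt (a : T ⟶ S) (x : S ⟶ X) : (a ≫ x ≫ I.one) ≫ I.tgt = a ≫ x := by
  simp [I.one_tgt]

lemma comp_opp_src (a : T ⟶ I.Ar) : (a ≫ I.opp) ≫ I.src = a ≫ I.tgt := by
  rw [Category.assoc, opp_src]

lemma comp_opp_tgt (a : T ⟶ I.Ar) : (a ≫ I.opp) ≫ I.tgt = a ≫ I.src := by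
  rw [Category.assoc, opp_tgt]

lemma one_star_map (a : T ⟶ I.Ar) : ((a ≫ I.src ≫ I.one) ≫ I.map) ⋆ (a ≫ I.map) = a ≫ I.map := by
  rw [Category.assoc, Category.assoc, one_map, ← Category.assoc, ← Category.assoc, unit_star]
  simp [I.map_src]

lemma star_one_map (a : T ⟶ I.Ar) : (a ≫ I.map) ⋆ ((a ≫ I.tgt ≫ I.one) ≫ I.map) = a ≫ I.map := by
  rw [Category.assoc, Category.assoc, one_map, ← Category.assoc, ← Category.assoc, star_unit]
  simp [I.map_tgt]

lemma star_opp_map (a : T ⟶ I.Ar) :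
    (a ≫ I.map) ⋆ ((a ≫ I.opp) ≫ I.map) = (a ≫ I.src ≫ I.one) ≫ I.map := by
  rw [Category.assoc a I.opp, opp_map, ← Category.assoc, star_inv]
  simp [I.map_src, one_map]

lemma opp_star_map (a : T ⟶ I.Ar) :
    ((a ≫ I.opp) ≫ I.map) ⋆ (a ≫ I.map) = (a ≫ I.tgt ≫ I.one) ≫ I.map := by
  rw [Category.assoc a I.opp, opp_map, ← Category.assoc, inv_star]
  simp [I.map_tgt, one_map]

variable [J.HasIsos]

/-- The structure arrows of the induced groupoid. -/
noncomputable def pre : PreGroupoid J where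
  Ob := X
  Ar := I.Ar
  src := I.src
  tgt := I.tgt
  tgt_adm := .of_section _ I.one I.one_tgt I.hasPullback
  unit := I.one
  inv := I.opp
  mul :=
    haveI := I.hasPullback I.src
    I.mul

section

variable {a b : T ⟶ I.Ar} (h : a ≫ I.tgt = b ≫ I.src)

lemma pre_comp_src : I.pre.comp a b h ≫ I.src = a ≫ I.src :=
  haveI := I.hasPullback I.src
  I.lift_mul_src h

lemma pre_comp_tgt : I.pre.comp a b h ≫ I.tgt = b ≫ I.tgt :=
  haveI := I.hasPullback I.src
  I.lift_mul_tgt h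

lemma pre_comp_map : I.pre.comp a b h ≫ I.map = (a ≫ I.map) ⋆ (b ≫ I.map) :=
  haveI := I.hasPullback I.src
  I.lift_mul_map h

end

/-- The groupoid induced by `G` on `X`. -/
noncomputable def groupoid : IntGroupoid J where
  toPreGroupoid := I.pre
  unit_src := I.one_src
  unit_tgt := I.one_tgt
  comp_src _ _ h := I.pre_comp_src h
  comp_tgt _ _ h := I.pre_comp_tgt h
  unit_comp a h := I.hom_ext ((I.pre_comp_src h).trans (I.comp_one_src a I.src))
    (I.pre_comp_tgt h) ((I.pre_comp_map h).trans (I.one_star_map a))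
  comp_unit a h := I.hom_ext (I.pre_comp_src h)
    ((I.pre_comp_tgt h).trans (I.comp_one_tgt a I.tgt))
    ((I.pre_comp_map h).trans (I.star_one_map a))
  comp_assoc a _ c h₁ h₂ h₃ h₄ := I.hom_ext
    ((I.pre_comp_src h₂).trans ((I.pre_comp_src h₁).trans (I.pre_comp_src h₄).symm))
    ((I.pre_comp_tgt h₂).trans ((I.pre_comp_tgt h₄).trans (I.pre_comp_tgt h₃)).symm)
    ((I.pre_comp_map h₂).trans <| (congrArg (· ⋆ (c ≫ I.map)) (I.pre_comp_map h₁)).trans <|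
      (star_assoc (I.map_tgt_eq h₁) (I.map_tgt_eq h₃)).trans <|
        (congrArg ((a ≫ I.map) ⋆ ·) (I.pre_comp_map h₃)).symm.trans (I.pre_comp_map h₄).symm)
  inv_src := I.opp_src
  inv_tgt := I.opp_tgt
  comp_inv a h := I.hom_ext
    ((I.pre_comp_src h).trans (I.comp_one_src a I.src).symm)
    ((I.pre_comp_tgt h).trans ((I.comp_opp_tgt a).trans (I.comp_one_tgt a I.src).symm))
    ((I.pre_comp_map h).trans (I.star_opp_map a))
  inv_comp a h := I.hom_ext
    ((I.pre_comp_src h).trans ((I.comp_opp_src a).trans (I.comp_one_src a I.tgt).symm))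
    ((I.pre_comp_tgt h).trans (I.comp_one_tgt a I.tgt).symm)
    ((I.pre_comp_map h).trans (I.opp_star_map a))

/-- The projection of the induced groupoid. -/
noncomputable def proj : I.groupoid ⟶ G :=
  homOfComp (H := I.groupoid) q I.map I.map_src I.map_tgt fun a b h =>
    (congrArg (· ≫ I.map) (comp_eq_star (G := I.groupoid) a b h)).symm.trans (I.pre_comp_map h)

lemma fullyFaithful_proj : FullyFaithful I.proj := fun _ x y γ h h' =>
  ⟨I.lift x y γ h h', ⟨I.lift_src .., I.lift_tgt .., I.lift_map ..⟩, fun _ hη =>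
    I.hom_ext (hη.1.trans (I.lift_src ..).symm) (hη.2.1.trans (I.lift_tgt ..).symm)
      (hη.2.2.trans (I.lift_map ..).symm)⟩

lemma locallyEssSurj_proj (hq : LocallySplit J q) : LocallyEssSurj I.proj :=
  Locally.mono hq fun _ z ⟨l, hl⟩ => ⟨l, z ≫ G.unit,
    by rw [Category.assoc, G.unit_src, Category.comp_id]; exact hl.symm, by simp [G.unit_tgt]⟩

end Induced

/-! ### Lifting along fully faithful arrows and homotopy pullbacks -/

/-- A strict arrow `f` to the target of a fully faithful arrow `φ` lifts along `φ`, up to a natural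
transformation, if its object part does. -/
lemma FullyFaithful.exists_lift {φ : H ⟶ G} (hφ : FullyFaithful φ) (f : K ⟶ G) (y : K.Ob ⟶ H.Ob)
    (γ : K.Ob ⟶ G.Ar) (h : γ ≫ G.src = y ≫ φ.ob) (h' : γ ≫ G.tgt = f.ob) :
    ∃ g : K ⟶ H, Nonempty (Trans (g ≫ φ) f) := by
  have e₁ : (K.src ≫ γ) ≫ G.tgt = f.ar ≫ G.src := by rw [Category.assoc, h', f.ar_src]
  have e₂ : f.ar ≫ G.tgt = ((K.tgt ≫ γ) ≫ G.inv) ≫ G.src := by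
    rw [Category.assoc, G.inv_src, Category.assoc, h', f.ar_tgt]
  have e₃ : (K.src ≫ γ) ≫ G.tgt = (f.ar ⋆ ((K.tgt ≫ γ) ≫ G.inv)) ≫ G.src := by
    rw [star_src e₂, e₁]
  have e₄ : (f.ar ⋆ ((K.tgt ≫ γ) ≫ G.inv)) ≫ G.tgt = (K.tgt ≫ γ) ≫ G.src := by
    rw [star_tgt e₂, Category.assoc, G.inv_tgt]
  obtain ⟨g, ⟨g_src, g_tgt, g_ar⟩, -⟩ := hφ (K.src ≫ y) (K.tgt ≫ y)
    ((K.src ≫ γ) ⋆ f.ar ⋆ ((K.tgt ≫ γ) ≫ G.inv))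
    (by rw [star_src e₃, Category.assoc, h, Category.assoc])
    (by rw [star_tgt e₃, e₄, Category.assoc, h, Category.assoc])
  -- the arrow part of the lift is the only one for which `γ` is natural
  have nat : (K.src ≫ γ) ⋆ f.ar = (g ≫ φ.ar) ⋆ (K.tgt ≫ γ) := by
    rw [g_ar, star_assoc e₃ e₄, star_assoc e₂ (by simp [G.inv_tgt]), inv_star, star_unit]
    rw [e₂, Category.assoc, G.inv_src]
  have e₅ : (g ≫ φ.ar) ≫ G.tgt = (K.tgt ≫ γ) ≫ G.src := by
    rw [Category.assoc, φ.ar_tgt, reassoc_of% g_tgt, Category.assoc, h]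
  have nat' : ∀ {T : C} (a : T ⟶ K.Ar), (a ≫ K.src ≫ γ) ⋆ (a ≫ f.ar) =
      (a ≫ g ≫ φ.ar) ⋆ (a ≫ K.tgt ≫ γ) := fun a => by
    rw [← comp_star _ e₁, nat, comp_star _ e₅]
  have map_star : ∀ {T : C} (a b : T ⟶ K.Ar), a ≫ K.tgt = b ≫ K.src →
      (a ⋆ b) ≫ g = (a ≫ g) ⋆ (b ≫ g) := by
    intro T a b hab
    have hg : (a ≫ g) ≫ H.tgt = (b ≫ g) ≫ H.src := by
      rw [Category.assoc, g_tgt, Category.assoc, g_src, reassoc_of% hab]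
    have hf : (a ≫ f.ar) ≫ G.tgt = (b ≫ f.ar) ≫ G.src := by
      rw [Category.assoc, Category.assoc, f.ar_src, f.ar_tgt, reassoc_of% hab]
    have hgφ : (a ≫ g ≫ φ.ar) ≫ G.tgt = (b ≫ g ≫ φ.ar) ≫ G.src := by
      rw [Category.assoc, e₅, Category.assoc, Category.assoc, Category.assoc, φ.ar_src,
        reassoc_of% g_src, h, reassoc_of% hab]
    have hs : ∀ c : T ⟶ K.Ar, (c ≫ K.src ≫ γ) ≫ G.tgt = (c ≫ f.ar) ≫ G.src := fun c => by
      simpa using c ≫= e₁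
    have ht : ∀ c : T ⟶ K.Ar, (c ≫ g ≫ φ.ar) ≫ G.tgt = (c ≫ K.tgt ≫ γ) ≫ G.src := fun c => by
      simpa using c ≫= e₅
    refine hφ.ext ?_ ?_ ?_
    · rw [star_src hg, Category.assoc, Category.assoc, g_src, reassoc_of% (star_src hab)]
    · rw [star_tgt hg, Category.assoc, Category.assoc, g_tgt, reassoc_of% (star_tgt hab)]
    · rw [star_ar _ hg]
      simp only [Category.assoc]
      refine star_right_cancel (c := b ≫ K.tgt ≫ γ) ?_ ?_ ?_
      · have := ht (a ⋆ b)
        rwa [reassoc_of% (star_tgt hab)] at this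
      · rw [star_tgt hgφ, ht]
      · have n := nat' (a ⋆ b)
        rw [reassoc_of% (star_tgt hab), reassoc_of% (star_src hab)] at n
        rw [← n, star_ar _ hab, star_assoc hgφ (ht b), ← nat' b, ← reassoc_of% hab,
          ← star_assoc (hs a) hf, nat' a, star_assoc (ht a)]
        rw [reassoc_of% hab, hs b]
  refine ⟨homOfComp y g g_src g_tgt map_star,
    ⟨{ app := γ, app_src := h, app_tgt := h', naturality := nat }⟩⟩

/-- A cospan one of whose sides is an essential equivalence has a homotopy pullback: its objects are
the objects `z` of `K` together with an arrow from an object in the image of `φ` to `f z`. -/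
lemma IsEssentialEquivalence.exists_square [J.HasIsos] {φ : H ⟶ G} (hφ : IsEssentialEquivalence φ)
    (f : K ⟶ G) : ∃ (P : IntGroupoid J) (p : P ⟶ K) (g : P ⟶ H),
      FullyFaithful p ∧ LocallyEssSurj p ∧ Nonempty (Trans (g ≫ φ) (p ≫ f)) := by
  have := hφ.essSurj.hasPullback f.ob
  have hq := IsPullback.of_hasPullback (pullback.fst G.src φ.ob ≫ G.tgt) f.ob
  have : ∀ {Y : C} (z : Y ⟶ K.Ob),
      HasPullback (pullback.snd (pullback.fst G.src φ.ob ≫ G.tgt) f.ob) z := fun z => by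
    have := hφ.essSurj.hasPullback (z ≫ f.ob)
    exact (IsPullback.of_right (h₁₁ := pullback.lift (pullback.fst _ (z ≫ f.ob))
      (pullback.snd _ _ ≫ z) (by rw [pullback.condition, Category.assoc]))
      (by rw [pullback.lift_fst]; exact .of_hasPullback _ _) (pullback.lift_snd _ _ _)
      hq).hasPullback
  let I := Induced.ofHasPullback K (pullback.snd (pullback.fst G.src φ.ob ≫ G.tgt) f.ob)
  have h₁ : (pullback.fst (pullback.fst G.src φ.ob ≫ G.tgt) f.ob ≫ pullback.fst _ _) ≫ G.src =
      (pullback.fst (pullback.fst G.src φ.ob ≫ G.tgt) f.ob ≫ pullback.snd _ _) ≫ φ.ob := by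
    rw [Category.assoc, pullback.condition, Category.assoc]
  have h₂ : (pullback.fst (pullback.fst G.src φ.ob ≫ G.tgt) f.ob ≫ pullback.fst _ _) ≫ G.tgt =
      pullback.snd _ _ ≫ f.ob := by
    rw [Category.assoc, pullback.condition]
  have hφ' : FullyFaithful φ := fun _ => hφ.fullyFaithful
  obtain ⟨g, hg⟩ := hφ'.exists_lift (I.proj ≫ f) _ _ h₁ h₂
  exact ⟨_, I.proj, g, I.fullyFaithful_proj, I.locallyEssSurj_proj (hφ.essSurj.universal hq).2, hg⟩

end IntGroupoid
end IntGpd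

namespace IntGpd

/-! ### The bicalculus of fractions -/

namespace IntGroupoid

variable {C : Type u} [Category.{v} C] {J : Precoverage C} [J.HasIsos]
local infixr:75 " ⋆ " => star

open Bicategory

variable {a b c : AHG₂ J} {f g : a ⟶ b} {w : b ⟶ c}

/-- Whiskering with a fully faithful arrow is faithful on 2-cells. -/
lemma FullyFaithful.whiskerRight_injective (hw : FullyFaithful w.arrow) {η θ : f ⟶ g}
    (h : η ▷ w = θ ▷ w) : η = θ := by
  refine component_injective (hw.ext ?_ ?_ ?_)
  · rw [component_src, component_src]
  · rw [component_tgt, component_tgt]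
  · rw [← component_whiskerRight, h, component_whiskerRight]

/-- Whiskering with a fully faithful arrow is full on 2-cells. -/
lemma FullyFaithful.exists_whiskerRight (hw : FullyFaithful w.arrow) (α : f ≫ w ⟶ g ≫ w) :
    ∃ β : f ⟶ g, β ▷ w = α := by
  obtain ⟨γ, ⟨γ_src, γ_tgt, γ_ar⟩, -⟩ := hw f.arrow.ob g.arrow.ob (component α) (component_src α)
    (component_tgt α)
  have h₁ : (a.as.src ≫ γ) ≫ b.as.tgt = g.arrow.ar ≫ b.as.src := by
    rw [Category.assoc, γ_tgt, g.arrow.ar_src]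
  have h₂ : f.arrow.ar ≫ b.as.tgt = (a.as.tgt ≫ γ) ≫ b.as.src := by
    rw [Category.assoc, γ_src, f.arrow.ar_tgt]
  let β : Trans f.arrow g.arrow :=
    { app := γ
      app_src := γ_src
      app_tgt := γ_tgt
      naturality := by
        refine hw.ext ?_ ?_ ?_
        · rw [star_src h₁, star_src h₂, Category.assoc, γ_src, f.arrow.ar_src]
        · rw [star_tgt h₁, star_tgt h₂, Category.assoc, γ_tgt, g.arrow.ar_tgt]
        · rw [star_ar _ h₁, star_ar _ h₂, Category.assoc, Category.assoc, γ_ar]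
          exact component_naturality α }
  refine ⟨(cellEquiv f g).symm β, component_injective ?_⟩
  rw [component_whiskerRight, component, Equiv.apply_symm_apply]
  exact γ_ar

/-- The essential homotopy equivalences admit a bicalculus of fractions. Two-cells lift uniquely
along fully faithful arrows, so that the 2-cell conditions hold without refining the domain. -/
theorem bicalculusOfFractions [J.HasPullbacks] [J.IsStableUnderBaseChange]
    [J.IsStableUnderComposition] (hsub : Subcanonical J) (hdesc : EffectiveDescent J) :
    BicalculusOfFractions (essentialHomotopyEquivalences J) := by
  have iff : ∀ {a b : AHG₂ J} (f : a ⟶ b), essentialHomotopyEquivalences J f ↔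
      FullyFaithful f.arrow ∧ LocallyEssSurj f.arrow :=
    fun f => isEssentialHomotopyEquivalence_iff hsub hdesc
  have comp : ∀ {a b c : AHG₂ J} (f : a ⟶ b) (g : b ⟶ c), essentialHomotopyEquivalences J f →
      essentialHomotopyEquivalences J g → essentialHomotopyEquivalences J (f ≫ g) :=
    fun f g hf hg => (iff _).2
      ⟨((iff f).1 hf).1.comp ((iff g).1 hg).1, ((iff f).1 hf).2.comp ((iff g).1 hg).2⟩
  have iso : ∀ {a b : AHG₂ J} (f g : a ⟶ b), (f ≅ g) → essentialHomotopyEquivalences J f →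
      essentialHomotopyEquivalences J g := fun f g e hf => (iff _).2
    ⟨((iff f).1 hf).1.of_trans (cellEquiv f g e.hom),
      ((iff f).1 hf).2.of_trans (cellEquiv f g e.hom)⟩
  have square : ∀ {a b c : AHG₂ J} (w : a ⟶ b) (f : c ⟶ b), essentialHomotopyEquivalences J w →
      ∃ (p : AHG₂ J) (w' : p ⟶ c) (f' : p ⟶ a), essentialHomotopyEquivalences J w' ∧
        Nonempty (w' ≫ f ≅ f' ≫ w) := by
    intro a b c w f hw
    obtain ⟨h₁, h₂⟩ := (iff w).1 hw
    obtain ⟨P, p, g, hp, hp', ⟨α⟩⟩ :=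
      (h₁.isEssentialEquivalence hsub hdesc h₂).exists_square f.arrow
    exact ⟨⟨P⟩, ⟨p⟩, ⟨g⟩, (iff _).2 ⟨hp, hp'⟩, ⟨(Trans.cellIso α).symm⟩⟩
  exact
    { equivalence := fun a b f ⟨g, ⟨e⟩, ⟨e'⟩⟩ => (iff f).2
        (fullyFaithful_and_locallyEssSurj_of_trans (cellEquiv _ _ e.hom) (cellEquiv _ _ e'.hom))
      comp := fun _ _ _ => comp
      square := fun _ _ _ => square
      lift := by
        intro a b c f g w α hw
        obtain ⟨β, hβ⟩ := ((iff w).1 hw).1.exists_whiskerRight α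
        refine ⟨⟨a, 𝟙 a, (iff _).2 ⟨.id _, .id _⟩, (λ_ f).hom ≫ β ≫ (λ_ g).inv, ?_⟩,
          fun _ => inferInstance⟩
        simp [← hβ]
      lift_unique := by
        intro a b c f g w α hw L L'
        obtain ⟨q, s', s, hs', ⟨e⟩⟩ := square L.v L'.v L.mem
        have h' := comp s' L'.v hs' L'.mem
        refine ⟨q, s, s', e.symm, iso _ _ e h', h', ?_⟩
        have k : L.β ▷ w = (α_ L.v f w).hom ≫ L.v ◁ α ≫ (α_ L.v g w).inv := by simp [L.comm]
        have k' : L'.β ▷ w = (α_ L'.v f w).hom ≫ L'.v ◁ α ≫ (α_ L'.v g w).inv := by simp [L'.comm]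
        -- after whiskering with `w`, both sides are the horizontal composite of `e` and `α`
        refine ((iff w).1 hw).1.whiskerRight_injective ?_
        have x := whisker_exchange e.inv α
        simpa [k, k'] using
          (α_ (s ≫ L.v) f w).hom ≫= x =≫ (α_ (s' ≫ L'.v) g w).inv
      iso := fun _ _ f g ⟨e⟩ => iso f g e }

end IntGroupoid
end IntGpd

theorem mainTheorem4 {C : Type u} [Category.{v} C] (J : Precoverage C) [J.HasIsos]
    [J.HasPullbacks] [J.IsStableUnderBaseChange] [J.IsStableUnderComposition]
    (hsub : IntGpd.Subcanonical J) (hdesc : IntGpd.EffectiveDescent J) :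
    IntGpd.BicalculusOfFractions (IntGpd.essentialHomotopyEquivalences J) ∧
      ∃ (B : Type (max u v)) (_ : Bicategory.{max u v, max u v} B)
        (U : Pseudofunctor (IntGpd.AHG₂ J) B),
        IntGpd.IsLocalization.{v, max u v, w₃, v, max u v, v₃, max u v, max u v, u₃}
          (IntGpd.essentialHomotopyEquivalences J) U :=
  ⟨IntGpd.IntGroupoid.bicalculusOfFractions hsub hdesc,
    IntGpd.FormalLoc (IntGpd.essentialHomotopyEquivalences J), inferInstance,
    IntGpd.FormalLoc.incl _, IntGpd.FormalLoc.isLocalization_incl _⟩
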